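/- For a real symmetric $n\times n$ matrix $A$ and an integer $m\ge 1$, let $\mathrm{tr}_m^G(A)=\frac1m\sum_{j=1}^m z_j^TAz_j$, where $z_1,\dots,z_m$ are independent standard Gaussian vectors in $\mathbb{R}^n$. For $0<\lambda\le\phi$ put $\rho=\phi^2/\lambda^2$ and $$A_{\mathrm{abs}}(\lambda,\phi)=\lambda\,\mathrm{diag}\bigl(1,\dots,1,\sqrt{\rho-\lfloor\rho\rfloor},0,\dots,0\bigr)$$ with $\lfloor\rho\rfloor$ ones, padded with zeros to a square matrix of the required size (the size being at least $\rho$). Theorem. Let $m\ge 1$ and $0<\lambda\le\phi$. There is a real number $\varepsilon_{\mathrm{abs}}$, depending only on $m,\lambda,\phi$, such that for every $n$, every symmetric $A\in\mathbb{R}^{n\times n}$ with spectral norm $\|A\|_2=\lambda$ and Frobenius norm $\|A\|_F=\phi$, and every $\varepsilon\ge\varepsilon_{\mathrm{abs}}$, $$\Pr\bigl(|\mathrm{tr}_m^G(A)-\mathrm{tr}(A)|\ge\varepsilon\bigr)\le 2\Pr\bigl(\mathrm{tr}_m^G(A_{\mathrm{abs}})-\mathrm{tr}(A_{\mathrm{abs}})\ge\varepsilon\bigr)\le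 2\Pr\bigl(X-\mathbb{E}[X]\ge\varepsilon\bigr),$$ where $A_{\mathrm{abs}}=A_{\mathrm{abs}}(\lambda,\phi)$ is taken of size $n\times n$ and $X\sim\mathrm{Gamma}\bigl(\frac{m\rho}{2},\frac{m}{2\lambda}\bigr)$ (shape, rate); here $\rho=\phi^2/\lambda^2$ is the stable rank of $A$. -/

import Mathlib

open MeasureTheory ProbabilityTheory Matrix

noncomputable section

namespace TraceEst

section SpectralNorm
open scoped Matrix.Norms.L2Operator

/-- The spectral norm `‖A‖₂` (operator norm for the Euclidean norm). -/
def specNorm {n : ℕ} (A : Matrix (Fin n) (Fin n) ℝ) : ℝ := ‖A‖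

end SpectralNorm

section FrobeniusNorm
open scoped Matrix.Norms.Frobenius

/-- The Frobenius norm `‖A‖_F`. -/
def frobNorm {n : ℕ} (A : Matrix (Fin n) (Fin n) ℝ) : ℝ := ‖A‖

end FrobeniusNorm

/-- Sanity check: `‖A‖₂` is the operator norm of `A` acting on Euclidean space. -/
theorem specNorm_eq {n : ℕ} (A : Matrix (Fin n) (Fin n) ℝ) :
    specNorm A = ‖Matrix.toEuclideanCLM (n := Fin n) (𝕜 := ℝ) A‖ := rfl

/-- Sanity check: `‖A‖_F` is the square root of the sum of the squared entries. -/
theorem frobNorm_eq {n : ℕ} (A : Matrix (Fin n) (Fin n) ℝ) :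
    frobNorm A = √(∑ i, ∑ j, A i j ^ 2) := by
  rw [frobNorm, Matrix.frobenius_norm_def, Real.sqrt_eq_rpow]
  simp

/-- The Gaussian trace estimator `(1/m) ∑ⱼ zⱼᵀ A zⱼ`, as a function of the sample vectors
`z₁, …, zₘ`. -/
def gaussTr {n : ℕ} (m : ℕ) (A : Matrix (Fin n) (Fin n) ℝ)
    (z : Fin m → EuclideanSpace ℝ (Fin n)) : ℝ :=
  (1 / (m : ℝ)) * ∑ j, (z j).ofLp ⬝ᵥ (A *ᵥ (z j).ofLp)

/-- The joint law of `m` independent standard Gaussian vectors in `ℝⁿ`. -/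
def sampleLaw (m n : ℕ) : Measure (Fin m → EuclideanSpace ℝ (Fin n)) :=
  Measure.pi fun _ => stdGaussian (EuclideanSpace ℝ (Fin n))

/-- `ρ = φ² / λ²`. -/
def rho (lam phi : ℝ) : ℝ := phi ^ 2 / lam ^ 2

/-- The `n × n` matrix `A_abs(λ, φ) = λ · diag(1, …, 1, √(ρ - ⌊ρ⌋), 0, …, 0)` with `⌊ρ⌋` ones.
All the nonzero entries fit as soon as `ρ ≤ n`, which holds with `λ = ‖A‖₂ > 0` and `φ = ‖A‖_F`
for every `n × n` matrix `A`. -/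
def Aabs (n : ℕ) (lam phi : ℝ) : Matrix (Fin n) (Fin n) ℝ :=
  lam • Matrix.diagonal fun i : Fin n =>
    if (i : ℕ) < ⌊rho lam phi⌋₊ then 1
    else if (i : ℕ) = ⌊rho lam phi⌋₊ then √(rho lam phi - ⌊rho lam phi⌋₊)
    else 0

end TraceEst

end

/-! After diagonalization the centered estimator is `∑ a (z_a² - 1)`, where each number
(eigenvalue)/m occurs m times. The claim is that, far out, its tail grows when the squares of the
coefficients are concentrated on fewer coefficients. The extremal family under the constraints |a| ≤
λ/m and fixed sum of squares then consists of copies of λ/m and one remainder per copy of the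
spectrum: the spectrum of `Aabs`.

Monotonicity comes from rotating two coefficients, a = r sin τ and b = r cos τ. Two Gaussian
integrations by parts in each variable give (`hasDerivAt_integral_chi`) that the τ-derivative of E
h(Q) is 4ab(a - b) E h'''(Q'), where Q' is the form in which a and b have three degrees of freedom
each. When h is a smooth step ending at ε, h' is a nonnegative bump near ε, and E h''' ≥ 0 says that
the density of Q' is convex there, tested weakly.

Tail convexity rests on bell shape: the second derivative of the density has sign pattern + - +. The
moment generating function of a form with nonnegative coefficients is a product of factors (1 -
2ua)^(-1/2). Pairing consecutive sorted coefficients turns it into a Stieltjes function times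
factors of exponential variables (`exists_mixture`). Hence a quadratic form is a mixture of laws s E
- s' E' plus independent signed exponentials (`QuadMGF.exists_decomp`). The mixture is bell shaped
by inspection, and exponential convolution diminishes variation (`NoMPM.expC`). If the second
derivative of such a density were negative far out, the density would stay comparable to its central
values on a long stretch (`half_le_of_neg_secondDeriv`), contradicting a Chernoff bound that depends
only on the sum of squares. So the threshold is uniform in n and A.

The first inequality is the union bound for A and -A, which satisfy the same constraints. For the
second, the extremal form is, up to centering, a gamma variable plus a gamma variable of larger
rate, and its tail is eventually below that of the single gamma law by comparison of densities
(`exists_conv_Ici_le`). -/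

namespace TraceEst

open Real Filter Topology
open scoped MeasureTheory NNReal ENNReal

/-! ### Uniqueness of measures from moment generating functions. -/

/-- Two probability measures on `ℝ` whose moment generating functions are finite and agree near
zero coincide. -/
theorem measure_ext_of_mgf_near_zero {μ ν : Measure ℝ} [IsProbabilityMeasure μ]
    [IsProbabilityMeasure ν] {δ : ℝ} (hδ : 0 < δ)
    (hμ : ∀ u : ℝ, |u| < δ → Integrable (fun x => exp (u * x)) μ)
    (hν : ∀ u : ℝ, |u| < δ → Integrable (fun x => exp (u * x)) ν)
    (h : ∀ u : ℝ, |u| < δ → ∫ x, exp (u * x) ∂μ = ∫ x, exp (u * x) ∂ν) : μ = ν := by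
  have hsub (ρ : Measure ℝ) (hρ : ∀ u : ℝ, |u| < δ → Integrable (fun x => exp (u * x)) ρ) :
      Set.Ioo (-δ) δ ⊆ interior (integrableExpSet id ρ) := by
    refine interior_maximal (fun u hu => ?_) isOpen_Ioo
    exact hρ u (abs_lt.2 hu)
  have hX : AnalyticOnNhd ℂ (complexMGF id μ) {z | z.re ∈ Set.Ioo (-δ) δ} :=
    analyticOnNhd_complexMGF.mono fun z hz => hsub μ hμ hz
  have hY : AnalyticOnNhd ℂ (complexMGF id ν) {z | z.re ∈ Set.Ioo (-δ) δ} :=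
    analyticOnNhd_complexMGF.mono fun z hz => hsub ν hν hz
  -- Both functions are analytic on the vertical strip and agree at real points accumulating at 0.
  -- The strip contains the imaginary axis, where they are the characteristic functions.
  have heq : Set.EqOn (complexMGF id μ) (complexMGF id ν) {z | z.re ∈ Set.Ioo (-δ) δ} := by
    refine AnalyticOnNhd.eqOn_of_preconnected_of_frequently_eq hX hY
      ((convex_Ioo (-δ) δ).linear_preimage Complex.reLm).isPreconnected
      (z₀ := ((0 : ℝ) : ℂ)) (by simp [hδ]) ?_
    have h_real : ∃ᶠ (x : ℝ) in 𝓝[≠] (0 : ℝ), complexMGF id μ x = complexMGF id ν x := by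
      refine Eventually.frequently ?_
      have : ∀ᶠ x : ℝ in 𝓝 (0 : ℝ), |x| < δ := by
        have := (continuous_abs (G := ℝ)).tendsto 0
        rw [abs_zero] at this
        exact this.eventually_lt_const hδ
      filter_upwards [nhdsWithin_le_nhds this] with x hx
      rw [complexMGF_ofReal, complexMGF_ofReal]
      have := h x hx
      simp only [mgf, id]
      rw [this]
    rw [frequently_iff_seq_forall] at h_real ⊢
    obtain ⟨xs, hx_tendsto, hx_eq⟩ := h_real
    refine ⟨fun n => xs n, ?_, fun n => ?_⟩
    · rw [tendsto_nhdsWithin_iff] at hx_tendsto ⊢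
      constructor
      · exact (Complex.continuous_ofReal.tendsto 0).comp hx_tendsto.1
      · simpa using hx_tendsto.2
    · simp [hx_eq]
  refine Measure.ext_of_charFun (funext fun t => ?_)
  have h1 := heq (x := Complex.I * t) (by simp [hδ])
  simp only [complexMGF, id] at h1
  rw [charFun_apply_real, charFun_apply_real]
  calc _ = ∫ x, Complex.exp (Complex.I * t * x) ∂μ := by
        congr 1; ext x; congr 1; ring
    _ = _ := h1
    _ = _ := by congr 1; ext x; congr 1; ring

/-! ### Gaussian integrals and integration by parts. -/

/-- The standard Gaussian measure on the line. -/
noncomputable abbrev stdG : Measure ℝ := gaussianReal 0 1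

theorem integral_stdG (f : ℝ → ℝ) :
    ∫ x, f x ∂stdG = ∫ x, gaussianPDFReal 0 1 x * f x := by
  rw [integral_gaussianReal_eq_integral_smul (by norm_num)]
  rfl

theorem integrable_stdG_iff {f : ℝ → ℝ} :
    Integrable f stdG ↔ Integrable (fun x => gaussianPDFReal 0 1 x * f x) := by
  rw [stdG, gaussianReal_of_var_ne_zero _ (by norm_num),
    integrable_withDensity_iff_integrable_smul' (measurable_gaussianPDF 0 1)
      (ae_of_all _ fun x => by simp [gaussianPDF])]
  simp [toReal_gaussianPDF]

theorem gaussianPDFReal_std (x : ℝ) :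
    gaussianPDFReal 0 1 x = (√(2 * π))⁻¹ * exp (-(x ^ 2 / 2)) := by
  simp [gaussianPDFReal, neg_div]

theorem hasDerivAt_gaussianPDFReal_std (x : ℝ) :
    HasDerivAt (gaussianPDFReal 0 1) (-x * gaussianPDFReal 0 1 x) x := by
  have h : gaussianPDFReal 0 1 = fun x => (√(2 * π))⁻¹ * exp (-(x ^ 2 / 2)) :=
    funext gaussianPDFReal_std
  rw [h]
  have h1 : HasDerivAt (fun x : ℝ => -(x ^ 2 / 2)) (-x) x := by
    have := ((hasDerivAt_pow 2 x).div_const 2).neg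
    convert! this using 1
    simp
  convert! (h1.exp.const_mul (√(2 * π))⁻¹) using 1
  ring

/-- Gaussian integration by parts. -/
theorem integral_mul_stdG {F F' : ℝ → ℝ} (hF : ∀ x, HasDerivAt F (F' x) x)
    (h0 : Integrable F stdG) (h1 : Integrable F' stdG) (h2 : Integrable (fun x => x * F x) stdG) :
    ∫ x, x * F x ∂stdG = ∫ x, F' x ∂stdG := by
  rw [integrable_stdG_iff] at h0 h1 h2
  rw [integral_stdG, integral_stdG]
  have := integral_mul_deriv_eq_deriv_mul_of_integrable (u := F) (u' := F')
    (v := gaussianPDFReal 0 1) (v' := fun x => -x * gaussianPDFReal 0 1 x)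
    (fun x _ => hF x) (fun x _ => hasDerivAt_gaussianPDFReal_std x)
    (h2.neg.congr (ae_of_all _ fun x => by simp; ring))
    (h1.congr (ae_of_all _ fun x => by simp; ring))
    (h0.congr (ae_of_all _ fun x => by simp; ring))
  have e1 : ∫ x, gaussianPDFReal 0 1 x * (x * F x) =
      - ∫ x, F x * (-x * gaussianPDFReal 0 1 x) := by
    rw [← integral_neg]; congr 1; ext x; ring
  rw [e1, this, neg_neg]
  congr 1; ext x; ring

theorem integrable_exp_sq_stdG {t : ℝ} (ht : 2 * t < 1) :
    Integrable (fun x => exp (t * x ^ 2)) stdG := by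
  rw [integrable_stdG_iff]
  have := (integrable_exp_neg_mul_sq (b := 1 / 2 - t) (by linarith)).const_mul (√(2 * π))⁻¹
  refine this.congr (ae_of_all _ fun x => ?_)
  simp only [gaussianPDFReal_std, mul_assoc, ← exp_add]
  ring_nf

theorem integral_exp_sq_stdG {t : ℝ} (ht : 2 * t < 1) :
    ∫ x, exp (t * x ^ 2) ∂stdG = (√(1 - 2 * t))⁻¹ := by
  rw [integral_stdG]
  have : ∀ x : ℝ, gaussianPDFReal 0 1 x * exp (t * x ^ 2) =
      (√(2 * π))⁻¹ * exp (-(1 / 2 - t) * x ^ 2) := fun x => by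
    simp only [gaussianPDFReal_std, mul_assoc, ← exp_add]
    ring_nf
  simp_rw [this]
  rw [integral_const_mul, integral_gaussian, ← Real.sqrt_inv, ← Real.sqrt_inv,
    ← Real.sqrt_mul (by positivity)]
  congr 1
  have : (1 / 2 - t) ≠ 0 := by linarith
  have : (1 - 2 * t) ≠ 0 := by linarith
  have := pi_pos.ne'
  field_simp

theorem sq_le_exp_mul_sq {δ : ℝ} (hδ : 0 < δ) (x : ℝ) : x ^ 2 ≤ δ⁻¹ * exp (δ * x ^ 2) := by
  have := add_one_le_exp (δ * x ^ 2)
  rw [← div_eq_inv_mul, le_div_iff₀ hδ]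
  linarith

theorem integrable_sq_mul_exp_sq_stdG {t : ℝ} (ht : 2 * t < 1) :
    Integrable (fun x => x ^ 2 * exp (t * x ^ 2)) stdG := by
  obtain ⟨δ, hδ, hδ'⟩ : ∃ δ > 0, 2 * (t + δ) < 1 := ⟨(1 - 2 * t) / 4, by linarith, by linarith⟩
  refine ((integrable_exp_sq_stdG hδ').const_mul δ⁻¹).mono' (by fun_prop) (ae_of_all _ fun x => ?_)
  rw [Real.norm_of_nonneg (by positivity), add_mul, add_comm, exp_add, ← mul_assoc]
  exact mul_le_mul_of_nonneg_right (sq_le_exp_mul_sq hδ x) (exp_pos _).le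

theorem integrable_mul_exp_sq_stdG {t : ℝ} (ht : 2 * t < 1) :
    Integrable (fun x => x * exp (t * x ^ 2)) stdG := by
  refine ((integrable_exp_sq_stdG ht).add (integrable_sq_mul_exp_sq_stdG ht)).mono'
    (by fun_prop) (ae_of_all _ fun x => ?_)
  simp only [norm_mul, Real.norm_eq_abs, abs_exp, Pi.add_apply]
  rw [← one_add_mul]
  refine mul_le_mul_of_nonneg_right ?_ (exp_pos _).le
  nlinarith [sq_abs x, sq_nonneg (|x| - 1)]

/-- Integration by parts for x e^(t x²) gives I = J + 2tI, where J is the integral without the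
factor x². -/
theorem integral_sq_mul_exp_sq_stdG {t : ℝ} (ht : 2 * t < 1) :
    ∫ x, x ^ 2 * exp (t * x ^ 2) ∂stdG = (√(1 - 2 * t))⁻¹ ^ 3 := by
  have hd (x : ℝ) : HasDerivAt (fun x => x * exp (t * x ^ 2))
      (exp (t * x ^ 2) + 2 * t * (x ^ 2 * exp (t * x ^ 2))) x := by
    have h1 : HasDerivAt (fun x : ℝ => t * x ^ 2) (t * (2 * x)) x := by
      simpa using (hasDerivAt_pow 2 x).const_mul t
    convert! (hasDerivAt_id x).mul h1.exp using 1
    simp only [id]; ring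
  have i1 := integrable_exp_sq_stdG ht
  have i2 := integrable_sq_mul_exp_sq_stdG ht
  have := integral_mul_stdG hd (integrable_mul_exp_sq_stdG ht) (i1.add (i2.const_mul _))
    (i2.congr (ae_of_all _ fun x => by ring))
  rw [integral_add i1 (i2.const_mul _), integral_const_mul, integral_exp_sq_stdG ht] at this
  have e : ∫ x, x * (x * exp (t * x ^ 2)) ∂stdG = ∫ x, x ^ 2 * exp (t * x ^ 2) ∂stdG := by
    congr 1; ext x; ring
  rw [e] at this
  set I := ∫ x, x ^ 2 * exp (t * x ^ 2) ∂stdG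
  have hs : 0 < √(1 - 2 * t) := Real.sqrt_pos.2 (by linarith)
  have hq : √(1 - 2 * t) ^ 2 = 1 - 2 * t := Real.sq_sqrt (by linarith)
  have h3 : I * √(1 - 2 * t) ^ 2 = (√(1 - 2 * t))⁻¹ := by rw [hq]; linarith
  rw [inv_pow]
  refine eq_inv_of_mul_eq_one_left ?_
  rw [pow_succ, ← mul_assoc, h3, inv_mul_cancel₀ hs.ne']

/-- Law of `a (z² - 1)` for a standard Gaussian `z`. -/
noncomputable def chi (a : ℝ) : Measure ℝ := stdG.map fun z => a * (z ^ 2 - 1)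

/-- Law of `a (z² - 1)` for `z` with density `z²` with respect to the standard Gaussian. -/
noncomputable def chiThree (a : ℝ) : Measure ℝ :=
  (stdG.withDensity fun z => ENNReal.ofReal (z ^ 2)).map fun z => a * (z ^ 2 - 1)

instance (a : ℝ) : IsProbabilityMeasure (chi a) :=
  Measure.isProbabilityMeasure_map (by fun_prop)

theorem integrable_sq_stdG : Integrable (fun x => x ^ 2) stdG := by
  simpa using integrable_sq_mul_exp_sq_stdG (t := 0) (by norm_num)

theorem integral_sq_stdG : ∫ x, x ^ 2 ∂stdG = 1 := by
  simpa using integral_sq_mul_exp_sq_stdG (t := 0) (by norm_num)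

theorem integral_chiThree {a : ℝ} {f : ℝ → ℝ} (hf : Measurable f) :
    ∫ x, f x ∂(chiThree a) = ∫ z, z ^ 2 * f (a * (z ^ 2 - 1)) ∂stdG := by
  rw [chiThree, integral_map (by fun_prop) hf.aestronglyMeasurable,
    integral_withDensity_eq_integral_toReal_smul (by fun_prop) (by simp)]
  simp [ENNReal.toReal_ofReal, sq_nonneg]

theorem integrable_chiThree {a : ℝ} {f : ℝ → ℝ} (hf : Measurable f) :
    Integrable f (chiThree a) ↔ Integrable (fun z => z ^ 2 * f (a * (z ^ 2 - 1))) stdG := by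
  rw [chiThree, integrable_map_measure hf.aestronglyMeasurable (by fun_prop),
    integrable_withDensity_iff_integrable_smul' (by fun_prop) (by simp)]
  simp [ENNReal.toReal_ofReal, sq_nonneg]

instance (a : ℝ) : IsProbabilityMeasure (chiThree a) := by
  have : IsProbabilityMeasure (stdG.withDensity fun z => ENNReal.ofReal (z ^ 2)) := by
    constructor
    rw [withDensity_apply _ MeasurableSet.univ, setLIntegral_univ,
      ← ofReal_integral_eq_lintegral_ofReal integrable_sq_stdG (ae_of_all _ fun x => sq_nonneg x),
      integral_sq_stdG, ENNReal.ofReal_one]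
  exact Measure.isProbabilityMeasure_map (by fun_prop)

/-! ### Laws of Gaussian quadratic forms, described by their coefficients. -/

/-- The measure `μ` is a probability measure with the moment generating function of
`c + ∑ a z_a²`, `a` running through the multiset `w`. -/
structure QuadMGF (μ : Measure ℝ) (w : Multiset ℝ) (c : ℝ) : Prop where
  prob : IsProbabilityMeasure μ
  integrable : ∀ u : ℝ, (∀ a ∈ w, |2 * u * a| < 1) → Integrable (fun x => exp (u * x)) μ
  integral_eq : ∀ u : ℝ, (∀ a ∈ w, |2 * u * a| < 1) →
    ∫ x, exp (u * x) ∂μ = exp (u * c) * (w.map fun a => (√(1 - 2 * u * a))⁻¹).prod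

theorem quadMGF_chi (a : ℝ) : QuadMGF (chi a) {a} (-a) := by
  have e (u z : ℝ) : exp (u * (a * (z ^ 2 - 1))) = exp (u * -a) * exp (u * a * z ^ 2) := by
    rw [← exp_add]; ring_nf
  refine ⟨inferInstance, fun u hu => ?_, fun u hu => ?_⟩
  · have hu' : 2 * (u * a) < 1 := by
      have := (abs_lt.1 (hu a (by simp))).2; linarith
    rw [chi, integrable_map_measure (by fun_prop) (by fun_prop)]
    exact ((integrable_exp_sq_stdG hu').const_mul _).congr (ae_of_all _ fun z => (e u z).symm)
  · have hu' : 2 * (u * a) < 1 := by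
      have := (abs_lt.1 (hu a (by simp))).2; linarith
    rw [chi, integral_map (by fun_prop) (by fun_prop)]
    simp_rw [e]
    rw [integral_const_mul, integral_exp_sq_stdG hu']
    simp [mul_assoc]

/-- The weight z² cubes the factor (1 - 2ua)^(-1/2), so a weighted variable counts as three Gaussian
ones. The shift stays -a, hence this law is not centered. -/
theorem quadMGF_chiThree (a : ℝ) : QuadMGF (chiThree a) {a, a, a} (-a) := by
  have e (u z : ℝ) : z ^ 2 * exp (u * (a * (z ^ 2 - 1))) =
      exp (u * -a) * (z ^ 2 * exp (u * a * z ^ 2)) := by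
    rw [mul_left_comm (exp _), ← exp_add]; ring_nf
  refine ⟨inferInstance, fun u hu => ?_, fun u hu => ?_⟩
  · have hu' : 2 * (u * a) < 1 := by
      have := (abs_lt.1 (hu a (by simp))).2; linarith
    rw [integrable_chiThree (by fun_prop)]
    exact ((integrable_sq_mul_exp_sq_stdG hu').const_mul _).congr
      (ae_of_all _ fun z => (e u z).symm)
  · have hu' : 2 * (u * a) < 1 := by
      have := (abs_lt.1 (hu a (by simp))).2; linarith
    rw [integral_chiThree (by fun_prop)]
    simp_rw [e]
    rw [integral_const_mul, integral_sq_mul_exp_sq_stdG hu']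
    simp [mul_assoc]
    ring

theorem quadMGF_dirac (c : ℝ) : QuadMGF (Measure.dirac c) 0 c :=
  ⟨inferInstance, fun u _ => integrable_dirac (by simp), fun u _ => by simp⟩

theorem integrable_exp_conv {μ ν : Measure ℝ} [SFinite μ] [SFinite ν] {u : ℝ}
    (hμ : Integrable (fun x => exp (u * x)) μ) (hν : Integrable (fun x => exp (u * x)) ν) :
    Integrable (fun x => exp (u * x)) (μ ∗ ν) := by
  rw [Measure.conv, integrable_map_measure (by fun_prop) (by fun_prop)]
  refine (hμ.mul_prod hν).congr (ae_of_all _ fun p => ?_)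
  simp [mul_add, exp_add]

theorem integral_exp_conv {μ ν : Measure ℝ} [SFinite μ] [SFinite ν] {u : ℝ} :
    ∫ x, exp (u * x) ∂(μ ∗ ν) = (∫ x, exp (u * x) ∂μ) * ∫ x, exp (u * x) ∂ν := by
  rw [Measure.conv, integral_map (by fun_prop) (by fun_prop), ← integral_prod_mul]
  simp [mul_add, exp_add]

theorem QuadMGF.conv {μ ν : Measure ℝ} {w w' : Multiset ℝ} {c c' : ℝ} (h : QuadMGF μ w c)
    (h' : QuadMGF ν w' c') : QuadMGF (μ ∗ ν) (w + w') (c + c') := by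
  have := h.prob
  have := h'.prob
  refine ⟨inferInstance, fun u hu => ?_, fun u hu => ?_⟩
  · exact integrable_exp_conv (h.integrable u fun a ha => hu a (by simp [ha]))
      (h'.integrable u fun a ha => hu a (by simp [ha]))
  · rw [integral_exp_conv, h.integral_eq u fun a ha => hu a (by simp [ha]),
      h'.integral_eq u fun a ha => hu a (by simp [ha]), Multiset.map_add, Multiset.prod_add,
      mul_add, exp_add]
    ring

theorem exists_pos_forall_abs_lt_one (w : Multiset ℝ) :
    ∃ δ > 0, ∀ u : ℝ, |u| < δ → ∀ a ∈ w, |2 * u * a| < 1 := by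
  induction w using Multiset.induction_on with
  | empty => exact ⟨1, one_pos, by simp⟩
  | cons b w ih =>
    obtain ⟨δ, hδ, h⟩ := ih
    refine ⟨min δ (1 / (2 * |b| + 1)), by positivity, fun u hu a ha => ?_⟩
    rcases Multiset.mem_cons.1 ha with rfl | ha
    · have h1 := hu.trans_le (min_le_right _ _)
      rw [lt_div_iff₀ (by positivity)] at h1
      rw [abs_mul, abs_mul, abs_two]
      nlinarith [abs_nonneg u, abs_nonneg a]
    · exact h u (hu.trans_le (min_le_left _ _)) a ha

/-- Finitely many coefficients leave a common neighbourhood of 0 where the moment generating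
function is finite. Identities between laws of forms thus reduce to matching coefficients and
shifts. -/
theorem QuadMGF.unique {μ ν : Measure ℝ} {w : Multiset ℝ} {c : ℝ} (h : QuadMGF μ w c)
    (h' : QuadMGF ν w c) : μ = ν := by
  have := h.prob
  have := h'.prob
  obtain ⟨δ, hδ, hw⟩ := exists_pos_forall_abs_lt_one w
  refine measure_ext_of_mgf_near_zero hδ (fun u hu => h.integrable u (hw u hu))
    (fun u hu => h'.integrable u (hw u hu)) fun u hu => ?_
  rw [h.integral_eq u (hw u hu), h'.integral_eq u (hw u hu)]

theorem exists_quadMGF (w : Multiset ℝ) : ∃ μ, QuadMGF μ w (-w.sum) := by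
  induction w using Multiset.induction_on with
  | empty => exact ⟨_, by simpa using quadMGF_dirac 0⟩
  | cons a w ih =>
    obtain ⟨μ, hμ⟩ := ih
    refine ⟨chi a ∗ μ, ?_⟩
    rw [Multiset.sum_cons, neg_add, ← Multiset.singleton_add]
    exact (quadMGF_chi a).conv hμ

/-- The law of `∑ a (z_a² - 1)`, `a` running through the multiset `w`, with independent standard
Gaussian variables `z_a`. -/
noncomputable def quadLaw (w : Multiset ℝ) : Measure ℝ := (exists_quadMGF w).choose

theorem quadMGF_quadLaw (w : Multiset ℝ) : QuadMGF (quadLaw w) w (-w.sum) :=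
  (exists_quadMGF w).choose_spec

instance (w : Multiset ℝ) : IsProbabilityMeasure (quadLaw w) := (quadMGF_quadLaw w).prob

theorem quadLaw_cons (a : ℝ) (w : Multiset ℝ) : quadLaw (a ::ₘ w) = chi a ∗ quadLaw w := by
  refine (quadMGF_quadLaw _).unique ?_
  rw [Multiset.sum_cons, neg_add, ← Multiset.singleton_add]
  exact (quadMGF_chi a).conv (quadMGF_quadLaw w)

end TraceEst

/-! ### Convolution with exponentials and preservation of sign patterns. -/

namespace TraceEst

open Real Filter Topology
open scoped MeasureTheory NNReal ENNReal

/-- The standard exponential distribution. -/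
noncomputable abbrev stdE : Measure ℝ := expMeasure 1

instance : IsProbabilityMeasure stdE := isProbabilityMeasure_expMeasure one_pos

theorem stdE_eq : stdE = (volume.restrict (Set.Ioi 0)).withDensity
    fun y => ENNReal.ofReal (exp (-y)) := by
  rw [stdE, expMeasure, gammaMeasure, ← withDensity_indicator measurableSet_Ioi]
  refine withDensity_congr_ae ?_
  filter_upwards [compl_mem_ae_iff.2 (measure_singleton (0 : ℝ))] with y hy
  rcases lt_or_gt_of_ne (show y ≠ 0 from hy) with h | h
  · rw [gammaPDF_of_neg h, Set.indicator_of_notMem (by simp [h.le])]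
  · rw [gammaPDF_of_nonneg h.le, Set.indicator_of_mem (by exact h)]
    simp

theorem integral_stdE (f : ℝ → ℝ) : ∫ y, f y ∂stdE = ∫ y in Set.Ioi 0, f y * exp (-y) := by
  rw [stdE_eq, integral_withDensity_eq_integral_toReal_smul (by fun_prop) (by simp)]
  simp [ENNReal.toReal_ofReal, (exp_pos _).le, mul_comm]

theorem integrable_stdE_iff (f : ℝ → ℝ) :
    Integrable f stdE ↔ IntegrableOn (fun y => f y * exp (-y)) (Set.Ioi 0) := by
  rw [stdE_eq, integrable_withDensity_iff_integrable_smul' (by fun_prop) (by simp)]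
  simp [ENNReal.toReal_ofReal, (exp_pos _).le, mul_comm, IntegrableOn]

/-- Bounded continuous real functions. -/
def BddCont (f : ℝ → ℝ) : Prop := Continuous f ∧ ∃ C, ∀ x, |f x| ≤ C

theorem BddCont.integrable {f : ℝ → ℝ} (hf : BddCont f) (μ : Measure ℝ) [IsFiniteMeasure μ] :
    Integrable f μ := by
  obtain ⟨hc, C, hC⟩ := hf
  exact (integrable_const C).mono' hc.aestronglyMeasurable (ae_of_all _ hC)

theorem BddCont.comp {f g : ℝ → ℝ} (hf : BddCont f) (hg : Continuous g) :
    BddCont fun x => f (g x) :=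
  ⟨hf.1.comp hg, hf.2.choose, fun x => hf.2.choose_spec (g x)⟩

theorem BddCont.add {f g : ℝ → ℝ} (hf : BddCont f) (hg : BddCont g) :
    BddCont fun x => f x + g x := by
  obtain ⟨hf, C, hC⟩ := hf
  obtain ⟨hg, D, hD⟩ := hg
  exact ⟨hf.add hg, C + D, fun x => (abs_add_le _ _).trans (add_le_add (hC x) (hD x))⟩

theorem BddCont.const_mul {f : ℝ → ℝ} (hf : BddCont f) (c : ℝ) :
    BddCont fun x => c * f x := by
  obtain ⟨hf, C, hC⟩ := hf
  exact ⟨by fun_prop, |c| * C, fun x => by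
    rw [abs_mul]; exact mul_le_mul_of_nonneg_left (hC x) (abs_nonneg c)⟩

theorem BddCont.sub {f g : ℝ → ℝ} (hf : BddCont f) (hg : BddCont g) :
    BddCont fun x => f x - g x := by
  simpa [sub_eq_add_neg] using hf.add (hg.const_mul (-1))

/-- Convolution with the law of `b * E`, `E` standard exponential. -/
noncomputable def expC (b : ℝ) (f : ℝ → ℝ) (x : ℝ) : ℝ := ∫ y, f (x - b * y) ∂stdE

theorem BddCont.expC {f : ℝ → ℝ} (hf : BddCont f) (b : ℝ) : BddCont (expC b f) := by
  obtain ⟨C, hC⟩ := hf.2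
  refine ⟨?_, C, fun x => ?_⟩
  · refine continuous_of_dominated (bound := fun _ => C) (fun x => ?_) (fun x => ?_)
      (integrable_const C) (ae_of_all _ fun y => ?_)
    · exact (hf.1.comp (by fun_prop)).aestronglyMeasurable
    · exact ae_of_all _ fun y => hC _
    · exact hf.1.comp (by fun_prop)
  · have := norm_integral_le_of_norm_le_const (μ := stdE) (C := C)
      (f := fun y => f (x - b * y)) (ae_of_all _ fun y => hC _)
    simpa [TraceEst.expC] using this

theorem expC_nonneg {f : ℝ → ℝ} (hf : ∀ x, 0 ≤ f x) (b x : ℝ) : 0 ≤ expC b f x :=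
  integral_nonneg fun _ => hf _

theorem expC_neg_arg (b : ℝ) (f : ℝ → ℝ) (x : ℝ) :
    expC b f (-x) = expC (-b) (fun t => f (-t)) x := by
  simp only [expC]
  congr 1; ext y; ring_nf

theorem integrableOn_Iic_mul_exp {f : ℝ → ℝ} (hf : BddCont f) {b : ℝ} (hb : 0 < b) (x : ℝ) :
    IntegrableOn (fun t => f t * exp (t / b)) (Set.Iic x) := by
  obtain ⟨C, hC⟩ := hf.2
  have h1 : IntegrableOn (fun t => exp (t / b)) (Set.Iic x) := by
    have := integrableOn_exp_mul_Iic (a := b⁻¹) (by positivity) x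
    simpa [div_eq_inv_mul] using this
  refine (h1.const_mul C).mono'
    ((hf.1.mul (by fun_prop)).aestronglyMeasurable) (ae_of_all _ fun t => ?_)
  rw [norm_mul, Real.norm_of_nonneg (exp_pos _).le]
  exact mul_le_mul_of_nonneg_right (hC t) (exp_pos _).le

/-- The substitution t = x - by shows that, up to a positive factor, the convolution is a primitive
of f e^(t/b). Its derivative and its sign pattern are both read off from this. -/
theorem expC_eq {b : ℝ} (hb : 0 < b) (f : ℝ → ℝ) (x : ℝ) :
    expC b f x = b⁻¹ * exp (-x / b) * ∫ t in Set.Iic x, f t * exp (t / b) := by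
  rw [integral_Iic_eq_integral_Iio, ← integral_indicator measurableSet_Iio]
  have h1 : ∫ t, (Set.Iio x).indicator (fun t => f t * exp (t / b)) t =
      b * ∫ y, (Set.Iio x).indicator (fun t => f t * exp (t / b)) (x - b * y) := by
    have := Measure.integral_comp_mul_left
      (fun s => (Set.Iio x).indicator (fun t => f t * exp (t / b)) (x - s)) b
    rw [this, integral_sub_left_eq_self _ volume x, abs_of_pos (by positivity), smul_eq_mul,
      ← mul_assoc, mul_inv_cancel₀ hb.ne', one_mul]
  rw [h1, expC, integral_stdE, ← integral_indicator measurableSet_Ioi]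
  have h2 : ∀ y, (Set.Iio x).indicator (fun t => f t * exp (t / b)) (x - b * y) =
      exp (x / b) * (Set.Ioi 0).indicator (fun y => f (x - b * y) * exp (-y)) y := fun y => by
    by_cases hy : 0 < y
    · rw [Set.indicator_of_mem (by simp [hb, hy]), Set.indicator_of_mem (by exact hy),
        mul_left_comm, ← exp_add]
      congr 2; field_simp; ring
    · rw [Set.indicator_of_notMem, Set.indicator_of_notMem (by exact hy), mul_zero]
      simp only [Set.mem_Iio, not_lt]
      nlinarith
  simp_rw [h2]
  rw [integral_const_mul]
  have : exp (-x / b) * exp (x / b) = 1 := by rw [← exp_add]; ring_nf; simp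
  generalize (∫ y, (Set.Ioi 0).indicator (fun y => f (x - b * y) * exp (-y)) y) = J
  linear_combination (-J * b⁻¹ * b) * this - J * mul_inv_cancel₀ hb.ne'

theorem hasDerivAt_expC {f : ℝ → ℝ} (hf : BddCont f) {b : ℝ} (hb : 0 < b) (x : ℝ) :
    HasDerivAt (expC b f) (b⁻¹ * (f x - expC b f x)) x := by
  have hI : HasDerivAt (fun x => ∫ t in Set.Iic x, f t * exp (t / b)) (f x * exp (x / b)) x := by
    have hc : Continuous fun t => f t * exp (t / b) := hf.1.mul (by fun_prop)
    have h1 := (intervalIntegral.integral_hasDerivAt_right (hc.intervalIntegrable 0 x)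
      (hc.stronglyMeasurableAtFilter _ _) hc.continuousAt).const_add
        (∫ t in Set.Iic 0, f t * exp (t / b))
    refine h1.congr_of_eventuallyEq (Eventually.of_forall fun y => ?_)
    have := intervalIntegral.integral_Iic_sub_Iic (integrableOn_Iic_mul_exp hf hb 0)
      (integrableOn_Iic_mul_exp hf hb y)
    simp only
    linarith
  have he : HasDerivAt (fun x => b⁻¹ * exp (-x / b)) (b⁻¹ * (exp (-x / b) * (-1 / b))) x :=
    (((hasDerivAt_id x).neg.div_const b).exp).const_mul _
  have h := he.mul hI
  have e : expC b f = fun x => b⁻¹ * exp (-x / b) * ∫ t in Set.Iic x, f t * exp (t / b) :=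
    funext (expC_eq hb f)
  rw [e]
  convert! h using 1
  have : exp (-x / b) * exp (x / b) = 1 := by rw [← exp_add]; ring_nf; simp
  simp only
  linear_combination (-b⁻¹ * f x) * this

/-- The function never takes negative, positive and negative values in this order. -/
def NoMPM (G : ℝ → ℝ) : Prop :=
  ∀ x₁ x₂ x₃, x₁ < x₂ → x₂ < x₃ → G x₁ < 0 → 0 < G x₂ → 0 ≤ G x₃

theorem NoMPM.comp_neg {G : ℝ → ℝ} (h : NoMPM G) : NoMPM fun x => G (-x) := by
  intro x₁ x₂ x₃ h12 h23 h1 h2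
  by_contra h3
  exact absurd h1 (not_lt.2 (h _ _ _ (neg_lt_neg h23) (neg_lt_neg h12) (not_le.1 h3) h2))

/-- A primitive vanishing at -∞ that is negative, then positive, then negative needs an integrand
with the same succession of signs at interlaced points. The positive factor in `expC_eq` does not
affect signs. -/
theorem NoMPM.expC_of_pos {H : ℝ → ℝ} (hH : BddCont H) (h : NoMPM H) {b : ℝ} (hb : 0 < b) :
    NoMPM (expC b H) := by
  intro x₁ x₂ x₃ h12 h23 h1 h2
  by_contra! h3
  have hpos (x : ℝ) : 0 < b⁻¹ * exp (-x / b) := by positivity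
  rw [expC_eq hb] at h1 h2 h3
  have h1' := neg_of_mul_neg_right h1 (hpos _).le
  have h2' := pos_of_mul_pos_right h2 (hpos _).le
  have h3' := neg_of_mul_neg_right h3 (hpos _).le
  have d12 := intervalIntegral.integral_Iic_sub_Iic (integrableOn_Iic_mul_exp hH hb x₁)
    (integrableOn_Iic_mul_exp hH hb x₂)
  have d23 := intervalIntegral.integral_Iic_sub_Iic (integrableOn_Iic_mul_exp hH hb x₂)
    (integrableOn_Iic_mul_exp hH hb x₃)
  obtain ⟨y₁, hy₁, hn₁⟩ : ∃ y ≤ x₁, H y < 0 := by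
    by_contra! hcon
    exact absurd h1' (not_lt.2 (setIntegral_nonneg measurableSet_Iic fun t ht =>
      mul_nonneg (hcon t ht) (exp_pos _).le))
  obtain ⟨y₂, hy₂, hy₂', hp₂⟩ : ∃ y, x₁ < y ∧ y ≤ x₂ ∧ 0 < H y := by
    by_contra! hcon
    have : ∫ t in x₁..x₂, H t * exp (t / b) ≤ 0 := by
      rw [intervalIntegral.integral_of_le h12.le]
      exact setIntegral_nonpos measurableSet_Ioc fun t ht =>
        mul_nonpos_of_nonpos_of_nonneg (hcon t ht.1 ht.2) (exp_pos _).le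
    linarith
  obtain ⟨y₃, hy₃, hn₃⟩ : ∃ y, x₂ < y ∧ H y < 0 := by
    by_contra! hcon
    have : 0 ≤ ∫ t in x₂..x₃, H t * exp (t / b) := by
      rw [intervalIntegral.integral_of_le h23.le]
      exact setIntegral_nonneg measurableSet_Ioc fun t ht =>
        mul_nonneg (hcon t ht.1) (exp_pos _).le
    linarith
  exact absurd hn₃ (not_lt.2 (h y₁ y₂ y₃ (by linarith) (by linarith) hn₁ hp₂))

/-- Convolution with exponential distributions is variation diminishing. -/
theorem NoMPM.expC {H : ℝ → ℝ} (hH : BddCont H) (h : NoMPM H) (b : ℝ) : NoMPM (expC b H) := by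
  rcases lt_trichotomy b 0 with hb | rfl | hb
  · have := (NoMPM.expC_of_pos (hH.comp continuous_neg) h.comp_neg (neg_pos.2 hb)).comp_neg
    have e : (fun x => TraceEst.expC (-b) (fun t => H (-t)) (-x)) = TraceEst.expC b H :=
      funext fun x => by rw [← expC_neg_arg, neg_neg]
    rwa [e] at this
  · have : TraceEst.expC 0 H = H := by ext x; simp [TraceEst.expC]
    rwa [this]
  · exact h.expC_of_pos hH hb

/-- Symmetric second difference. -/
def secDiff (h : ℝ) (f : ℝ → ℝ) (x : ℝ) : ℝ := f (x + h) + f (x - h) - 2 * f x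

theorem BddCont.secDiff {f : ℝ → ℝ} (hf : BddCont f) (h : ℝ) : BddCont (secDiff h f) :=
  ((hf.comp (continuous_id.add continuous_const)).add
    (hf.comp (continuous_id.sub continuous_const))).sub (hf.const_mul 2)

theorem secDiff_expC {f : ℝ → ℝ} (hf : BddCont f) (b h : ℝ) :
    secDiff h (expC b f) = expC b (secDiff h f) := by
  ext x
  have i (c : ℝ) : Integrable (fun y => f (c - b * y)) stdE :=
    (hf.comp (g := fun y => c - b * y) (by fun_prop)).integrable _
  simp only [secDiff, expC]
  have e (y : ℝ) : f (x - b * y + h) + f (x - b * y - h) - 2 * f (x - b * y) =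
      f (x + h - b * y) + f (x - h - b * y) - 2 * f (x - b * y) := by
    ring_nf
  simp_rw [e]
  have i1 : Integrable (fun y => f (x + h - b * y) + f (x - h - b * y)) stdE := (i _).add (i _)
  rw [integral_sub i1 ((i _).const_mul 2), integral_add (i _) (i _),
    integral_const_mul]

/-- The second derivative inherits the sign pattern of the second differences. -/
theorem NoMPM.of_secDiff {f f' f'' : ℝ → ℝ} (h1 : ∀ x, HasDerivAt f (f' x) x)
    (h2 : ∀ x, HasDerivAt f' (f'' x) x) (hc : Continuous f'')
    (h : ∀ t > 0, NoMPM (secDiff t f)) : NoMPM f'' := by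
  -- Where g'' > 0, g is strictly convex nearby, so small symmetric second differences are positive.
  -- A general g is allowed so that -f is covered too; one small t then serves all three points.
  have key (g g' g'' : ℝ → ℝ) (h1 : ∀ x, HasDerivAt g (g' x) x)
      (h2 : ∀ x, HasDerivAt g' (g'' x) x) (hc : Continuous g'') (x : ℝ) (hx : 0 < g'' x) :
      ∀ᶠ t in 𝓝[>] (0 : ℝ), 0 < secDiff t g x := by
    obtain ⟨r, hr, hball⟩ := Metric.eventually_nhds_iff_ball.1
      (hc.continuousAt.eventually (lt_mem_nhds hx))
    have hconv : StrictConvexOn ℝ (Set.Ioo (x - r) (x + r)) g := by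
      have hd : deriv g = g' := funext fun y => (h1 y).deriv
      have hd2 : deriv g' = g'' := funext fun y => (h2 y).deriv
      refine strictConvexOn_of_deriv2_pos (convex_Ioo _ _)
        (fun y _ => (h1 y).continuousAt.continuousWithinAt) fun y hy => ?_
      rw [interior_Ioo] at hy
      simp only [Function.iterate_succ, Function.iterate_zero, Function.comp, id, hd, hd2]
      refine hball y ?_
      rw [Real.ball_eq_Ioo]; exact hy
    filter_upwards [Ioo_mem_nhdsGT hr] with t ht
    have := hconv.2 (show x + t ∈ _ from ⟨by linarith [ht.1], by linarith [ht.2]⟩)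
      (show x - t ∈ _ from ⟨by linarith [ht.2], by linarith [ht.1]⟩) (by linarith [ht.1])
      (show (0 : ℝ) < 1 / 2 by norm_num) (show (0 : ℝ) < 1 / 2 by norm_num) (by norm_num)
    simp only [smul_eq_mul] at this
    have e : 1 / 2 * (x + t) + 1 / 2 * (x - t) = x := by ring
    rw [e] at this
    simp only [secDiff]; linarith
  have key' (x : ℝ) (hx : f'' x < 0) : ∀ᶠ t in 𝓝[>] (0 : ℝ), secDiff t f x < 0 := by
    filter_upwards [key (fun x => -f x) (fun x => -f' x) (fun x => -f'' x)
      (fun x => (h1 x).neg) (fun x => (h2 x).neg) hc.neg x (by linarith)] with t ht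
    simp only [secDiff] at ht ⊢; linarith
  intro x₁ x₂ x₃ h12 h23 hn1 hp2
  by_contra! hn3
  obtain ⟨t, ⟨⟨ha, hb⟩, hc⟩, ht⟩ := ((((key' x₁ hn1).and (key f f' f'' h1 h2 hc x₂ hp2)).and
    (key' x₃ hn3)).and self_mem_nhdsWithin).exists
  exact absurd hc (not_lt.2 (h t ht x₁ x₂ x₃ h12 h23 ha hb))

/-- A bounded nonnegative function whose second derivative has the pattern `+ - +` is large
to the left of a point where that derivative is negative. -/
theorem half_le_of_neg_secondDeriv {f f' f'' : ℝ → ℝ} (h1 : ∀ x, HasDerivAt f (f' x) x)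
    (h2 : ∀ x, HasDerivAt f' (f'' x) x) (h0 : ∀ x, 0 ≤ f x) (hb : ∃ C, ∀ x, f x ≤ C)
    (h : NoMPM f'') {p : ℝ} (hp : f'' p < 0) {y z : ℝ} (hyz : y ≤ z)
    (hz : 2 * z ≤ y + p) : f y / 2 ≤ f z := by
  have hd : deriv f = f' := funext fun y => (h1 y).deriv
  have hd2 : deriv f' = f'' := funext fun y => (h2 y).deriv
  have hcont : Continuous f := continuous_iff_continuousAt.2 fun x => (h1 x).continuousAt
  have hconcave (s : ℝ) (hs : ∀ t, s < t → t < p → f'' t ≤ 0) :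
      ConcaveOn ℝ (Set.Icc s p) f := by
    refine concaveOn_of_deriv2_nonpos (convex_Icc _ _) hcont.continuousOn
      (fun y _ => (h1 y).differentiableAt.differentiableWithinAt)
      (fun y _ => by rw [hd]; exact (h2 y).differentiableAt.differentiableWithinAt) fun t ht => ?_
    rw [interior_Icc] at ht
    simpa [hd, hd2] using hs t ht.1 ht.2
  -- The point b lies in the first half of [a, p], so the chord at b gives f(a) weight at least 1/2,
  -- and f(p) ≥ 0.
  have hconc (s a b : ℝ) (hs : ∀ t, s < t → t < p → f'' t ≤ 0) (hsa : s ≤ a) (hab : a ≤ b)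
      (hbp : 2 * b ≤ a + p) (hap : a < p) : f a / 2 ≤ f b := by
    have hpa : 0 < p - a := by linarith
    have := (hconcave s hs).2 (show a ∈ _ from ⟨hsa, by linarith⟩)
      (show p ∈ _ from ⟨by linarith, le_rfl⟩)
      (show 0 ≤ (p - b) / (p - a) by apply div_nonneg <;> linarith)
      (show 0 ≤ (b - a) / (p - a) by apply div_nonneg <;> linarith) (by field_simp; ring)
    simp only [smul_eq_mul] at this
    have e : (p - b) / (p - a) * a + (b - a) / (p - a) * p = b := by field_simp; ring
    rw [e] at this
    have h3 : 1 / 2 ≤ (p - b) / (p - a) := by rw [le_div_iff₀ hpa]; linarith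
    have h4 : 0 ≤ (b - a) / (p - a) := by apply div_nonneg <;> linarith
    nlinarith [h0 a, h0 p, mul_nonneg h4 (h0 p), mul_le_mul_of_nonneg_right h3 (h0 a)]
  rcases le_or_gt p y with hyp | hyp
  · have : y = z := by linarith
    subst this; linarith [h0 y]
  by_cases hS : ∃ t, t < p ∧ 0 < f'' t
  -- With s the last place before p where f'' is positive, f is concave on [s, p]. The pattern + - +
  -- together with f''(p) < 0 makes f convex to the left of s.
  · set S := {t | t < p ∧ 0 < f'' t}
    have hne : S.Nonempty := hS
    have hbdd : BddAbove S := ⟨p, fun t ht => ht.1.le⟩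
    set s := sSup S
    have hsp : s ≤ p := csSup_le hne fun t ht => ht.1.le
    have hright : ∀ t, s < t → t < p → f'' t ≤ 0 := fun t hst htp => by
      by_contra! hcon
      exact absurd (le_csSup hbdd (show t ∈ S from ⟨htp, hcon⟩)) (not_le.2 hst)
    have hleft : ∀ t, t < s → 0 ≤ f'' t := fun t hts => by
      obtain ⟨q, hq, htq⟩ := exists_lt_of_lt_csSup hne hts
      by_contra! hcon
      exact absurd hp (not_lt.2 (h t q p htq hq.1 hcon hq.2))
    -- A negative slope at t would persist to the left by convexity and push f above its bound C at
    -- q. So f increases up to s, and to the right of s the concave estimate takes over.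
    have hf' : ∀ t, t < s → 0 ≤ f' t := by
      intro t hts
      by_contra! hneg
      have hconv : ConvexOn ℝ (Set.Iic s) f := by
        refine convexOn_of_deriv2_nonneg (convex_Iic _) hcont.continuousOn
          (fun y _ => (h1 y).differentiableAt.differentiableWithinAt)
          (fun y _ => by rw [hd]; exact (h2 y).differentiableAt.differentiableWithinAt)
          fun t ht => ?_
        rw [interior_Iic] at ht
        simpa [hd, hd2] using hleft t ht
      obtain ⟨C, hC⟩ := hb
      set q := t - (C + 1) / (-f' t)
      have hC0 : 0 ≤ C := (h0 0).trans (hC 0)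
      have hqt : q < t := by
        have : 0 < (C + 1) / (-f' t) := div_pos (by linarith) (by linarith)
        simp only [q]; linarith
      have := hconv.slope_le_of_hasDerivAt (x := q) (y := t) (by simp; linarith) (by simp; linarith)
        hqt (h1 t)
      rw [slope_def_field, div_le_iff₀ (by linarith)] at this
      have e : f' t * (t - q) = -(C + 1) := by
        have := hneg.ne
        simp only [q, sub_sub_cancel]; field_simp
      have := hC q
      have := h0 t
      linarith
    have hmono : MonotoneOn f (Set.Iic s) := by
      refine monotoneOn_of_deriv_nonneg (convex_Iic _) hcont.continuousOn
        (fun y _ => (h1 y).differentiableAt.differentiableWithinAt) fun t ht => ?_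
      rw [interior_Iic] at ht
      rw [hd]; exact hf' t ht
    rcases le_or_gt s y with hsy | hsy
    · exact hconc s y z hright hsy hyz hz hyp
    · rcases le_or_gt z s with hzs | hzs
      · have := hmono hsy.le hzs hyz
        linarith [h0 y]
      · have h5 := hconc s s z hright le_rfl hzs.le (by linarith) (by linarith)
        have h6 := hmono hsy.le (Set.self_mem_Iic) hsy.le
        linarith
  · push Not at hS
    exact hconc y y z (fun t _ htp => hS t htp) le_rfl hyz hz hyp

end TraceEst

/-! ### Bell-shaped densities and convexity of their tails. -/

namespace TraceEst

open Real Filter Topology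
open scoped MeasureTheory NNReal ENNReal

/-- `f` is a density of `μ`. -/
def HasDens (μ : Measure ℝ) (f : ℝ → ℝ) : Prop :=
  Integrable f ∧ ∀ k : ℝ → ℝ, Measurable k → (∃ C, ∀ x, |k x| ≤ C) →
    ∫ x, k x ∂μ = ∫ x, k x * f x

/-- Law of `b * E`, `E` standard exponential. -/
noncomputable def expLaw (b : ℝ) : Measure ℝ := stdE.map fun y => b * y

instance (b : ℝ) : IsProbabilityMeasure (expLaw b) :=
  Measure.isProbabilityMeasure_map (by fun_prop)

theorem integrable_of_bdd {α : Type*} [MeasurableSpace α] {ν : Measure α} [IsFiniteMeasure ν]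
    {k : α → ℝ} (hk : Measurable k) (hb : ∃ C, ∀ x, |k x| ≤ C) : Integrable k ν := by
  obtain ⟨C, hC⟩ := hb
  exact (integrable_const C).mono' hk.aestronglyMeasurable (ae_of_all _ hC)

theorem integral_conv_expLaw {μ : Measure ℝ} [IsProbabilityMeasure μ] (b : ℝ) {k : ℝ → ℝ}
    (hk : Measurable k) (hb : ∃ C, ∀ x, |k x| ≤ C) :
    ∫ x, k x ∂(μ ∗ expLaw b) = ∫ y, ∫ x, k (x + b * y) ∂μ ∂stdE := by
  rw [integral_conv (integrable_of_bdd hk hb)]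
  have (x : ℝ) : ∫ y, k (x + y) ∂(expLaw b) = ∫ y, k (x + b * y) ∂stdE := by
    rw [expLaw, integral_map (by fun_prop)
      (Measurable.aestronglyMeasurable (by fun_prop))]
  simp_rw [this]
  refine integral_integral_swap ?_
  obtain ⟨C, hC⟩ := hb
  exact integrable_of_bdd (by fun_prop) ⟨C, fun p => hC _⟩

theorem HasDens.conv_expLaw {μ : Measure ℝ} [IsProbabilityMeasure μ] {f : ℝ → ℝ}
    (h : HasDens μ f) (hf : Measurable f) (b : ℝ) : HasDens (μ ∗ expLaw b) (expC b f) := by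
  have hint : Integrable (Function.uncurry fun x y => f (x - b * y)) (volume.prod stdE) := by
    rw [integrable_prod_iff' (Measurable.aestronglyMeasurable (by fun_prop))]
    refine ⟨ae_of_all _ fun y => h.1.comp_sub_right (b * y), ?_⟩
    simp only [Function.uncurry]
    have (y : ℝ) : ∫ x, ‖f (x - b * y)‖ = ∫ x, ‖f x‖ :=
      integral_sub_right_eq_self (fun x => ‖f x‖) (b * y)
    simp_rw [this]
    exact integrable_const _
  refine ⟨hint.integral_prod_left, fun k hk hb => ?_⟩
  rw [integral_conv_expLaw b hk hb]
  obtain ⟨C, hC⟩ := hb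
  have e1 (y : ℝ) : ∫ x, k (x + b * y) ∂μ = ∫ x, k x * f (x - b * y) := by
    rw [h.2 (fun x => k (x + b * y)) (by fun_prop) ⟨C, fun x => hC _⟩,
      ← integral_add_right_eq_self (fun x => k x * f (x - b * y)) (b * y)]
    simp
  simp_rw [e1, expC]
  rw [integral_integral_swap]
  · simp_rw [integral_const_mul]
  · have h2 : Integrable (fun p : ℝ × ℝ => f (p.1 - b * p.2) * k p.1) (volume.prod stdE) :=
      Integrable.mul_bdd (c := C) hint
        (hk.comp measurable_fst).aestronglyMeasurable (ae_of_all _ fun p => hC p.1)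
    refine (h2.swap).congr (ae_of_all _ fun p => ?_)
    simp [Function.uncurry, mul_comm]

theorem HasDens.conv_dirac {μ : Measure ℝ} [IsProbabilityMeasure μ] {f : ℝ → ℝ}
    (h : HasDens μ f) (c : ℝ) : HasDens (μ ∗ Measure.dirac c) fun x => f (x - c) := by
  refine ⟨h.1.comp_sub_right c, fun k hk hb => ?_⟩
  obtain ⟨C, hC⟩ := hb
  rw [Measure.conv_dirac, integral_map (by fun_prop) hk.aestronglyMeasurable,
    h.2 (fun x => k (x + c)) (by fun_prop) ⟨C, fun x => hC _⟩,
    ← integral_add_right_eq_self (fun x => k x * f (x - c)) c]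
  simp

/-- Probability laws with a bounded continuous density whose second differences have the sign
pattern `+ - +`. -/
def BellShaped (μ : Measure ℝ) : Prop :=
  ∃ f, BddCont f ∧ (∀ x, 0 ≤ f x) ∧ HasDens μ f ∧ ∀ t > 0, NoMPM (secDiff t f)

theorem BellShaped.conv_expLaw {μ : Measure ℝ} [IsProbabilityMeasure μ] (h : BellShaped μ)
    (b : ℝ) : BellShaped (μ ∗ expLaw b) := by
  obtain ⟨f, hf, h0, hd, hs⟩ := h
  refine ⟨expC b f, hf.expC b, expC_nonneg h0 b, hd.conv_expLaw hf.1.measurable b,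
    fun t ht => ?_⟩
  rw [secDiff_expC hf]
  exact (hs t ht).expC (hf.secDiff t) b

theorem BellShaped.conv_dirac {μ : Measure ℝ} [IsProbabilityMeasure μ] (h : BellShaped μ)
    (c : ℝ) : BellShaped (μ ∗ Measure.dirac c) := by
  obtain ⟨f, hf, h0, hd, hs⟩ := h
  refine ⟨fun x => f (x - c), hf.comp (by fun_prop), fun x => h0 _, hd.conv_dirac c,
    fun t ht => ?_⟩
  have e : secDiff t (fun x => f (x - c)) = fun x => secDiff t f (x - c) := by
    ext x; simp only [secDiff]; ring_nf
  rw [e]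
  intro x₁ x₂ x₃ h12 h23
  exact hs t ht _ _ _ (by linarith) (by linarith)

/-- Tail convexity in weak form. -/
theorem integral_secondDeriv_nonneg_of_bellShaped {μ : Measure ℝ} [IsProbabilityMeasure μ]
    (h : BellShaped μ) {η r : ℝ} (hη : 0 < η) (hr : 0 < r)
    (hP : ((μ ∗ expLaw η) ∗ expLaw η).real {x | r ≤ |x|} < 1 / 3)
    {k k' k'' : ℝ → ℝ} {p q : ℝ} (hk' : ∀ x, HasDerivAt k (k' x) x)
    (hk'' : ∀ x, HasDerivAt k' (k'' x) x) (hc : Continuous k'') (h0 : ∀ x, 0 ≤ k x)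
    (hsupp : ∀ x, x ∉ Set.Icc p q → k x = 0) (hp : 5 * r ≤ p) :
    0 ≤ ∫ x, k'' x ∂((μ ∗ expLaw η) ∗ expLaw η) := by
  set μ' := (μ ∗ expLaw η) ∗ expLaw η
  obtain ⟨g, hg, hg0, hgd, hgs⟩ := h
  set f₀ := expC η g with hf₀def
  set f := expC η f₀ with hfdef
  have hf₀ : BddCont f₀ := hg.expC η
  have hf : BddCont f := hf₀.expC η
  have hfd : HasDens μ' f := (hgd.conv_expLaw hg.1.measurable η).conv_expLaw hf₀.1.measurable η
  have hf0 : ∀ x, 0 ≤ f x := expC_nonneg (expC_nonneg hg0 η) η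
  have hfs : ∀ t > 0, NoMPM (secDiff t f) := fun t ht => by
    rw [hfdef, secDiff_expC hf₀, hf₀def, secDiff_expC hg]
    exact ((hgs t ht).expC (hg.secDiff t) η).expC ((hg.secDiff t).expC η) η
  -- Each convolution F of G with the law of ηE satisfies ηF' = G - F. The two convolutions
  -- therefore provide two continuous derivatives.
  set f' : ℝ → ℝ := fun x => η⁻¹ * (f₀ x - f x) with hf'def
  set f'' : ℝ → ℝ := fun x => η⁻¹ * (η⁻¹ * (g x - f₀ x) - f' x) with hf''def
  have hD1 : ∀ x, HasDerivAt f (f' x) x := fun x => hasDerivAt_expC hf₀ hη x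
  have hD2 : ∀ x, HasDerivAt f' (f'' x) x := fun x =>
    ((hasDerivAt_expC hg hη x).sub (hD1 x)).const_mul η⁻¹
  have hf'c : Continuous f' := continuous_const.mul (hf₀.1.sub hf.1)
  have hf''c : Continuous f'' :=
    continuous_const.mul ((continuous_const.mul (hg.1.sub hf₀.1)).sub hf'c)
  have hNo : NoMPM f'' := NoMPM.of_secDiff hD1 hD2 hf''c hfs
  have hbdd : ∃ C, ∀ x, f x ≤ C := ⟨hf.2.choose, fun x => (le_abs_self _).trans (hf.2.choose_spec x)⟩
  have hprob (s : Set ℝ) (hs : MeasurableSet s) : μ'.real s = ∫ x in s, f x := by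
    have := hfd.2 (s.indicator 1) (measurable_one.indicator hs) ⟨1, fun x => by
      by_cases hx : x ∈ s <;> simp [hx]⟩
    rw [integral_indicator_one hs] at this
    rw [this, ← integral_indicator hs]
    congr 1; ext x
    by_cases hx : x ∈ s <;> simp [hx]
  -- Otherwise f(y) ≤ 2 f(y + 2r) for |y| ≤ r, since y + 4r ≤ 5r. The mass of (-r, r] is then at
  -- most twice the mass outside, so the total mass is below 3 · (1/3).
  have hpos : ∀ x, 5 * r ≤ x → 0 ≤ f'' x := by
    intro x hx
    by_contra! hneg
    have hhalf : ∀ y ∈ Set.Icc (-r) r, f y ≤ 2 * f (y + 2 * r) := fun y hy => by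
      have := half_le_of_neg_secondDeriv hD1 hD2 hf0 hbdd hNo hneg (y := y) (z := y + 2 * r)
        (by linarith) (by linarith [hy.1, hy.2])
      linarith
    have i1 : ∫ y in (-r)..r, f y ≤ 2 * ∫ y in r..(3 * r), f y := by
      have e : ∫ y in r..(3 * r), f y = ∫ y in (-r)..r, f (y + 2 * r) := by
        rw [intervalIntegral.integral_comp_add_right]; congr 1 <;> ring
      rw [e, ← intervalIntegral.integral_const_mul]
      have hc1 := hf.1
      exact intervalIntegral.integral_mono_on (by linarith) (hf.1.intervalIntegrable _ _)
        (Continuous.intervalIntegrable (by fun_prop) _ _) hhalf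
    rw [intervalIntegral.integral_of_le (by linarith), intervalIntegral.integral_of_le (by linarith),
      ← hprob _ measurableSet_Ioc, ← hprob _ measurableSet_Ioc] at i1
    have i2 : μ'.real (Set.Ioc r (3 * r)) ≤ μ'.real {x | r ≤ |x|} :=
      measureReal_mono fun y hy => hy.1.le.trans (le_abs_self y)
    have i3 : 1 ≤ μ'.real (Set.Ioc (-r) r) + μ'.real {x | r ≤ |x|} := by
      rw [← probReal_univ (μ := μ')]
      refine (measureReal_mono (fun y _ => ?_)).trans (measureReal_union_le _ _)
      rcases lt_or_ge |y| r with h | h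
      · exact Or.inl ⟨(abs_lt.1 h).1, (abs_lt.1 h).2.le⟩
      · exact Or.inr h
    linarith
  have hz {u u' : ℝ → ℝ} (hu : ∀ x, HasDerivAt u (u' x) x) (h : ∀ x, x ∉ Set.Icc p q → u x = 0) :
      ∀ x, x ∉ Set.Icc p q → u' x = 0 := fun x hx => by
    have : u =ᶠ[𝓝 x] fun _ => 0 :=
      Filter.eventuallyEq_of_mem (isClosed_Icc.isOpen_compl.mem_nhds hx) fun y hy => h y hy
    exact (hu x).unique ((hasDerivAt_const x (0 : ℝ)).congr_of_eventuallyEq this)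
  have hk0' := hz hk' hsupp
  have hk0'' := hz hk'' hk0'
  have hcs {u : ℝ → ℝ} (h : ∀ x, x ∉ Set.Icc p q → u x = 0) : HasCompactSupport u :=
    HasCompactSupport.intro isCompact_Icc h
  have hkc : Continuous k := continuous_iff_continuousAt.2 fun x => (hk' x).continuousAt
  have hkc' : Continuous k' := continuous_iff_continuousAt.2 fun x => (hk'' x).continuousAt
  have hint {u v : ℝ → ℝ} (hu : Continuous u) (h : ∀ x, x ∉ Set.Icc p q → u x = 0)
      (hv : Continuous v) : Integrable (v * u) :=
    (hv.mul hu).integrable_of_hasCompactSupport ((hcs h).mul_left)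
  obtain ⟨C, hC⟩ := (hcs hk0'').exists_bound_of_continuous hc
  rw [hfd.2 k'' hc.measurable ⟨C, hC⟩]
  -- Two integrations by parts move both derivatives from k to f; the compact support of k removes
  -- boundary terms.
  have s1 := integral_mul_deriv_eq_deriv_mul_of_integrable (u := f) (u' := f') (v := k')
    (v' := k'') (fun x _ => hD1 x) (fun x _ => hk'' x) (hint hc hk0'' hf.1)
    (hint hkc' hk0' hf'c) (hint hkc' hk0' hf.1)
  have s2 := integral_mul_deriv_eq_deriv_mul_of_integrable (u := f') (u' := f'') (v := k)
    (v' := k') (fun x _ => hD2 x) (fun x _ => hk' x) (hint hkc' hk0' hf'c)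
    (hint hkc hsupp hf''c) (hint hkc hsupp hf'c)
  simp_rw [mul_comm (k'' _)]
  rw [s1, s2, neg_neg]
  refine integral_nonneg fun x => ?_
  by_cases hx : x ∈ Set.Icc p q
  · exact mul_nonneg (hpos x (hp.trans hx.1)) (h0 x)
  · simp [hsupp x hx]

/-! ### Mixtures of two-sided exponential laws. -/

/-- Density of `s E - s' E'` for independent standard exponentials. -/
noncomputable def laplaceDens (s s' x : ℝ) : ℝ :=
  if 0 ≤ x then exp (-x / s) / (s + s') else exp (x / s') / (s + s')

theorem laplaceDens_neg {s s' : ℝ} (x : ℝ) : laplaceDens s s' (-x) = laplaceDens s' s x := by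
  rcases lt_trichotomy x 0 with h | rfl | h
  · simp [laplaceDens, h.le, not_le.2 h, add_comm]
  · simp [laplaceDens, add_comm]
  · simp [laplaceDens, h.le, not_le.2 h, add_comm]

theorem laplaceDens_of_nonneg (s s' : ℝ) {x : ℝ} (hx : 0 ≤ x) :
    laplaceDens s s' x = exp (-x / s) / (s + s') := if_pos hx

theorem laplaceDens_of_nonpos (s s' : ℝ) {x : ℝ} (hx : x ≤ 0) :
    laplaceDens s s' x = exp (x / s') / (s + s') := by
  rw [← neg_neg x, laplaceDens_neg, laplaceDens_of_nonneg _ _ (by linarith), add_comm, neg_neg]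

theorem laplaceDens_nonneg {s s' : ℝ} (hs : 0 < s) (hs' : 0 < s') (x : ℝ) :
    0 ≤ laplaceDens s s' x := by
  unfold laplaceDens; split_ifs <;> positivity

theorem laplaceDens_le {s s' η : ℝ} (hη : 0 < η) (hs : η ≤ s) (hs' : η ≤ s') (x : ℝ) :
    laplaceDens s s' x ≤ η⁻¹ := by
  have h1 : (s + s')⁻¹ ≤ η⁻¹ := by gcongr; linarith
  have h2 : 0 ≤ (s + s')⁻¹ := by have : 0 < s + s' := by linarith
                                 positivity
  have h3 : ∀ t : ℝ, t ≤ 0 → exp t / (s + s') ≤ η⁻¹ := fun t ht => by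
    have := exp_le_one_iff.2 ht
    rw [div_eq_mul_inv]; nlinarith
  unfold laplaceDens
  split_ifs with hx
  · exact h3 _ (div_nonpos_of_nonpos_of_nonneg (by linarith) (by linarith))
  · exact h3 _ (div_nonpos_of_nonpos_of_nonneg (by linarith) (by linarith))

theorem continuous_laplaceDens (s s' : ℝ) : Continuous (laplaceDens s s') := by
  unfold laplaceDens
  refine Continuous.if_le (by fun_prop) (by fun_prop) continuous_const continuous_id ?_
  rintro x rfl
  simp

theorem measurable_laplaceDens :
    Measurable fun p : (ℝ × ℝ) × ℝ => laplaceDens p.1.1 p.1.2 p.2 := by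
  unfold laplaceDens
  exact Measurable.ite (measurableSet_le measurable_const (by fun_prop)) (by fun_prop)
    (by fun_prop)

/-- All three points lie on the right-hand branch, where the density is a convex exponential. -/
theorem secDiff_laplaceDens_nonneg {s s' t x : ℝ} (hs : 0 < s) (hs' : 0 < s') (ht : 0 < t)
    (hx : t ≤ x) : 0 ≤ secDiff t (laplaceDens s s') x := by
  rw [secDiff, laplaceDens_of_nonneg _ _ (by linarith), laplaceDens_of_nonneg _ _ (by linarith),
    laplaceDens_of_nonneg _ _ (by linarith)]
  have e1 : exp (-(x + t) / s) = exp (-x / s) * exp (-(t / s)) := by rw [← exp_add]; ring_nf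
  have e2 : exp (-(x - t) / s) = exp (-x / s) * exp (t / s) := by rw [← exp_add]; ring_nf
  have h1 := add_one_le_exp (t / s)
  have h2 := add_one_le_exp (-(t / s))
  have : exp (-(x + t) / s) / (s + s') + exp (-(x - t) / s) / (s + s')
      - 2 * (exp (-x / s) / (s + s')) =
      exp (-x / s) / (s + s') * (exp (-(t / s)) + exp (t / s) - 2) := by
    rw [e1, e2]; ring
  rw [this]
  exact mul_nonneg (by positivity) (by linarith)

/-- For points of [0, t] only the one shifted by -t is on the left branch, where the density
increases. The other two terms combine to a decreasing exponential with negative coefficient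
e^(-t/s) - 2. -/
theorem secDiff_laplaceDens_mono {s s' t x y : ℝ} (hs : 0 < s) (hs' : 0 < s')
    (hx : 0 ≤ x) (hxy : x ≤ y) (hy : y ≤ t) :
    secDiff t (laplaceDens s s') x ≤ secDiff t (laplaceDens s s') y := by
  have key (z : ℝ) (hz : 0 ≤ z) (hzt : z ≤ t) : secDiff t (laplaceDens s s') z =
      (exp ((z - t) / s') + exp (-z / s) * (exp (-(t / s)) - 2)) / (s + s') := by
    rw [secDiff, laplaceDens_of_nonneg _ _ (by linarith), laplaceDens_of_nonpos _ _ (by linarith),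
      laplaceDens_of_nonneg _ _ (by linarith)]
    have e1 : exp (-(z + t) / s) = exp (-z / s) * exp (-(t / s)) := by rw [← exp_add]; ring_nf
    rw [e1]; ring
  rw [key x hx (hxy.trans hy), key y (hx.trans hxy) hy]
  have h1 : exp ((x - t) / s') ≤ exp ((y - t) / s') := by gcongr
  have h2 : exp (-y / s) ≤ exp (-x / s) := by gcongr
  have h3 : exp (-(t / s)) ≤ 1 :=
    exp_le_one_iff.2 (neg_nonpos.2 (div_nonneg (by linarith) hs.le))
  have : 0 < s + s' := by linarith
  gcongr ?_ / _
  nlinarith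

theorem secDiff_laplaceDens_neg_arg (s s' t x : ℝ) :
    secDiff t (laplaceDens s s') (-x) = secDiff t (laplaceDens s' s) x := by
  simp only [secDiff, ← laplaceDens_neg (s := s) (s' := s')]
  ring_nf

/-- Law of `(s + η) E - (s' + η) E'` with `(s, s')` of law `ν`. -/
noncomputable def twoSided (η : ℝ) (ν : Measure (ℝ × ℝ)) : Measure ℝ :=
  (ν.prod (stdE.prod stdE)).map fun p => (p.1.1 + η) * p.2.1 - (p.1.2 + η) * p.2.2

instance (η : ℝ) (ν : Measure (ℝ × ℝ)) [IsProbabilityMeasure ν] :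
    IsProbabilityMeasure (twoSided η ν) :=
  Measure.isProbabilityMeasure_map (by fun_prop)

theorem hasDens_expLaw {s : ℝ} (hs : 0 < s) :
    HasDens (expLaw s) ((Set.Ioi 0).indicator fun x => s⁻¹ * exp (-x / s)) := by
  have e (k : ℝ → ℝ) : ∫ y in Set.Ioi 0, k (s * y) * exp (-y) =
      ∫ x, k x * (Set.Ioi 0).indicator (fun x => s⁻¹ * exp (-x / s)) x := by
    have h1 : ∀ x, k x * (Set.Ioi 0).indicator (fun x => s⁻¹ * exp (-x / s)) x =
        (Set.Ioi 0).indicator (fun x => s⁻¹ * (k x * exp (-x / s))) x := fun x => by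
      by_cases hx : 0 < x
      · rw [Set.indicator_of_mem (by exact hx), Set.indicator_of_mem (by exact hx)]; ring
      · rw [Set.indicator_of_notMem (by exact hx), Set.indicator_of_notMem (by exact hx), mul_zero]
    simp_rw [h1]
    rw [integral_indicator measurableSet_Ioi, integral_const_mul]
    have := integral_comp_mul_left_Ioi (fun x => k x * exp (-x / s)) 0 hs
    simp only [mul_zero, smul_eq_mul] at this
    rw [← this]
    congr 1; ext y; congr 2; field_simp
  refine ⟨?_, fun k hk hb => ?_⟩
  · rw [integrable_indicator_iff measurableSet_Ioi]
    have := integrableOn_exp_mul_Ioi (a := -s⁻¹) (by simp [hs]) 0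
    refine (this.const_mul s⁻¹).congr (ae_of_all _ fun x => ?_)
    simp only; congr 2; ring
  · rw [expLaw, integral_map (by fun_prop) hk.aestronglyMeasurable, integral_stdE, e]

theorem expC_indicator {s s' : ℝ} (hs : 0 < s) (hs' : 0 < s') :
    expC (-s') ((Set.Ioi 0).indicator fun x => s⁻¹ * exp (-x / s)) = laplaceDens s s' := by
  ext x
  have h1 := expC_neg_arg (-s') ((Set.Ioi 0).indicator fun x => s⁻¹ * exp (-x / s)) (-x)
  rw [neg_neg, neg_neg] at h1
  rw [h1, expC_eq hs']
  have h2 : ∀ t, (Set.Ioi 0).indicator (fun x => s⁻¹ * exp (-x / s)) (-t) * exp (t / s') =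
      (Set.Iio 0).indicator (fun t => s⁻¹ * exp ((s⁻¹ + s'⁻¹) * t)) t := fun t => by
    by_cases ht : t < 0
    · rw [Set.indicator_of_mem (by simpa using ht), Set.indicator_of_mem (by exact ht), mul_assoc,
        ← exp_add]
      congr 2; ring
    · rw [Set.indicator_of_notMem (by simpa using ht), Set.indicator_of_notMem (by exact ht),
        zero_mul]
  simp_rw [h2]
  have hpos : 0 < s⁻¹ + s'⁻¹ := by positivity
  rw [integral_Iic_eq_integral_Iio, setIntegral_indicator measurableSet_Iio, Set.Iio_inter_Iio,
    ← integral_Iic_eq_integral_Iio, integral_const_mul, integral_exp_mul_Iic hpos]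
  rcases le_or_gt 0 x with hx | hx
  · rw [min_eq_left (by linarith), laplaceDens_of_nonneg _ _ hx]
    have e : exp (-x / s) = exp (-(-x) / s') * exp ((s⁻¹ + s'⁻¹) * -x) := by
      rw [← exp_add]; congr 1; ring
    rw [e]; field_simp; ring
  · rw [min_eq_right (by linarith), laplaceDens_of_nonpos _ _ hx.le]
    rw [neg_neg]; simp; field_simp; ring

theorem integral_laplaceDens {s s' : ℝ} (hs : 0 < s) (hs' : 0 < s') {k : ℝ → ℝ}
    (hk : Measurable k) (hb : ∃ C, ∀ x, |k x| ≤ C) :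
    ∫ p : ℝ × ℝ, k (s * p.1 - s' * p.2) ∂(stdE.prod stdE) = ∫ x, k x * laplaceDens s s' x := by
  have h := (hasDens_expLaw hs).conv_expLaw
    ((by fun_prop : Measurable fun x => s⁻¹ * exp (-x / s)).indicator measurableSet_Ioi) (-s')
  rw [expC_indicator hs hs'] at h
  rw [← h.2 k hk hb, Measure.conv, integral_map (by fun_prop) hk.aestronglyMeasurable, expLaw,
    expLaw, Measure.map_prod_map _ _ (by fun_prop) (by fun_prop),
    integral_map (by fun_prop) (Measurable.aestronglyMeasurable (by fun_prop))]
  congr 1; ext p; simp [sub_eq_add_neg]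

theorem integrable_laplaceDens {s s' : ℝ} (hs : 0 < s) (hs' : 0 < s') :
    Integrable (laplaceDens s s') := by
  have h := (hasDens_expLaw hs).conv_expLaw
    ((by fun_prop : Measurable fun x => s⁻¹ * exp (-x / s)).indicator measurableSet_Ioi) (-s')
  rw [expC_indicator hs hs'] at h
  exact h.1

/-- Sign patterns need not survive mixing, but two stronger properties of each component do: second
differences are nonnegative for |x| ≥ t, and on [-t, t] they are monotone in |x| on either side of
0. Negative values therefore occur only inside (-t, t), and a point between two of them has a value
no larger than one of them. The shift by η keeps the component densities below 1/η. -/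
theorem bellShaped_twoSided {η : ℝ} (hη : 0 < η) {ν : Measure (ℝ × ℝ)} [IsProbabilityMeasure ν]
    (hν : ∀ᵐ p ∂ν, 0 ≤ p.1 ∧ 0 ≤ p.2) : BellShaped (twoSided η ν) := by
  set L : ℝ × ℝ → ℝ → ℝ := fun p x => laplaceDens (p.1 + η) (p.2 + η) x
  have hLm : Measurable (Function.uncurry L) :=
    measurable_laplaceDens.comp (g := fun p : (ℝ × ℝ) × ℝ => laplaceDens p.1.1 p.1.2 p.2)
      (f := fun p : (ℝ × ℝ) × ℝ => ((p.1.1 + η, p.1.2 + η), p.2)) (by fun_prop)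
  have hLm1 (x : ℝ) : Measurable fun p => L p x :=
    hLm.comp (g := Function.uncurry L) (f := fun p => (p, x)) (by fun_prop)
  have hL0 : ∀ᵐ p ∂ν, ∀ x, 0 ≤ L p x := hν.mono fun p hp x =>
    laplaceDens_nonneg (by linarith [hp.1]) (by linarith [hp.2]) x
  have hL1 : ∀ᵐ p ∂ν, ∀ x, |L p x| ≤ η⁻¹ := by
    filter_upwards [hν, hL0] with p hp h0 x
    rw [abs_of_nonneg (h0 x)]
    exact laplaceDens_le hη (by linarith [hp.1]) (by linarith [hp.2]) x
  have hLi (x : ℝ) : Integrable (fun p => L p x) ν :=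
    (integrable_const η⁻¹).mono' (hLm1 x).aestronglyMeasurable (hL1.mono fun p hp => hp x)
  have hLi2 : Integrable (Function.uncurry L) (ν.prod volume) := by
    rw [integrable_prod_iff hLm.aestronglyMeasurable]
    refine ⟨hν.mono fun p hp => (integrable_laplaceDens (s := p.1 + η) (s' := p.2 + η)
      (by linarith [hp.1]) (by linarith [hp.2])),
      (integrable_const (1 : ℝ)).congr ?_⟩
    filter_upwards [hν, hL0] with p hp h0
    have := integral_laplaceDens (s := p.1 + η) (s' := p.2 + η) (k := fun _ => 1)
      (by linarith [hp.1]) (by linarith [hp.2]) measurable_const ⟨1, by simp⟩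
    simp only [integral_const, probReal_univ, one_smul, one_mul] at this
    rw [this]
    congr 1; ext x
    simp only [Function.uncurry, Real.norm_eq_abs]
    rw [abs_of_nonneg (h0 x)]
  refine ⟨fun x => ∫ p, L p x ∂ν, ⟨?_, η⁻¹, fun x => ?_⟩, fun x => ?_, ⟨?_, fun k hk hb => ?_⟩,
    fun t ht => ?_⟩
  · refine continuous_of_dominated (bound := fun _ => η⁻¹)
      (fun x => (hLm1 x).aestronglyMeasurable) (fun x => hL1.mono fun p hp => hp x)
      (integrable_const _) (ae_of_all _ fun p => continuous_laplaceDens _ _)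
  · have := norm_integral_le_of_norm_le_const (μ := ν) (C := η⁻¹)
      (f := fun p => L p x) (hL1.mono fun p hp => hp x)
    simpa using this
  · exact integral_nonneg_of_ae (hL0.mono fun p hp => hp x)
  · exact hLi2.integral_prod_right
  · obtain ⟨C, hC⟩ := hb
    rw [twoSided, integral_map (by fun_prop) hk.aestronglyMeasurable,
      integral_prod _ (integrable_of_bdd (by fun_prop) ⟨C, fun p => hC _⟩)]
    have h1 : ∀ᵐ p ∂ν, ∫ q : ℝ × ℝ, k ((p.1 + η) * q.1 - (p.2 + η) * q.2) ∂(stdE.prod stdE) =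
        ∫ x, k x * L p x := hν.mono fun p hp =>
      integral_laplaceDens (by linarith [hp.1]) (by linarith [hp.2]) hk ⟨C, hC⟩
    rw [integral_congr_ae h1, integral_integral_swap]
    · simp_rw [integral_const_mul]
    · have h2 : Integrable (fun p : (ℝ × ℝ) × ℝ => Function.uncurry L p * k p.2)
          (ν.prod volume) :=
        Integrable.mul_bdd (c := C) hLi2
          (hk.comp measurable_snd).aestronglyMeasurable (ae_of_all _ fun p => hC p.2)
      refine h2.congr (ae_of_all _ fun p => ?_)
      simp [Function.uncurry, mul_comm]
  · have e (x : ℝ) : secDiff t (fun x => ∫ p, L p x ∂ν) x = ∫ p, secDiff t (L p) x ∂ν := by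
      simp only [secDiff]
      have i1 : Integrable (fun p => L p (x + t) + L p (x - t)) ν := (hLi _).add (hLi _)
      rw [integral_sub i1 ((hLi _).const_mul 2), integral_add (hLi _) (hLi _), integral_const_mul]
    have hi (x : ℝ) : Integrable (fun p => secDiff t (L p) x) ν :=
      ((hLi _).add (hLi _)).sub ((hLi _).const_mul 2)
    have hout (x : ℝ) (hx : t ≤ |x|) : 0 ≤ secDiff t (fun x => ∫ p, L p x ∂ν) x := by
      rw [e]
      refine integral_nonneg_of_ae (hν.mono fun p hp => ?_)
      rcases le_abs.1 hx with h | h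
      · exact secDiff_laplaceDens_nonneg (by linarith [hp.1]) (by linarith [hp.2]) ht h
      · have := secDiff_laplaceDens_nonneg (s := p.2 + η) (s' := p.1 + η)
          (by linarith [hp.2]) (by linarith [hp.1]) ht h
        rwa [← secDiff_laplaceDens_neg_arg, neg_neg] at this
    intro x₁ x₂ x₃ h12 h23 hn1 hp2
    by_contra! hn3
    have a1 : |x₁| < t := by
      by_contra! h; exact absurd hn1 (not_lt.2 (hout _ h))
    have a3 : |x₃| < t := by
      by_contra! h; exact absurd hn3 (not_lt.2 (hout _ h))
    rw [abs_lt] at a1 a3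
    rcases le_or_gt 0 x₂ with h | h
    · have : secDiff t (fun x => ∫ p, L p x ∂ν) x₂ ≤ secDiff t (fun x => ∫ p, L p x ∂ν) x₃ := by
        rw [e, e]
        exact integral_mono_ae (hi _) (hi _) (hν.mono fun p hp =>
          secDiff_laplaceDens_mono (by linarith [hp.1]) (by linarith [hp.2]) h h23.le a3.2.le)
      linarith
    · have : secDiff t (fun x => ∫ p, L p x ∂ν) x₂ ≤ secDiff t (fun x => ∫ p, L p x ∂ν) x₁ := by
        rw [e, e]
        refine integral_mono_ae (hi _) (hi _) (hν.mono fun p hp => ?_)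
        have := secDiff_laplaceDens_mono (s := p.2 + η) (s' := p.1 + η) (t := t) (x := -x₂)
          (y := -x₁) (by linarith [hp.2]) (by linarith [hp.1]) (by linarith) (by linarith)
          (by linarith)
        simpa only [← secDiff_laplaceDens_neg_arg (s := p.1 + η), neg_neg] using this
      linarith

end TraceEst

/-! ### Stieltjes representations of products of square roots. -/

namespace TraceEst

open Real Filter Topology
open scoped MeasureTheory NNReal ENNReal

/-- The standard Cauchy distribution. -/
noncomputable abbrev stdC : Measure ℝ := cauchyMeasure 0 1

theorem integral_stdC (f : ℝ → ℝ) : ∫ v, f v ∂stdC = ∫ v, π⁻¹ * (1 + v ^ 2)⁻¹ * f v := by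
  rw [stdC, cauchyMeasure, if_neg one_ne_zero,
    integral_withDensity_eq_integral_toReal_smul (by fun_prop) (by simp [cauchyPDF])]
  congr 1; ext v
  rw [cauchyPDF, ENNReal.toReal_ofReal (cauchyPDF_pos 0 one_ne_zero v).le, cauchyPDFReal_def]
  simp [add_comm]

theorem integral_inv_add_mul_sq {A B : ℝ} (hA : 0 < A) (hB : 0 < B) :
    ∫ v : ℝ, (A + B * v ^ 2)⁻¹ = π / √(A * B) := by
  have h1 : ∀ v : ℝ, (A + B * v ^ 2)⁻¹ = A⁻¹ * (1 + (√(B / A) * v) ^ 2)⁻¹ := fun v => by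
    rw [mul_pow, Real.sq_sqrt (by positivity)]; field_simp
  simp_rw [h1]
  rw [integral_const_mul, Measure.integral_comp_mul_left (fun v => (1 + v ^ 2)⁻¹),
    integral_univ_inv_one_add_sq, abs_of_nonneg (by positivity), smul_eq_mul,
    Real.sqrt_div hB.le, Real.sqrt_mul hA.le]
  have := Real.sq_sqrt hA.le
  have : 0 < √A := Real.sqrt_pos.2 hA
  have : 0 < √B := Real.sqrt_pos.2 hB
  field_simp
  rw [Real.sq_sqrt hA.le]

/-- The point dividing `d` and `c` with weights `1` and `v²`. -/
noncomputable def divPoint (c d v : ℝ) : ℝ := (d + c * v ^ 2) / (1 + v ^ 2)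

theorem measurable_divPoint (c d : ℝ) : Measurable (divPoint c d) := by
  unfold divPoint; fun_prop

theorem divPoint_pos {c d : ℝ} (hc : 0 ≤ c) (hd : 0 < d) (v : ℝ) : 0 < divPoint c d v := by
  unfold divPoint; positivity

theorem le_divPoint {c d : ℝ} (h : c ≤ d) (v : ℝ) : c ≤ divPoint c d v := by
  unfold divPoint; rw [le_div_iff₀ (by positivity)]; nlinarith

theorem divPoint_le {c d : ℝ} (h : c ≤ d) (v : ℝ) : divPoint c d v ≤ d := by
  unfold divPoint
  rw [div_le_iff₀ (by positivity)]
  nlinarith [mul_le_mul_of_nonneg_right h (sq_nonneg v)]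

/-- Against the Cauchy density the factor 1 + v² cancels, leaving a multiple of the inverse of (1 -
ud) + (1 - uc)v². To the right of the poles both coefficients change sign, and the quotient under
the root is again positive. -/
theorem integral_divPoint {c d u : ℝ} (h : c ≤ d) (hu : u * d < 1 ∨ 1 < u * c) (hc : 0 ≤ c) :
    ∫ v, (1 - u * c) * (1 - u * divPoint c d v)⁻¹ ∂stdC = √((1 - u * c) / (1 - u * d)) := by
  rw [integral_stdC]
  rcases hu with hu | hu
  · have h1 : 0 < 1 - u * d := by linarith
    have h2 : 0 < 1 - u * c := by
      rcases le_or_gt 0 u with hu0 | hu0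
      · nlinarith
      · nlinarith
    have e (v : ℝ) : π⁻¹ * (1 + v ^ 2)⁻¹ * ((1 - u * c) * (1 - u * divPoint c d v)⁻¹) =
        π⁻¹ * (1 - u * c) * ((1 - u * d) + (1 - u * c) * v ^ 2)⁻¹ := by
      have e1 : 1 - u * divPoint c d v = ((1 - u * d) + (1 - u * c) * v ^ 2) / (1 + v ^ 2) := by
        unfold divPoint; field_simp; ring
      have : 0 < (1 - u * d) + (1 - u * c) * v ^ 2 := by positivity
      rw [e1]; field_simp
    simp_rw [e]
    rw [integral_const_mul, integral_inv_add_mul_sq h1 h2, Real.sqrt_div h2.le,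
      Real.sqrt_mul h1.le]
    have := Real.sqrt_pos.2 h1
    have := Real.sqrt_pos.2 h2
    have := pi_pos
    field_simp
    rw [Real.sq_sqrt h2.le]
  · have hu0 : 0 < u := by
      by_contra! hcon; nlinarith
    have h2 : 0 < u * c - 1 := by linarith
    have h1 : 0 < u * d - 1 := by nlinarith
    have e (v : ℝ) : π⁻¹ * (1 + v ^ 2)⁻¹ * ((1 - u * c) * (1 - u * divPoint c d v)⁻¹) =
        π⁻¹ * (u * c - 1) * ((u * d - 1) + (u * c - 1) * v ^ 2)⁻¹ := by
      have e1 : 1 - u * divPoint c d v = -(((u * d - 1) + (u * c - 1) * v ^ 2) / (1 + v ^ 2)) := by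
        unfold divPoint; field_simp; ring
      have : 0 < (u * d - 1) + (u * c - 1) * v ^ 2 := by positivity
      rw [e1]; field_simp; ring
    simp_rw [e]
    have e2 : (1 - u * c) / (1 - u * d) = (u * c - 1) / (u * d - 1) := by
      rw [← neg_sub, ← neg_sub (u * d), neg_div_neg_eq]
    rw [integral_const_mul, integral_inv_add_mul_sq h1 h2, e2, Real.sqrt_div h2.le,
      Real.sqrt_mul h1.le]
    have := Real.sqrt_pos.2 h1
    have := Real.sqrt_pos.2 h2
    have := pi_pos
    field_simp
    rw [Real.sq_sqrt h2.le]

/-- `N u = w₀ + ∫ (1 - u s)⁻¹ dν(s)` with `w₀ ≥ 0` and `ν` a finite measure on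
`[α, β] ∩ (0, ∞)`, for `u` to the left or to the right of the poles. -/
def IsStieltjes (α β : ℝ) (N : ℝ → ℝ) : Prop :=
  ∃ (w₀ : ℝ) (ν : Measure ℝ), 0 ≤ w₀ ∧ IsFiniteMeasure ν ∧ (∀ᵐ s ∂ν, 0 < s ∧ α ≤ s ∧ s ≤ β) ∧
    ∀ u, (u * β < 1 ∨ 1 < u * α) → N u = w₀ + ∫ s, (1 - u * s)⁻¹ ∂ν

theorem integrable_of_ae_bdd {α : Type*} [MeasurableSpace α] {ν : Measure α} [IsFiniteMeasure ν]
    {k : α → ℝ} (hk : Measurable k) {C : ℝ} (hb : ∀ᵐ x ∂ν, |k x| ≤ C) : Integrable k ν :=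
  (integrable_const C).mono' hk.aestronglyMeasurable hb

theorem exists_bound_inv {α β u : ℝ} (hα : 0 ≤ α) (hu : u * β < 1 ∨ 1 < u * α) :
    ∃ C, ∀ s, (0 < s ∧ α ≤ s ∧ s ≤ β) → |(1 - u * s)⁻¹| ≤ C := by
  rcases hu with hu | hu
  · refine ⟨max 1 (1 - u * β)⁻¹, fun s hs => ?_⟩
    rcases le_or_gt 0 u with h | h
    · have : 1 - u * β ≤ 1 - u * s := by nlinarith
      rw [abs_of_pos (inv_pos.2 (by linarith))]
      exact le_max_of_le_right (inv_anti₀ (by linarith) this)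
    · have : 1 ≤ 1 - u * s := by nlinarith
      rw [abs_of_pos (inv_pos.2 (by linarith))]
      exact le_max_of_le_left (inv_le_one_of_one_le₀ this)
  · refine ⟨(u * α - 1)⁻¹, fun s hs => ?_⟩
    have hu0 : 0 ≤ u := by
      by_contra! hcon
      nlinarith
    have : u * α - 1 ≤ u * s - 1 := by nlinarith
    rw [← abs_neg, ← inv_neg, neg_sub, abs_of_pos (inv_pos.2 (by linarith))]
    exact inv_anti₀ (by linarith) this

/-- In the Cauchy mixture of `integral_divPoint`, write (1 - uc)/(1 - us) = c/s + (1 - c/s)(1 -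
us)⁻¹. Since c ≤ s, the constant and the weights are nonnegative. -/
theorem isStieltjes_sqrt {c d : ℝ} (hc : 0 ≤ c) (hcd : c < d) :
    IsStieltjes c d fun u => √((1 - u * c) / (1 - u * d)) := by
  have hd : 0 < d := hc.trans_lt hcd
  have hm := measurable_divPoint c d
  have hw0 (v : ℝ) : 0 ≤ 1 - c / divPoint c d v := by
    have := divPoint_pos hc hd v
    rw [sub_nonneg, div_le_one this]; exact le_divPoint hcd.le v
  have hw1 (v : ℝ) : 0 ≤ c / divPoint c d v := div_nonneg hc (divPoint_pos hc hd v).le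
  have hi1 : Integrable (fun v => c / divPoint c d v) stdC :=
    integrable_of_ae_bdd (C := 1) (by fun_prop) (ae_of_all _ fun v => by
      rw [abs_of_nonneg (hw1 v)]; linarith [hw0 v])
  have hi2 : Integrable (fun v => 1 - c / divPoint c d v) stdC := (integrable_const _).sub hi1
  set κ := (stdC.withDensity fun v => ENNReal.ofReal (1 - c / divPoint c d v)).map (divPoint c d)
  have hfin : IsFiniteMeasure (stdC.withDensity fun v => ENNReal.ofReal (1 - c / divPoint c d v)) :=
    isFiniteMeasure_withDensity_ofReal hi2.2
  refine ⟨∫ v, c / divPoint c d v ∂stdC, κ, integral_nonneg hw1, inferInstance, ?_,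
    fun u hu => ?_⟩
  · have hms : MeasurableSet {s : ℝ | 0 < s ∧ c ≤ s ∧ s ≤ d} := measurableSet_Ioi.inter
      (measurableSet_Ici.inter measurableSet_Iic)
    refine (ae_map_iff hm.aemeasurable hms).2 ?_
    exact ae_of_all _ fun v => ⟨divPoint_pos hc hd v, le_divPoint hcd.le v, divPoint_le hcd.le v⟩
  · have hi3 : Integrable (fun v => (1 - c / divPoint c d v) * (1 - u * divPoint c d v)⁻¹)
        stdC := by
      obtain ⟨C, hC⟩ := exists_bound_inv hc hu
      refine hi2.mul_bdd (c := C) (Measurable.aestronglyMeasurable (by fun_prop))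
        (ae_of_all _ fun v => hC _ ⟨divPoint_pos hc hd v, le_divPoint hcd.le v,
          divPoint_le hcd.le v⟩)
    rw [integral_map (by fun_prop) (Measurable.aestronglyMeasurable (by fun_prop)),
      integral_withDensity_eq_integral_toReal_smul (by fun_prop) (by simp)]
    simp_rw [ENNReal.toReal_ofReal (hw0 _), smul_eq_mul]
    rw [← integral_add hi1 hi3, ← integral_divPoint hcd.le hu hc]
    congr 1; ext v
    have hs := divPoint_pos hc hd v
    have h1 := le_divPoint hcd.le v
    have h2 := divPoint_le hcd.le v
    set s := divPoint c d v
    have hne : 1 - u * s ≠ 0 := by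
      rcases hu with hu | hu
      · rcases le_or_gt 0 u with h | h <;> nlinarith
      · have hu0 : 0 ≤ u := by
          by_contra! hcon
          nlinarith
        nlinarith
    field_simp; ring

/-- Stieltjes functions with separated poles can be multiplied, as long as the first one is
nonnegative to the right of its poles. -/
theorem IsStieltjes.mul {α β c d : ℝ} {N R : ℝ → ℝ} (hN : IsStieltjes α β N)
    (hN0 : ∀ u, 1 < u * α → 0 ≤ N u) (hR : IsStieltjes c d R) (hdα : d < α)
    (hR0 : ∀ u, u * d < 1 → 0 ≤ R u) (hc : 0 ≤ c) (hcd : c ≤ d) (hαβ : α ≤ β) :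
    IsStieltjes c β fun u => N u * R u := by
  obtain ⟨w₀, ν, hw₀, hνf, hν, hNeq⟩ := hN
  obtain ⟨r₀, κ, hr₀, hκf, hκ, hReq⟩ := hR
  have hgap : 0 < α - d := by linarith
  have hα : 0 ≤ α := by linarith
  -- A and B are the new weights on the two pole families, from partial fractions of (1 - us)⁻¹(1 -
  -- ut)⁻¹. They equal R(1/s) and N(1/t). As d < α, the point 1/s is left of the poles of R and 1/t
  -- is right of those of N, which is where the sign hypotheses apply.
  set A : ℝ → ℝ := fun s => r₀ + ∫ t, s / (s - t) ∂κ with hAdef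
  set B : ℝ → ℝ := fun t => w₀ + ∫ s, t / (t - s) ∂ν with hBdef
  have hAm : Measurable A := by
    refine measurable_const.add ?_
    have : StronglyMeasurable (Function.uncurry fun s t : ℝ => s / (s - t)) :=
      Measurable.stronglyMeasurable (by fun_prop)
    exact this.integral_prod_right.measurable
  have hBm : Measurable B := by
    refine measurable_const.add ?_
    have : StronglyMeasurable (Function.uncurry fun t s : ℝ => t / (t - s)) :=
      Measurable.stronglyMeasurable (by fun_prop)
    exact this.integral_prod_right.measurable
  have hA : ∀ s, 0 < s ∧ α ≤ s ∧ s ≤ β → A s = R s⁻¹ := fun s hs => by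
    rw [hReq s⁻¹ (Or.inl (by rw [inv_mul_lt_iff₀ hs.1]; linarith))]
    simp only [A]
    congr 2; ext t
    have := hs.1.ne'
    rw [show 1 - s⁻¹ * t = (s - t) / s by field_simp, inv_div]
  have hB : ∀ t, 0 < t ∧ c ≤ t ∧ t ≤ d → B t = N t⁻¹ := fun t ht => by
    rw [hNeq t⁻¹ (Or.inr (by rw [lt_inv_mul_iff₀ ht.1]; linarith))]
    simp only [B]
    congr 2; ext s
    have := ht.1.ne'
    rw [show 1 - t⁻¹ * s = (t - s) / t by field_simp, inv_div]
  have hA0 : ∀ᵐ s ∂ν, 0 ≤ A s := hν.mono fun s hs => by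
    rw [hA s hs]; exact hR0 _ (by rw [inv_mul_lt_iff₀ hs.1]; linarith)
  have hB0 : ∀ᵐ t ∂κ, 0 ≤ B t := hκ.mono fun t ht => by
    rw [hB t ht]; exact hN0 _ (by rw [lt_inv_mul_iff₀ ht.1]; linarith)
  -- bounds
  have hst : ∀ s t, 0 < s ∧ α ≤ s ∧ s ≤ β → 0 < t ∧ c ≤ t ∧ t ≤ d →
      |s / (s - t)| ≤ β / (α - d) := fun s t hs ht => by
    have h1 : 0 < s - t := by linarith
    rw [abs_of_pos (div_pos hs.1 h1)]
    exact div_le_div₀ (by linarith) hs.2.2 hgap (by linarith)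
  have hts : ∀ s t, 0 < s ∧ α ≤ s ∧ s ≤ β → 0 < t ∧ c ≤ t ∧ t ≤ d →
      |t / (t - s)| ≤ β / (α - d) := fun s t hs ht => by
    have h1 : 0 < s - t := by linarith
    rw [← neg_sub s t, div_neg, abs_neg, abs_of_pos (div_pos ht.1 h1)]
    exact div_le_div₀ (by linarith) (by linarith) hgap (by linarith)
  have hAi : Integrable A ν := by
    refine integrable_of_ae_bdd hAm (C := |r₀| + β / (α - d) * κ.real Set.univ) ?_
    filter_upwards [hν] with s hs
    refine (abs_add_le _ _).trans (add_le_add le_rfl ?_)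
    exact norm_integral_le_of_norm_le_const (f := fun t => s / (s - t))
      (hκ.mono fun t ht => hst s t hs ht)
  have hBi : Integrable B κ := by
    refine integrable_of_ae_bdd hBm (C := |w₀| + β / (α - d) * ν.real Set.univ) ?_
    filter_upwards [hκ] with t ht
    refine (abs_add_le _ _).trans (add_le_add le_rfl ?_)
    exact norm_integral_le_of_norm_le_const (f := fun s => t / (t - s))
      (hν.mono fun s hs => hts s t hs ht)
  have hf1 : IsFiniteMeasure (ν.withDensity fun s => ENNReal.ofReal (A s)) :=
    isFiniteMeasure_withDensity_ofReal hAi.2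
  have hf2 : IsFiniteMeasure (κ.withDensity fun t => ENNReal.ofReal (B t)) :=
    isFiniteMeasure_withDensity_ofReal hBi.2
  refine ⟨w₀ * r₀, ν.withDensity (fun s => ENNReal.ofReal (A s)) +
    κ.withDensity (fun t => ENNReal.ofReal (B t)), mul_nonneg hw₀ hr₀, inferInstance, ?_,
    fun u hu => ?_⟩
  · rw [ae_add_measure_iff]
    refine ⟨(withDensity_absolutelyContinuous _ _).ae_le
      (hν.mono fun s hs => ⟨hs.1, by linarith, hs.2.2⟩),
      (withDensity_absolutelyContinuous _ _).ae_le
      (hκ.mono fun s hs => ⟨hs.1, hs.2.1, by linarith⟩)⟩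
  · have huN : u * β < 1 ∨ 1 < u * α := by
      rcases hu with h | h
      · exact Or.inl h
      · refine Or.inr (h.trans_le ?_)
        have : 0 ≤ u := by by_contra! hcon; nlinarith
        nlinarith
    have huR : u * d < 1 ∨ 1 < u * c := by
      rcases hu with h | h
      · left
        rcases le_or_gt 0 u with h0 | h0 <;> nlinarith
      · exact Or.inr h
    obtain ⟨C, hC⟩ := exists_bound_inv hα huN
    obtain ⟨D, hD⟩ := exists_bound_inv hc huR
    have i1 : Integrable (fun s => (1 - u * s)⁻¹) ν :=
      integrable_of_ae_bdd (by fun_prop) (hν.mono fun s hs => hC s hs)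
    have i2 : Integrable (fun t => (1 - u * t)⁻¹) κ :=
      integrable_of_ae_bdd (by fun_prop) (hκ.mono fun s hs => hD s hs)
    have i3 : Integrable (fun s => A s * (1 - u * s)⁻¹) ν :=
      hAi.mul_bdd (c := C) (Measurable.aestronglyMeasurable (by fun_prop))
        (hν.mono fun s hs => hC s hs)
    have i4 : Integrable (fun t => B t * (1 - u * t)⁻¹) κ :=
      hBi.mul_bdd (c := D) (Measurable.aestronglyMeasurable (by fun_prop))
        (hκ.mono fun s hs => hD s hs)
    have hνκ : ∀ᵐ p ∂ν.prod κ, (0 < p.1 ∧ α ≤ p.1 ∧ p.1 ≤ β) ∧ (0 < p.2 ∧ c ≤ p.2 ∧ p.2 ≤ d) :=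
      (Measure.quasiMeasurePreserving_fst.ae hν).and (Measure.quasiMeasurePreserving_snd.ae hκ)
    have i5 : Integrable (fun p : ℝ × ℝ => p.1 / (p.1 - p.2) * (1 - u * p.1)⁻¹) (ν.prod κ) := by
      refine integrable_of_ae_bdd (by fun_prop) (C := β / (α - d) * C) (hνκ.mono fun p hp => ?_)
      rw [abs_mul]
      exact mul_le_mul (hst _ _ hp.1 hp.2) (hC _ hp.1) (abs_nonneg _)
        ((abs_nonneg _).trans (hst _ _ hp.1 hp.2))
    have i6 : Integrable (fun p : ℝ × ℝ => p.2 / (p.2 - p.1) * (1 - u * p.2)⁻¹) (ν.prod κ) := by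
      refine integrable_of_ae_bdd (by fun_prop) (C := β / (α - d) * D) (hνκ.mono fun p hp => ?_)
      rw [abs_mul]
      exact mul_le_mul (hts _ _ hp.1 hp.2) (hD _ hp.2) (abs_nonneg _)
        ((abs_nonneg _).trans (hts _ _ hp.1 hp.2))
    have hprod : (∫ s, (1 - u * s)⁻¹ ∂ν) * ∫ t, (1 - u * t)⁻¹ ∂κ =
        (∫ s, (∫ t, s / (s - t) ∂κ) * (1 - u * s)⁻¹ ∂ν) +
        ∫ t, (∫ s, t / (t - s) ∂ν) * (1 - u * t)⁻¹ ∂κ := by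
      rw [← integral_prod_mul]
      have e : ∫ p : ℝ × ℝ, (1 - u * p.1)⁻¹ * (1 - u * p.2)⁻¹ ∂(ν.prod κ) =
          ∫ p : ℝ × ℝ, p.1 / (p.1 - p.2) * (1 - u * p.1)⁻¹ +
            p.2 / (p.2 - p.1) * (1 - u * p.2)⁻¹ ∂(ν.prod κ) := by
        refine integral_congr_ae (hνκ.mono fun p hp => ?_)
        have h1 : p.1 - p.2 ≠ 0 := by linarith [hp.1.2.1, hp.2.2.2]
        have h2 : p.2 - p.1 ≠ 0 := by intro h; apply h1; linarith
        have h3 : 1 - u * p.1 ≠ 0 := by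
          rcases huN with h | h
          · rcases le_or_gt 0 u with h0 | h0 <;> nlinarith [hp.1.2.2]
          · have : 0 ≤ u := by by_contra! hcon; nlinarith
            nlinarith [hp.1.2.1]
        have h4 : 1 - u * p.2 ≠ 0 := by
          rcases huR with h | h
          · rcases le_or_gt 0 u with h0 | h0 <;> nlinarith [hp.2.2.2]
          · have : 0 ≤ u := by by_contra! hcon; nlinarith
            nlinarith [hp.2.2.1]
        simp only
        rw [← neg_sub p.1 p.2, div_neg]
        field_simp; ring
      rw [e, integral_add i5 i6, integral_prod _ i5, integral_prod_symm _ i6]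
      simp_rw [integral_mul_const]
    have e3 : ∫ s, A s * (1 - u * s)⁻¹ ∂ν = r₀ * ∫ s, (1 - u * s)⁻¹ ∂ν +
        ∫ s, (∫ t, s / (s - t) ∂κ) * (1 - u * s)⁻¹ ∂ν := by
      rw [← integral_const_mul, ← integral_add (i1.const_mul _)]
      · congr 1; ext s; simp only [A]; ring
      · refine (i3.sub (i1.const_mul r₀)).congr (ae_of_all _ fun s => ?_)
        simp only [A, Pi.sub_apply]; ring
    have e4 : ∫ t, B t * (1 - u * t)⁻¹ ∂κ = w₀ * ∫ t, (1 - u * t)⁻¹ ∂κ +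
        ∫ t, (∫ s, t / (t - s) ∂ν) * (1 - u * t)⁻¹ ∂κ := by
      rw [← integral_const_mul, ← integral_add (i2.const_mul _)]
      · congr 1; ext s; simp only [B]; ring
      · refine (i4.sub (i2.const_mul w₀)).congr (ae_of_all _ fun s => ?_)
        simp only [B, Pi.sub_apply]; ring
    have d1 : ∀ᵐ s ∂ν, (ENNReal.ofReal (A s)).toReal • (1 - u * s)⁻¹ = A s * (1 - u * s)⁻¹ :=
      hA0.mono fun s hs => by rw [ENNReal.toReal_ofReal hs, smul_eq_mul]
    have d2 : ∀ᵐ s ∂κ, (ENNReal.ofReal (B s)).toReal • (1 - u * s)⁻¹ = B s * (1 - u * s)⁻¹ :=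
      hB0.mono fun s hs => by rw [ENNReal.toReal_ofReal hs, smul_eq_mul]
    simp only
    rw [integral_add_measure, integral_withDensity_eq_integral_toReal_smul (by fun_prop) (by simp),
      integral_withDensity_eq_integral_toReal_smul (by fun_prop) (by simp),
      integral_congr_ae d1, integral_congr_ae d2, e3, e4, hNeq u huN, hReq u huR]
    · linear_combination hprod
    · rw [integrable_withDensity_iff_integrable_smul' (by fun_prop) (by simp)]
      exact i3.congr (d1.mono fun s hs => hs.symm)
    · rw [integrable_withDensity_iff_integrable_smul' (by fun_prop) (by simp)]
      exact i4.congr (d2.mono fun s hs => hs.symm)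

end TraceEst

/-! ### Decomposition of quadratic forms into exponential variables. -/

namespace TraceEst

open Real Filter Topology
open scoped MeasureTheory NNReal ENNReal

/-- Sorted coefficients are consumed in pairs d > c through (1 - ud)^(-1/2)(1 - uc)^(-1/2) = √((1 -
uc)/(1 - ud)) · (1 - uc)⁻¹. The root is a Stieltjes function with poles from [c, d]. These intervals
are disjoint and descending, so `IsStieltjes.mul` absorbs each root into N, and c becomes an
exponential factor. -/
theorem exists_isStieltjes_of_sorted : ∀ (l : List ℝ), l.Pairwise (· > ·) → (∀ x ∈ l, 0 < x) →
    ∀ (α β : ℝ) (N : ℝ → ℝ), IsStieltjes α β N → (∀ u, 1 < u * α → 0 ≤ N u) → 0 ≤ α → α ≤ β →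
    (∀ x ∈ l, x < α) → ∃ (α' : ℝ) (N' : ℝ → ℝ) (bs : Multiset ℝ), 0 ≤ α' ∧ IsStieltjes α' β N' ∧
      ∀ u, u * β < 1 → N u * (l.map fun x => (√(1 - u * x))⁻¹).prod =
        N' u * (bs.map fun b => (1 - u * b)⁻¹).prod
  | [], _, _, α, β, N, hN, _, hα, _, _ => ⟨α, N, 0, hα, hN, fun u _ => by simp⟩
  -- A coefficient left without partner is paired with 0. The right-hand region 1 < u · 0 is then
  -- empty.
  | [d], _, hl, α, β, N, hN, hN0, hα, hαβ, hlα => by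
    have hd : 0 < d := hl d (by simp)
    refine ⟨0, _, 0, le_rfl, hN.mul hN0 (isStieltjes_sqrt le_rfl hd) (hlα d (by simp))
      (fun u _ => Real.sqrt_nonneg _) le_rfl hd.le hαβ, fun u _ => ?_⟩
    simp
  | d :: c :: l, hs, hl, α, β, N, hN, hN0, hα, hαβ, hlα => by
    have hd : 0 < d := hl d (by simp)
    have hc : 0 < c := hl c (by simp)
    have hcd : c < d := (List.pairwise_cons.1 hs).1 c (by simp)
    have hdα : d < α := hlα d (by simp)
    have hs' := (List.pairwise_cons.1 (List.pairwise_cons.1 hs).2)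
    have hN1 := hN.mul hN0 (isStieltjes_sqrt hc.le hcd) hdα
      (fun u _ => Real.sqrt_nonneg _) hc.le hcd.le hαβ
    obtain ⟨α', N', bs, hα', hN', heq⟩ := exists_isStieltjes_of_sorted l hs'.2
      (fun x hx => hl x (by simp [hx])) c β _ hN1
      (fun u hu => mul_nonneg (hN0 u (by
        have : 0 ≤ u := by by_contra! hcon; nlinarith
        nlinarith)) (Real.sqrt_nonneg _)) hc.le (by linarith) (fun x hx => hs'.1 x hx)
    refine ⟨α', N', c ::ₘ bs, hα', hN', fun u hu => ?_⟩
    have pos (x : ℝ) (hx : 0 < x) (hxβ : x ≤ β) : 0 < 1 - u * x := by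
      rcases le_or_gt 0 u with h | h <;> nlinarith
    have h1 := pos d hd (by linarith)
    have h2 := pos c hc (by linarith)
    have e : (√(1 - u * d))⁻¹ * (√(1 - u * c))⁻¹ =
        √((1 - u * c) / (1 - u * d)) * (1 - u * c)⁻¹ := by
      rw [Real.sqrt_div h2.le]
      have := Real.sqrt_pos.2 h1
      have := Real.sqrt_pos.2 h2
      have := Real.sq_sqrt h2.le
      field_simp
      linarith
    have := heq u hu
    simp only [List.map_cons, List.prod_cons, Multiset.map_cons, Multiset.prod_cons]
    rw [← mul_assoc (√(1 - u * d))⁻¹, e]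
    linear_combination (1 - u * c)⁻¹ * this

/-- A product of factors `(1 - u a)^(-1/2)` is a mixture of factors `(1 - u s)⁻¹` times a product
of factors `(1 - u b)⁻¹`. -/
theorem exists_mixture (n : ℕ) : ∀ w : Multiset ℝ, w.card = n → (∀ a ∈ w, 0 ≤ a) →
    ∃ (ν : Measure ℝ) (β : ℝ) (bs : Multiset ℝ), IsProbabilityMeasure ν ∧ 0 < β ∧
      (∀ᵐ s ∂ν, 0 ≤ s ∧ s ≤ β) ∧ ∀ u, |u| * β < 1 →
      (w.map fun a => (√(1 - u * a))⁻¹).prod =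
        (∫ s, (1 - u * s)⁻¹ ∂ν) * (bs.map fun b => (1 - u * b)⁻¹).prod := by
  induction n using Nat.strong_induction_on with
  | _ n ih =>
  intro w hn hw
  by_cases h0 : (0 : ℝ) ∈ w
  · obtain ⟨w', rfl⟩ := Multiset.exists_cons_of_mem h0
    obtain ⟨ν, β, bs, h1, h2, h3, h4⟩ := ih w'.card (by simp [← hn]) w' rfl
      fun a ha => hw a (by simp [ha])
    exact ⟨ν, β, bs, h1, h2, h3, fun u hu => by simp [h4 u hu]⟩
  by_cases hnd : w.Nodup
  -- Distinct positive coefficients: the recursion starts from the constant 1, with no poles and a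
  -- bound β above every coefficient.
  · obtain ⟨β, hβ0, hβ⟩ : ∃ β > 0, ∀ a ∈ w, a < β :=
      ⟨w.sum + 1, by linarith [Multiset.sum_nonneg hw], fun a ha => by
        linarith [Multiset.single_le_sum hw a ha]⟩
    have hst : IsStieltjes β β fun _ => 1 :=
      ⟨1, 0, zero_le_one, inferInstance, by simp, fun u _ => by simp⟩
    have hpw : (w.sort (· ≥ ·)).Pairwise (· > ·) := by
      have h1 := w.pairwise_sort (r := (· ≥ ·))
      have h2 : (w.sort (· ≥ ·)).Nodup := by
        rw [← Multiset.coe_nodup, Multiset.sort_eq]; exact hnd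
      exact (h1.and h2).imp fun h => lt_of_le_of_ne h.1 h.2.symm
    obtain ⟨α', N', bs, hα', ⟨w₀, ν, hw₀, hνf, hν, hN'⟩, heq⟩ := exists_isStieltjes_of_sorted
      (w.sort (· ≥ ·)) hpw (fun x hx => by
        rw [Multiset.mem_sort] at hx
        exact lt_of_le_of_ne (hw x hx) fun h => h0 (h ▸ hx)) β β _ hst (fun _ _ => zero_le_one)
      hβ0.le le_rfl fun x hx => hβ x (by rwa [Multiset.mem_sort] at hx)
    have hint (f : ℝ → ℝ) (hf : Integrable f ν) :
        ∫ s, f s ∂(ENNReal.ofReal w₀ • Measure.dirac 0 + ν) = w₀ * f 0 + ∫ s, f s ∂ν := by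
      rw [integral_add_measure ((integrable_dirac (by simp)).smul_measure (by simp)) hf,
        integral_smul_measure, integral_dirac, ENNReal.toReal_ofReal hw₀, smul_eq_mul]
    -- The constant term becomes an atom at s = 0, where (1 - us)⁻¹ = 1. The identity at u = 0 says
    -- that the total mass is 1.
    refine ⟨ENNReal.ofReal w₀ • Measure.dirac 0 + ν, β, bs, ?_, hβ0, ?_, fun u hu => ?_⟩
    · have h1 := heq 0 (by simp)
      rw [hN' 0 (by simp)] at h1
      simp only [zero_mul, sub_zero, Real.sqrt_one, inv_one, List.map_const', List.prod_replicate,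
        one_pow, mul_one, integral_const, smul_eq_mul, Multiset.map_const',
        Multiset.prod_replicate] at h1
      refine isProbabilityMeasure_iff_real.2 ?_
      rw [measureReal_add_apply (by simp [ENNReal.ofReal_ne_top]) (by simp), measureReal_ennreal_smul_apply, ENNReal.toReal_ofReal hw₀]
      simpa using h1.symm
    · rw [ae_add_measure_iff]
      refine ⟨Measure.ae_smul_measure ?_ _, hν.mono fun s hs => ⟨hs.1.le, hs.2.2⟩⟩
      rw [ae_dirac_iff (measurableSet_Icc (a := (0 : ℝ)) (b := β))]
      exact ⟨le_rfl, hβ0.le⟩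
    · have huβ : u * β < 1 := lt_of_le_of_lt (mul_le_mul_of_nonneg_right (le_abs_self u) hβ0.le) hu
      have h1 := heq u huβ
      obtain ⟨C, hC⟩ := exists_bound_inv hα' (Or.inl huβ)
      rw [hint _ (integrable_of_ae_bdd (by fun_prop) (hν.mono fun s hs => hC s hs))]
      rw [hN' u (Or.inl huβ), one_mul] at h1
      simp only [mul_zero, sub_zero, inv_one, mul_one]
      rw [← h1, ← Multiset.prod_coe, ← Multiset.map_coe, Multiset.sort_eq]
  -- A repeated coefficient contributes (1 - ua)⁻¹ exactly, an exponential factor that can be split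
  -- off.
  · obtain ⟨a, ha⟩ : ∃ a, ¬ w.count a ≤ 1 := by
      by_contra! hcon; exact hnd (Multiset.nodup_iff_count_le_one.2 hcon)
    obtain ⟨w', rfl⟩ : ∃ w', w = a ::ₘ a ::ₘ w' := by
      have h2 : Multiset.replicate 2 a ≤ w := Multiset.le_count_iff_replicate_le.1 (by omega)
      obtain ⟨w', rfl⟩ := Multiset.le_iff_exists_add.1 h2
      exact ⟨w', by simp [Multiset.replicate_succ]⟩
    obtain ⟨ν, β, bs, h1, h2, h3, h4⟩ := ih w'.card (by simp [← hn]) w' rfl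
      fun a ha => hw a (by simp [ha])
    have ha0 := hw a (by simp)
    refine ⟨ν, max β a, a ::ₘ bs, h1, lt_max_of_lt_left h2,
      h3.mono fun s hs => ⟨hs.1, le_max_of_le_left hs.2⟩, fun u hu => ?_⟩
    have hu1 : |u| * β < 1 :=
      (mul_le_mul_of_nonneg_left (le_max_left _ _) (abs_nonneg u)).trans_lt hu
    have hu2 : |u| * a < 1 :=
      (mul_le_mul_of_nonneg_left (le_max_right _ _) (abs_nonneg u)).trans_lt hu
    have hpos : 0 ≤ 1 - u * a := by
      have := mul_le_mul_of_nonneg_right (le_abs_self u) ha0; linarith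
    simp only [Multiset.map_cons, Multiset.prod_cons]
    rw [← mul_assoc, ← mul_inv, Real.mul_self_sqrt hpos, h4 u hu1]
    ring

theorem integrable_exp_stdE {v : ℝ} (hv : v < 1) : Integrable (fun e => exp (v * e)) stdE := by
  rw [integrable_stdE_iff]
  refine (integrableOn_exp_mul_Ioi (a := v - 1) (by linarith) 0).congr (ae_of_all _ fun x => ?_)
  simp only; rw [← exp_add]; ring_nf

theorem integral_exp_stdE {v : ℝ} (hv : v < 1) : ∫ e, exp (v * e) ∂stdE = (1 - v)⁻¹ := by
  rw [integral_stdE]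
  have : ∀ e : ℝ, exp (v * e) * exp (-e) = exp ((v - 1) * e) := fun e => by
    rw [← exp_add]; ring_nf
  simp_rw [this]
  rw [integral_exp_mul_Ioi (by linarith), mul_zero, exp_zero, neg_div, one_div, ← inv_neg, neg_sub]

/-- A probability measure with the moment generating function of a shifted sum of scaled
exponential variables, near zero, which acts on bell shaped laws by convolution. -/
theorem exists_expSum (bs : Multiset ℝ) (c : ℝ) : ∃ κ : Measure ℝ, IsProbabilityMeasure κ ∧
    (∀ μ : Measure ℝ, IsProbabilityMeasure μ → BellShaped μ → BellShaped (μ ∗ κ)) ∧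
    ∃ δ > 0, ∀ u, |u| < δ → Integrable (fun x => exp (u * x)) κ ∧
      ∫ x, exp (u * x) ∂κ = exp (u * c) * (bs.map fun b => (1 - u * b)⁻¹).prod := by
  induction bs using Multiset.induction_on with
  | empty => exact ⟨Measure.dirac c, inferInstance, fun μ _ h => h.conv_dirac c, 1, one_pos,
      fun u _ => ⟨integrable_dirac (by simp), by simp⟩⟩
  | cons b bs ih =>
    obtain ⟨κ, hκ, hbell, δ, hδ, hmgf⟩ := ih
    refine ⟨κ ∗ expLaw b, inferInstance, fun μ hμ h => ?_, min δ (1 / (|b| + 1)), by positivity,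
      fun u hu => ?_⟩
    · rw [← Measure.conv_assoc]
      exact (hbell μ hμ h).conv_expLaw b
    · have h1 := hmgf u (hu.trans_le (min_le_left _ _))
      have h2 := hu.trans_le (min_le_right _ _)
      rw [lt_div_iff₀ (by positivity)] at h2
      have h3 : u * b < 1 := by
        have := le_abs_self (u * b)
        rw [abs_mul] at this
        nlinarith [abs_nonneg u, abs_nonneg b]
      have e (x : ℝ) : exp (u * (b * x)) = exp (u * b * x) := by rw [mul_assoc]
      have i1 : Integrable (fun x => exp (u * x)) (expLaw b) := by
        rw [expLaw, integrable_map_measure (by fun_prop) (by fun_prop)]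
        exact (integrable_exp_stdE h3).congr (ae_of_all _ fun x => (e x).symm)
      refine ⟨integrable_exp_conv h1.1 i1, ?_⟩
      rw [integral_exp_conv, h1.2, expLaw, integral_map (by fun_prop) (by fun_prop)]
      simp_rw [e]
      rw [integral_exp_stdE h3, Multiset.map_cons, Multiset.prod_cons]
      ring

theorem mgf_twoSided {ν₁ ν₂ : Measure ℝ} [IsProbabilityMeasure ν₁] [IsProbabilityMeasure ν₂]
    {β₁ β₂ u : ℝ} (h1 : ∀ᵐ s ∂ν₁, 0 ≤ s ∧ s ≤ β₁) (h2 : ∀ᵐ s ∂ν₂, 0 ≤ s ∧ s ≤ β₂)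
    (hu1 : |u| * β₁ < 1) (hu2 : |u| * β₂ < 1) :
    Integrable (fun x => exp (u * x)) (twoSided 0 (ν₁.prod ν₂)) ∧
    ∫ x, exp (u * x) ∂(twoSided 0 (ν₁.prod ν₂)) =
      (∫ s, (1 - u * s)⁻¹ ∂ν₁) * ∫ s, (1 - -u * s)⁻¹ ∂ν₂ := by
  have hν : ∀ᵐ p ∂ν₁.prod ν₂, (0 ≤ p.1 ∧ p.1 ≤ β₁) ∧ (0 ≤ p.2 ∧ p.2 ≤ β₂) :=
    (Measure.quasiMeasurePreserving_fst.ae h1).and (Measure.quasiMeasurePreserving_snd.ae h2)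
  have hlt {v β s : ℝ} (hv : |v| * β < 1) (hs : 0 ≤ s ∧ s ≤ β) : v * s < 1 :=
    ((mul_le_mul_of_nonneg_right (le_abs_self v) hs.1).trans
      (mul_le_mul_of_nonneg_left hs.2 (abs_nonneg v))).trans_lt hv
  have hbd {v β : ℝ} {ν : Measure ℝ} [IsProbabilityMeasure ν] (hv : |v| * β < 1)
      (h : ∀ᵐ s ∂ν, 0 ≤ s ∧ s ≤ β) : Integrable (fun s => (1 - v * s)⁻¹) ν := by
    refine integrable_of_ae_bdd (C := (1 - |v| * β)⁻¹) (by fun_prop) (h.mono fun s hs => ?_)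
    have := hlt hv hs
    rw [abs_of_pos (inv_pos.2 (by linarith))]
    refine inv_anti₀ (by linarith) ?_
    have := ((mul_le_mul_of_nonneg_right (le_abs_self v) hs.1).trans
      (mul_le_mul_of_nonneg_left hs.2 (abs_nonneg v)))
    linarith
  have e (p : (ℝ × ℝ) × ℝ × ℝ) : exp (u * ((p.1.1 + 0) * p.2.1 - (p.1.2 + 0) * p.2.2)) =
      exp (u * p.1.1 * p.2.1) * exp (-u * p.1.2 * p.2.2) := by
    rw [← exp_add]; ring_nf
  have hin : ∀ᵐ p ∂ν₁.prod ν₂,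
      ∫ q : ℝ × ℝ, exp (u * p.1 * q.1) * exp (-u * p.2 * q.2) ∂(stdE.prod stdE) =
        (1 - u * p.1)⁻¹ * (1 - -u * p.2)⁻¹ := hν.mono fun p hp => by
    rw [integral_prod_mul (fun e => exp (u * p.1 * e)) (fun e => exp (-u * p.2 * e)),
      integral_exp_stdE (hlt hu1 hp.1), integral_exp_stdE (hlt (by simpa using hu2) hp.2)]
  have hprod : Integrable (fun p : ℝ × ℝ => (1 - u * p.1)⁻¹ * (1 - -u * p.2)⁻¹) (ν₁.prod ν₂) :=
    (hbd hu1 h1).mul_prod (hbd (v := -u) (by simpa using hu2) h2)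
  have hint : Integrable (fun p : (ℝ × ℝ) × ℝ × ℝ => exp (u * p.1.1 * p.2.1) *
      exp (-u * p.1.2 * p.2.2)) ((ν₁.prod ν₂).prod (stdE.prod stdE)) := by
    rw [integrable_prod_iff (by fun_prop)]
    refine ⟨hν.mono fun p hp => ?_, hprod.congr (hin.mono fun p hp => ?_)⟩
    · exact (integrable_exp_stdE (hlt hu1 hp.1)).mul_prod
        (integrable_exp_stdE (v := -u * p.2) (hlt (by simpa using hu2) hp.2))
    · simp only
      rw [← hp]
      congr 1; ext q
      rw [Real.norm_of_nonneg (by positivity)]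
  refine ⟨?_, ?_⟩
  · rw [twoSided, integrable_map_measure (by fun_prop) (by fun_prop)]
    exact hint.congr (ae_of_all _ fun p => (e p).symm)
  · rw [twoSided, integral_map (by fun_prop) (by fun_prop)]
    simp_rw [e]
    rw [integral_prod _ hint, integral_congr_ae hin, integral_prod_mul (fun s => (1 - u * s)⁻¹)
      (fun s => (1 - -u * s)⁻¹)]

/-- Gaussian quadratic forms are sums of a two-sided mixture of exponentials and of independent
exponential variables. -/
theorem QuadMGF.exists_decomp {μ : Measure ℝ} {w : Multiset ℝ} {c : ℝ} (h : QuadMGF μ w c) :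
    ∃ (ν : Measure (ℝ × ℝ)) (κ : Measure ℝ), IsProbabilityMeasure ν ∧ IsProbabilityMeasure κ ∧
      (∀ᵐ p ∂ν, 0 ≤ p.1 ∧ 0 ≤ p.2) ∧
      (∀ μ : Measure ℝ, IsProbabilityMeasure μ → BellShaped μ → BellShaped (μ ∗ κ)) ∧
      μ = twoSided 0 ν ∗ κ := by
  have := h.prob
  -- The factors 2 and -2 convert 1 - 2ua into 1 - ux or 1 + ux with x ≥ 0. The negative part is
  -- thus handled at -u, and its exponentials enter with the opposite sign.
  set w₁ := (w.filter (0 ≤ ·)).map (2 * ·)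
  set w₂ := (w.filter (¬ 0 ≤ ·)).map (-2 * ·)
  obtain ⟨ν₁, β₁, b₁, hp1, hβ1, hs1, he1⟩ := exists_mixture _ w₁ rfl (by
    intro a ha
    obtain ⟨x, hx, rfl⟩ := Multiset.mem_map.1 ha
    have := (Multiset.mem_filter.1 hx).2
    positivity)
  obtain ⟨ν₂, β₂, b₂, hp2, hβ2, hs2, he2⟩ := exists_mixture _ w₂ rfl (by
    intro a ha
    obtain ⟨x, hx, rfl⟩ := Multiset.mem_map.1 ha
    have := (Multiset.mem_filter.1 hx).2
    linarith)
  obtain ⟨κ, hκ, hbell, δ, hδ, hmgf⟩ := exists_expSum (b₁ + b₂.map (- ·)) c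
  obtain ⟨δ', hδ', hw⟩ := exists_pos_forall_abs_lt_one w
  refine ⟨ν₁.prod ν₂, κ, inferInstance, hκ, ?_, hbell, ?_⟩
  · filter_upwards [Measure.quasiMeasurePreserving_fst.ae hs1,
      Measure.quasiMeasurePreserving_snd.ae hs2] with p h1 h2 using ⟨h1.1, h2.1⟩
  have key (u : ℝ) (hu : |u| < min (min δ δ') (min β₁⁻¹ β₂⁻¹)) :
      Integrable (fun x => exp (u * x)) μ ∧
      Integrable (fun x => exp (u * x)) (twoSided 0 (ν₁.prod ν₂) ∗ κ) ∧
      ∫ x, exp (u * x) ∂μ = ∫ x, exp (u * x) ∂(twoSided 0 (ν₁.prod ν₂) ∗ κ) := by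
    simp only [lt_min_iff] at hu
    have hu1 : |u| * β₁ < 1 := by
      have := hu.2.1; rwa [← one_div, lt_div_iff₀ hβ1] at this
    have hu2 : |u| * β₂ < 1 := by
      have := hu.2.2; rwa [← one_div, lt_div_iff₀ hβ2] at this
    have h1 := mgf_twoSided hs1 hs2 hu1 hu2
    have h2 := hmgf u hu.1.1
    refine ⟨h.integrable u (hw u hu.1.2), integrable_exp_conv h1.1 h2.1, ?_⟩
    rw [integral_exp_conv, h1.2, h2.2, h.integral_eq u (hw u hu.1.2), Multiset.map_add,
      Multiset.prod_add]
    have e1 := he1 u hu1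
    have e2 := he2 (-u) (by simpa using hu2)
    have e3 : (w.map fun a => (√(1 - 2 * u * a))⁻¹).prod =
        (w₁.map fun a => (√(1 - u * a))⁻¹).prod * (w₂.map fun a => (√(1 - -u * a))⁻¹).prod := by
      conv_lhs => rw [← Multiset.filter_add_not (0 ≤ ·) w]
      rw [Multiset.map_add, Multiset.prod_add]
      simp only [w₁, w₂, Multiset.map_map, Function.comp_def]
      congr 3 <;> ext a <;> ring_nf
    have e4 : ((b₂.map (- ·)).map fun b => (1 - u * b)⁻¹) = b₂.map fun b => (1 - -u * b)⁻¹ := by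
      rw [Multiset.map_map]; congr 1; ext b; simp
    rw [e3, e1, e2, e4]
    ring
  exact measure_ext_of_mgf_near_zero (δ := min (min δ δ') (min β₁⁻¹ β₂⁻¹)) (by positivity)
    (fun u hu => (key u hu).1) (fun u hu => (key u hu).2.1) (fun u hu => (key u hu).2.2)

theorem map_conv_map {α β : Type*} [MeasurableSpace α] [MeasurableSpace β] {m₁ : Measure α}
    {m₂ : Measure β} [SFinite m₁] [SFinite m₂] {f : α → ℝ} {g : β → ℝ} (hf : Measurable f)
    (hg : Measurable g) : m₁.map f ∗ m₂.map g = (m₁.prod m₂).map fun p => f p.1 + g p.2 := by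
  rw [Measure.conv, Measure.map_prod_map _ _ hf hg, Measure.map_map (by fun_prop) (by fun_prop)]
  rfl

/-- All perturbed laws are images of one product measure under maps continuous in η, so dominated
convergence applies. -/
theorem tendsto_integral_perturbed (ν : Measure (ℝ × ℝ)) (κ : Measure ℝ) [IsProbabilityMeasure ν]
    [IsProbabilityMeasure κ] {k : ℝ → ℝ} (hk : BddCont k) :
    Tendsto (fun η => ∫ x, k x ∂(((twoSided η ν ∗ κ) ∗ expLaw η) ∗ expLaw η)) (𝓝[>] 0)
      (𝓝 (∫ x, k x ∂(twoSided 0 ν ∗ κ))) := by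
  have e (η : ℝ) : ((twoSided η ν ∗ κ) ∗ expLaw η) ∗ expLaw η =
      ((((ν.prod (stdE.prod stdE)).prod κ).prod stdE).prod stdE).map fun p =>
        (p.1.1.1.1.1 + η) * p.1.1.1.2.1 - (p.1.1.1.1.2 + η) * p.1.1.1.2.2 + p.1.1.2 +
          η * p.1.2 + η * p.2 := by
    conv_lhs => rw [← Measure.map_id (μ := κ), twoSided, expLaw]
    rw [map_conv_map (by fun_prop) (by fun_prop), map_conv_map (by fun_prop) (by fun_prop),
      map_conv_map (by fun_prop) (by fun_prop)]
    rfl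
  have e0 : twoSided 0 ν ∗ κ = ((twoSided 0 ν ∗ κ) ∗ expLaw 0) ∗ expLaw 0 := by
    have : expLaw 0 = Measure.dirac 0 := by simp [expLaw]
    rw [this, Measure.conv_dirac_zero, Measure.conv_dirac_zero]
  rw [e0]
  simp_rw [e]
  have i (η : ℝ) := integral_map (μ := ((((ν.prod (stdE.prod stdE)).prod κ).prod stdE).prod stdE))
    (φ := fun p => (p.1.1.1.1.1 + η) * p.1.1.1.2.1 - (p.1.1.1.1.2 + η) * p.1.1.1.2.2 + p.1.1.2 +
          η * p.1.2 + η * p.2) (by fun_prop) hk.1.aestronglyMeasurable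
  simp_rw [i]
  obtain ⟨hkc, C, hC⟩ := hk
  refine tendsto_integral_filter_of_dominated_convergence (fun _ => C)
    (Eventually.of_forall fun η => (hkc.comp (by fun_prop)).aestronglyMeasurable)
    (Eventually.of_forall fun η => ae_of_all _ fun p => hC _) (integrable_const _)
    (ae_of_all _ fun p => ?_)
  refine Tendsto.mono_left ?_ nhdsWithin_le_nhds
  refine Continuous.tendsto (f := fun η => k ((p.1.1.1.1.1 + η) * p.1.1.1.2.1 -
    (p.1.1.1.1.2 + η) * p.1.1.1.2.2 + p.1.1.2 + η * p.1.2 + η * p.2)) ?_ 0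
  fun_prop

/-- Weak form of the convexity of the density of a Gaussian quadratic form in its tail. -/
theorem QuadMGF.integral_secondDeriv_nonneg {μ : Measure ℝ} {w : Multiset ℝ} {c : ℝ}
    (h : QuadMGF μ w c) {r : ℝ} (hr : 0 < r) (hP : μ.real {x | r ≤ |x|} < 1 / 3)
    {k k' k'' : ℝ → ℝ} {p q : ℝ} (hk' : ∀ x, HasDerivAt k (k' x) x)
    (hk'' : ∀ x, HasDerivAt k' (k'' x) x) (hc : BddCont k'') (h0 : ∀ x, 0 ≤ k x)
    (hsupp : ∀ x, x ∉ Set.Icc p q → k x = 0) (hp : 5 * (r + 1) ≤ p) :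
    0 ≤ ∫ x, k'' x ∂μ := by
  have := h.prob
  obtain ⟨ν, κ, hν, hκ, hpos, hbell, rfl⟩ := h.exists_decomp
  refine ge_of_tendsto (tendsto_integral_perturbed ν κ hc) ?_
  -- The function g lies between the indicators of r + 1 ≤ |x| and r ≤ |x|. Being continuous, it
  -- carries the bound 1/3 over to small η, at the price of replacing r by r + 1.
  set g : ℝ → ℝ := fun x => min 1 (max 0 (|x| - r))
  have hg : BddCont g := ⟨by fun_prop, 1, fun x => by
    rw [abs_of_nonneg (le_min zero_le_one (le_max_left _ _))]; exact min_le_left _ _⟩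
  have hms (r : ℝ) : MeasurableSet {x : ℝ | r ≤ |x|} := measurableSet_le measurable_const (by fun_prop)
  have hle : ∫ x, g x ∂(twoSided 0 ν ∗ κ) < 1 / 3 := by
    refine lt_of_le_of_lt ?_ hP
    rw [← integral_indicator_one (hms r)]
    refine integral_mono (hg.integrable _) ((integrable_const 1).indicator (hms r)) fun x => ?_
    by_cases hx : r ≤ |x|
    · rw [Set.indicator_of_mem (by exact hx)]; exact min_le_left _ _
    · rw [Set.indicator_of_notMem (by exact hx)]
      simp only [g]
      rw [max_eq_left (by linarith)]; simp
  filter_upwards [(tendsto_integral_perturbed ν κ hg).eventually_lt_const hle, self_mem_nhdsWithin]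
    with η hη hη0
  refine integral_secondDeriv_nonneg_of_bellShaped
    (hbell _ inferInstance (bellShaped_twoSided hη0 hpos)) hη0 (by linarith : 0 < r + 1) ?_ hk' hk''
    hc.1 h0 hsupp hp
  refine lt_of_le_of_lt ?_ hη
  rw [← integral_indicator_one (hms (r + 1))]
  refine integral_mono ((integrable_const 1).indicator (hms (r + 1))) (hg.integrable _) fun x => ?_
  by_cases hx : r + 1 ≤ |x|
  · rw [Set.indicator_of_mem (by exact hx)]
    simp only [g, Pi.one_apply]
    rw [le_min_iff]; exact ⟨le_rfl, le_max_of_le_right (by linarith)⟩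
  · rw [Set.indicator_of_notMem (by exact hx)]
    exact le_min zero_le_one (le_max_left _ _)

end TraceEst

/-! ### A Chernoff bound depending only on the size of the coefficients. -/

namespace TraceEst

open Real Filter Topology
open scoped MeasureTheory NNReal ENNReal

/-- The bound e^y ≤ 1 + y + y² at y = -x - 2x² gives e^y ≤ 1 - x; then take square roots. -/
theorem inv_sqrt_one_sub_le_exp {x : ℝ} (hx : |x| ≤ 1 / 5) :
    (√(1 - x))⁻¹ ≤ exp (x / 2 + x ^ 2) := by
  obtain ⟨h1, h2⟩ := abs_le.1 hx
  have h3 : |-x - 2 * x ^ 2| ≤ 1 := abs_le.2 ⟨by nlinarith, by nlinarith⟩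
  have h4 := (abs_le.1 (Real.abs_exp_sub_one_sub_id_le h3)).2
  have h5 : exp (-x - 2 * x ^ 2) ≤ 1 - x := by
    nlinarith [mul_nonneg (sq_nonneg x) (show 0 ≤ 2 - (1 + 2 * x) ^ 2 by nlinarith)]
  have h6 : exp (-(x / 2 + x ^ 2)) ≤ √(1 - x) := by
    refine Real.le_sqrt_of_sq_le ?_
    rw [← exp_nat_mul]
    convert h5 using 2
    push_cast; ring
  rw [← neg_neg (x / 2 + x ^ 2), exp_neg]
  exact inv_anti₀ (exp_pos _) h6

theorem prod_inv_sqrt_le {w : Multiset ℝ} {u : ℝ} (hw : ∀ a ∈ w, |2 * u * a| ≤ 1 / 5) :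
    (w.map fun a => (√(1 - 2 * u * a))⁻¹).prod ≤
      exp (u * w.sum + 4 * u ^ 2 * (w.map (· ^ 2)).sum) := by
  induction w using Multiset.induction_on with
  | empty => simp
  | cons a w ih =>
    simp only [Multiset.map_cons, Multiset.prod_cons, Multiset.sum_cons]
    have h1 := inv_sqrt_one_sub_le_exp (hw a (by simp))
    have h2 := ih fun b hb => hw b (by simp [hb])
    refine (mul_le_mul h1 h2 (Multiset.prod_nonneg fun x hx => ?_) (exp_pos _).le).trans_eq ?_
    · obtain ⟨b, _, rfl⟩ := Multiset.mem_map.1 hx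
      positivity
    · rw [← exp_add]; ring_nf

theorem QuadMGF.tail_lt {μ : Measure ℝ} {w : Multiset ℝ} {c s : ℝ} (h : QuadMGF μ w c)
    (hs : 0 ≤ s) (hw : ∀ a ∈ w, |a| ≤ s) (hc : |c + w.sum| ≤ 4 * s)
    (hsq : (w.map (· ^ 2)).sum ≤ 3 * s ^ 2) :
    μ.real {x | 40 * (s + 1) ≤ |x|} < 1 / 3 := by
  have := h.prob
  -- With this u one has |2ua| ≤ 1/5, and the exponent of the moment generating function is at most
  -- 0.4 + 0.12 < 1. Moreover 40(s + 1)u = 4, so each side of the tail is at most e^(1-4) < 1/6.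
  set u : ℝ := (10 * (s + 1))⁻¹ with hu
  have hu0 : 0 < u := by positivity
  have hus : u * s ≤ 1 / 10 := by
    rw [hu, inv_mul_le_iff₀ (by positivity)]; linarith
  have key (v : ℝ) (hv : |v| = u) : Integrable (fun x => exp (v * x)) μ ∧
      ∫ x, exp (v * x) ∂μ ≤ exp 1 := by
    have hvw : ∀ a ∈ w, |2 * v * a| ≤ 1 / 5 := fun a ha => by
      rw [abs_mul, abs_mul, hv, abs_two]
      nlinarith [hw a ha]
    have hvw' : ∀ a ∈ w, |2 * v * a| < 1 := fun a ha => (hvw a ha).trans_lt (by norm_num)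
    refine ⟨h.integrable v hvw', ?_⟩
    rw [h.integral_eq v hvw']
    refine (mul_le_mul_of_nonneg_left (prod_inv_sqrt_le hvw) (exp_pos _).le).trans ?_
    rw [← exp_add]
    refine exp_le_exp.2 ?_
    have h1 : v * c + v * w.sum ≤ 4 / 10 := by
      rw [← mul_add]
      refine (le_abs_self _).trans ?_
      rw [abs_mul, hv]
      nlinarith [abs_nonneg (c + w.sum)]
    have h2 : v ^ 2 = u ^ 2 := by rw [← sq_abs, hv]
    have h3 : 4 * v ^ 2 * (w.map (· ^ 2)).sum ≤ 12 / 100 := by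
      rw [h2]
      calc 4 * u ^ 2 * (w.map (· ^ 2)).sum ≤ 4 * u ^ 2 * (3 * s ^ 2) := by gcongr
        _ = 12 * (u * s) ^ 2 := by ring
        _ ≤ 12 * (1 / 10) ^ 2 := by gcongr
        _ = 12 / 100 := by norm_num
    linarith
  have mk (v : ℝ) (hv : |v| = u) : μ.real {x | 4 ≤ v * x} ≤ exp (-3) := by
    obtain ⟨hi, hle⟩ := key v hv
    have h1 := mul_meas_ge_le_integral_of_nonneg (ae_of_all _ fun x => (exp_pos (v * x)).le) hi
      (exp 4)
    have h2 : {x | exp 4 ≤ exp (v * x)} = {x | 4 ≤ v * x} := by ext x; simp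
    rw [h2] at h1
    have h3 : exp 4 * μ.real {x | 4 ≤ v * x} ≤ exp 1 := h1.trans hle
    have h4 : exp (-3) = exp 1 / exp 4 := by rw [← exp_sub]; norm_num
    rw [h4, le_div_iff₀ (exp_pos _)]; linarith
  have hsub : {x : ℝ | 40 * (s + 1) ≤ |x|} ⊆ {x | 4 ≤ u * x} ∪ {x | 4 ≤ -u * x} := fun x hx => by
    have hx' : 40 * (s + 1) ≤ |x| := hx
    have h4 : 4 ≤ u * |x| := by
      rw [hu, ← div_eq_inv_mul, le_div_iff₀ (by positivity)]; linarith
    rcases abs_cases x with ⟨h, _⟩ | ⟨h, _⟩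
    · left; rw [h] at h4; exact h4
    · right; rw [h] at h4; simp only [Set.mem_ofPred_eq]; linarith
  have h6 := (measureReal_mono (μ := μ) hsub).trans (measureReal_union_le _ _)
  have h7 := mk u (abs_of_pos hu0)
  have h8 := mk (-u) (by rw [abs_neg, abs_of_pos hu0])
  have h9 : exp (-3) < 1 / 6 := by
    rw [exp_neg, inv_lt_comm₀ (exp_pos _) (by norm_num)]
    have := add_one_le_exp (1 : ℝ)
    have h : exp 3 = exp 1 ^ 3 := by rw [← exp_nat_mul]; norm_num
    rw [h]
    calc (1 / 6 : ℝ)⁻¹ < 2 ^ 3 := by norm_num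
      _ ≤ exp 1 ^ 3 := by gcongr; linarith
  linarith

/-! ### The derivative of expectations under rotation of two coefficients. -/

/-- A function with bounded continuous derivatives up to order three. -/
structure SmoothTest (h h₁ h₂ h₃ : ℝ → ℝ) : Prop where
  bdd : BddCont h
  bdd₁ : BddCont h₁
  bdd₂ : BddCont h₂
  bdd₃ : BddCont h₃
  deriv₁ : ∀ x, HasDerivAt h (h₁ x) x
  deriv₂ : ∀ x, HasDerivAt h₁ (h₂ x) x
  deriv₃ : ∀ x, HasDerivAt h₂ (h₃ x) x

theorem integral_chi {a : ℝ} {f : ℝ → ℝ} (hf : Measurable f) :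
    ∫ x, f x ∂(chi a) = ∫ z, f (a * (z ^ 2 - 1)) ∂stdG := by
  rw [chi, integral_map (by fun_prop) hf.aestronglyMeasurable]

theorem integrable_sq_mul_bdd {f : ℝ → ℝ} (hf : Measurable f) {C : ℝ} (hC : ∀ x, |f x| ≤ C) :
    Integrable (fun z => z ^ 2 * f z) stdG :=
  integrable_sq_stdG.mul_bdd (c := C) hf.aestronglyMeasurable (ae_of_all _ hC)

/-- Gaussian integration by parts for z G(a(z² - 1) + c). It trades one derivative of G for two
extra degrees of freedom. -/
theorem integral_chiThree_eq (a c : ℝ) {G G' : ℝ → ℝ} (hG : BddCont G) (hG' : BddCont G')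
    (hd : ∀ x, HasDerivAt G (G' x) x) :
    ∫ x, G (x + c) ∂(chiThree a) =
      ∫ x, G (x + c) ∂(chi a) + 2 * a * ∫ x, G' (x + c) ∂(chiThree a) := by
  obtain ⟨hGc, C, hC⟩ := hG
  obtain ⟨hGc', C', hC'⟩ := hG'
  have m1 : Measurable fun x => G (x + c) := hGc.measurable.comp (by fun_prop)
  have m2 : Measurable fun x => G' (x + c) := hGc'.measurable.comp (by fun_prop)
  rw [integral_chiThree m1, integral_chi m1, integral_chiThree m2]
  have hd' (z : ℝ) : HasDerivAt (fun z => z * G (a * (z ^ 2 - 1) + c))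
      (G (a * (z ^ 2 - 1) + c) + 2 * a * (z ^ 2 * G' (a * (z ^ 2 - 1) + c))) z := by
    have h1 : HasDerivAt (fun z : ℝ => a * (z ^ 2 - 1) + c) (a * (2 * z)) z := by
      simpa using (((hasDerivAt_pow 2 z).sub_const 1).const_mul a).add_const c
    convert! (hasDerivAt_id z).mul ((hd _).comp z h1) using 1
    simp only [id, Function.comp]; ring
  have i1 : Integrable (fun z => G (a * (z ^ 2 - 1) + c)) stdG :=
    integrable_of_bdd (hGc.measurable.comp (by fun_prop)) ⟨C, fun z => hC _⟩
  have i2 : Integrable (fun z => z ^ 2 * G' (a * (z ^ 2 - 1) + c)) stdG :=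
    integrable_sq_mul_bdd (hGc'.measurable.comp (by fun_prop)) fun z => hC' _
  have i3 : Integrable (fun z => z ^ 2 * G (a * (z ^ 2 - 1) + c)) stdG :=
    integrable_sq_mul_bdd (hGc.measurable.comp (by fun_prop)) fun z => hC _
  have i0 : Integrable (fun z : ℝ => z) stdG := by
    simpa using integrable_mul_exp_sq_stdG (t := 0) (by norm_num)
  have i4 : Integrable (fun z => z * G (a * (z ^ 2 - 1) + c)) stdG :=
    i0.mul_bdd (c := C) (hGc.comp (by fun_prop)).aestronglyMeasurable (ae_of_all _ fun z => hC _)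
  have := integral_mul_stdG hd' i4 (i1.add (i2.const_mul _))
    (i3.congr (ae_of_all _ fun z => by ring))
  rw [integral_add i1 (i2.const_mul _), integral_const_mul] at this
  rw [← this]
  congr 1; ext z; ring

theorem integral_conv_of_bddCont {μ ν : Measure ℝ} [IsProbabilityMeasure μ]
    [IsProbabilityMeasure ν] {G : ℝ → ℝ} (hG : BddCont G) :
    ∫ x, G x ∂(μ ∗ ν) = ∫ y, ∫ x, G (x + y) ∂μ ∂ν := by
  rw [Measure.conv_comm, integral_conv (hG.integrable _)]
  simp_rw [add_comm]

theorem BddCont.integrable_integral_add {G : ℝ → ℝ} (hG : BddCont G) (μ ν : Measure ℝ)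
    [IsProbabilityMeasure μ] [IsProbabilityMeasure ν] :
    Integrable (fun y => ∫ x, G (x + y) ∂μ) ν := by
  have : Integrable (fun p : ℝ × ℝ => G (p.2 + p.1)) (ν.prod μ) := by
    obtain ⟨hc, C, hC⟩ := hG
    exact integrable_of_bdd (hc.measurable.comp (by fun_prop)) ⟨C, fun p => hC _⟩
  exact this.integral_prod_left

theorem integral_chiThree_conv (a : ℝ) (ρ : Measure ℝ) [IsProbabilityMeasure ρ] {G G' : ℝ → ℝ}
    (hG : BddCont G) (hG' : BddCont G') (hd : ∀ x, HasDerivAt G (G' x) x) :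
    ∫ x, G x ∂(chiThree a ∗ ρ) =
      ∫ x, G x ∂(chi a ∗ ρ) + 2 * a * ∫ x, G' x ∂(chiThree a ∗ ρ) := by
  rw [integral_conv_of_bddCont hG, integral_conv_of_bddCont hG, integral_conv_of_bddCont hG',
    ← integral_const_mul, ← integral_add (hG.integrable_integral_add _ _)
      ((hG'.integrable_integral_add _ _).const_mul _)]
  congr 1; ext c
  exact integral_chiThree_eq a c hG hG' hd

theorem integral_prod_chi (a b : ℝ) (ρ : Measure ℝ) [IsProbabilityMeasure ρ] {G : ℝ → ℝ}
    (hG : BddCont G) : ∫ p : ℝ × ℝ × ℝ, G (a * (p.1 ^ 2 - 1) + (b * (p.2.1 ^ 2 - 1) + p.2.2))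
      ∂(stdG.prod (stdG.prod ρ)) = ∫ x, G x ∂(chi a ∗ (chi b ∗ ρ)) := by
  conv_rhs => rw [← Measure.map_id (μ := ρ)]
  rw [chi, chi, map_conv_map (by fun_prop) (by fun_prop), map_conv_map (by fun_prop) (by fun_prop),
    integral_map (by fun_prop) hG.1.aestronglyMeasurable]
  rfl

theorem integrable_prod_sq_left {ρ : Measure ℝ} [IsProbabilityMeasure ρ] :
    Integrable (fun p : ℝ × ℝ × ℝ => p.1 ^ 2) (stdG.prod (stdG.prod ρ)) :=
  (integrable_sq_stdG).comp_fst _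

theorem integrable_prod_sq_mid {ρ : Measure ℝ} [IsProbabilityMeasure ρ] :
    Integrable (fun p : ℝ × ℝ × ℝ => p.2.1 ^ 2) (stdG.prod (stdG.prod ρ)) :=
  ((integrable_sq_stdG).comp_fst ρ).comp_snd stdG

theorem integral_prod_chiThree_left (a b : ℝ) (ρ : Measure ℝ) [IsProbabilityMeasure ρ]
    {G : ℝ → ℝ} (hG : BddCont G) :
    ∫ p : ℝ × ℝ × ℝ, p.1 ^ 2 * G (a * (p.1 ^ 2 - 1) + (b * (p.2.1 ^ 2 - 1) + p.2.2))
      ∂(stdG.prod (stdG.prod ρ)) = ∫ x, G x ∂(chiThree a ∗ (chi b ∗ ρ)) := by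
  obtain ⟨hc, C, hC⟩ := hG
  have hi : Integrable (fun p : ℝ × ℝ × ℝ => p.1 ^ 2 *
      G (a * (p.1 ^ 2 - 1) + (b * (p.2.1 ^ 2 - 1) + p.2.2))) (stdG.prod (stdG.prod ρ)) :=
    integrable_prod_sq_left.mul_bdd (c := C) (hc.comp (by fun_prop)).aestronglyMeasurable
      (ae_of_all _ fun p => hC _)
  have e : chi b ∗ ρ = (stdG.prod ρ).map fun q => b * (q.1 ^ 2 - 1) + q.2 := by
    conv_lhs => rw [← Measure.map_id (μ := ρ)]
    rw [chi, map_conv_map (by fun_prop) (by fun_prop)]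
    rfl
  rw [integral_conv_of_bddCont ⟨hc, C, hC⟩, e, integral_map (by fun_prop)
    (StronglyMeasurable.aestronglyMeasurable (StronglyMeasurable.integral_prod_right (f := fun y x => G (x + y))
      (hc.comp (by fun_prop)).stronglyMeasurable)), integral_prod_symm _ hi]
  congr 1; ext q
  have m1 : Measurable fun x => G (x + (b * (q.1 ^ 2 - 1) + q.2)) :=
    hc.measurable.comp (by fun_prop)
  rw [integral_chiThree m1]

theorem integral_prod_chiThree_mid (a b : ℝ) (ρ : Measure ℝ) [IsProbabilityMeasure ρ]
    {G : ℝ → ℝ} (hG : BddCont G) :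
    ∫ p : ℝ × ℝ × ℝ, p.2.1 ^ 2 * G (a * (p.1 ^ 2 - 1) + (b * (p.2.1 ^ 2 - 1) + p.2.2))
      ∂(stdG.prod (stdG.prod ρ)) = ∫ x, G x ∂(chiThree b ∗ (chi a ∗ ρ)) := by
  rw [← integral_prod_chiThree_left b a ρ hG]
  have hmp : MeasurePreserving (fun p : ℝ × ℝ × ℝ => (p.2.1, p.1, p.2.2))
      (stdG.prod (stdG.prod ρ)) (stdG.prod (stdG.prod ρ)) := by
    have h1 := (measurePreserving_prodAssoc stdG stdG ρ).symm
    have h2 : MeasurePreserving (Prod.map Prod.swap id) ((stdG.prod stdG).prod ρ)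
      ((stdG.prod stdG).prod ρ) := Measure.measurePreserving_swap.prod (MeasurePreserving.id ρ)
    exact (measurePreserving_prodAssoc stdG stdG ρ).comp (h2.comp h1)
  obtain ⟨hc, C, hC⟩ := hG
  rw [← hmp.map_eq, integral_map (by fun_prop) (Continuous.aestronglyMeasurable
    (by have := hc; fun_prop)), hmp.map_eq]
  congr 1; ext p
  simp only
  ring_nf

/-- Derivative of the expectation of a test function along a rotation of two coefficients. -/
theorem hasDerivAt_integral_chi {h h₁ h₂ h₃ : ℝ → ℝ} (H : SmoothTest h h₁ h₂ h₃) (ρ : Measure ℝ)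
    [IsProbabilityMeasure ρ] (r τ : ℝ) :
    HasDerivAt (fun τ => ∫ x, h x ∂(chi (r * sin τ) ∗ (chi (r * cos τ) ∗ ρ)))
      (4 * (r * sin τ) * (r * cos τ) * (r * sin τ - r * cos τ) *
        ∫ x, h₃ x ∂(chiThree (r * sin τ) ∗ (chiThree (r * cos τ) ∗ ρ))) τ := by
  obtain ⟨C, hC⟩ := H.bdd₁.2
  obtain ⟨C₀, hC₀⟩ := H.bdd.2
  have hC0 : 0 ≤ C := (abs_nonneg _).trans (hC 0)
  set P := stdG.prod (stdG.prod ρ)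
  set Q : ℝ → ℝ × ℝ × ℝ → ℝ := fun τ p =>
    r * sin τ * (p.1 ^ 2 - 1) + (r * cos τ * (p.2.1 ^ 2 - 1) + p.2.2) with hQ
  have hQc (τ : ℝ) : Continuous (Q τ) := by simp only [hQ]; fun_prop
  have e1 : (fun τ => ∫ x, h x ∂(chi (r * sin τ) ∗ (chi (r * cos τ) ∗ ρ))) =
      fun τ => ∫ p, h (Q τ p) ∂P := funext fun τ => (integral_prod_chi _ _ ρ H.bdd).symm
  have hder : HasDerivAt (fun τ => ∫ p, h (Q τ p) ∂P)
      (∫ p, h₁ (Q τ p) * (r * cos τ * (p.1 ^ 2 - 1) - r * sin τ * (p.2.1 ^ 2 - 1)) ∂P) τ := by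
    refine (hasDerivAt_integral_of_dominated_loc_of_deriv_le (μ := P)
      (bound := fun p => C * (|r| * (p.1 ^ 2 + p.2.1 ^ 2 + 2)))
      (F := fun τ p => h (Q τ p))
      (F' := fun τ p => h₁ (Q τ p) * (r * cos τ * (p.1 ^ 2 - 1) - r * sin τ * (p.2.1 ^ 2 - 1)))
      (s := Set.univ) Filter.univ_mem ?_ ?_ ?_ ?_ ?_ ?_).2
    · exact Eventually.of_forall fun τ => (H.bdd.1.comp (hQc τ)).aestronglyMeasurable
    · exact integrable_of_bdd (H.bdd.1.comp (hQc τ)).measurable ⟨C₀, fun p => hC₀ _⟩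
    · exact ((H.bdd₁.1.comp (hQc τ)).mul (by fun_prop)).aestronglyMeasurable
    · refine ae_of_all _ fun p τ _ => ?_
      rw [norm_mul]
      refine mul_le_mul (hC _) ?_ (norm_nonneg _) hC0
      have : r * cos τ * (p.1 ^ 2 - 1) - r * sin τ * (p.2.1 ^ 2 - 1) =
        r * (cos τ * (p.1 ^ 2 - 1) - sin τ * (p.2.1 ^ 2 - 1)) := by ring
      rw [this, norm_mul]
      refine mul_le_mul_of_nonneg_left ?_ (norm_nonneg _)
      have b1 : |cos τ * (p.1 ^ 2 - 1)| ≤ p.1 ^ 2 + 1 := by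
        rw [abs_mul]
        refine (mul_le_of_le_one_left (abs_nonneg _) (abs_cos_le_one τ)).trans ?_
        exact abs_le.2 ⟨by nlinarith [sq_nonneg p.1], by linarith⟩
      have b2 : |sin τ * (p.2.1 ^ 2 - 1)| ≤ p.2.1 ^ 2 + 1 := by
        rw [abs_mul]
        refine (mul_le_of_le_one_left (abs_nonneg _) (abs_sin_le_one τ)).trans ?_
        exact abs_le.2 ⟨by nlinarith [sq_nonneg p.2.1], by linarith⟩
      refine (abs_sub _ _).trans ?_
      linarith
    · exact (((integrable_prod_sq_left.add integrable_prod_sq_mid).add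
        (integrable_const 2)).const_mul |r|).const_mul C
    · refine ae_of_all _ fun p τ _ => ?_
      have hq : HasDerivAt (fun τ => Q τ p)
          (r * cos τ * (p.1 ^ 2 - 1) - r * sin τ * (p.2.1 ^ 2 - 1)) τ := by
        have := (((hasDerivAt_sin τ).const_mul r).mul_const (p.1 ^ 2 - 1)).add
          ((((hasDerivAt_cos τ).const_mul r).mul_const (p.2.1 ^ 2 - 1)).add_const p.2.2)
        convert! this using 1
        ring
      exact (H.deriv₁ _).comp τ hq
  rw [e1]
  convert! hder using 1
  set a := r * sin τ
  set b := r * cos τ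
  have i0 : Integrable (fun p => h₁ (Q τ p)) P :=
    integrable_of_bdd (H.bdd₁.1.comp (hQc τ)).measurable ⟨C, fun p => hC _⟩
  have i1 : Integrable (fun p => p.1 ^ 2 * h₁ (Q τ p)) P :=
    integrable_prod_sq_left.mul_bdd (c := C) (H.bdd₁.1.comp (hQc τ)).aestronglyMeasurable
      (ae_of_all _ fun p => hC _)
  have i2 : Integrable (fun p => p.2.1 ^ 2 * h₁ (Q τ p)) P :=
    integrable_prod_sq_mid.mul_bdd (c := C) (H.bdd₁.1.comp (hQc τ)).aestronglyMeasurable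
      (ae_of_all _ fun p => hC _)
  have e2 : ∫ p, h₁ (Q τ p) * (b * (p.1 ^ 2 - 1) - a * (p.2.1 ^ 2 - 1)) ∂P =
      b * (∫ p, p.1 ^ 2 * h₁ (Q τ p) ∂P - ∫ p, h₁ (Q τ p) ∂P) -
      a * (∫ p, p.2.1 ^ 2 * h₁ (Q τ p) ∂P - ∫ p, h₁ (Q τ p) ∂P) := by
    have j1 : Integrable (fun p => b * (p.1 ^ 2 * h₁ (Q τ p) - h₁ (Q τ p))) P :=
      (i1.sub i0).const_mul b
    have j2 : Integrable (fun p => a * (p.2.1 ^ 2 * h₁ (Q τ p) - h₁ (Q τ p))) P :=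
      (i2.sub i0).const_mul a
    rw [← integral_sub i1 i0, ← integral_sub i2 i0, ← integral_const_mul, ← integral_const_mul,
      ← integral_sub j1 j2]
    congr 1; ext p; ring
  have e3 : ∫ p, p.1 ^ 2 * h₁ (Q τ p) ∂P = ∫ x, h₁ x ∂(chiThree a ∗ (chi b ∗ ρ)) :=
    integral_prod_chiThree_left a b ρ H.bdd₁
  have e4 : ∫ p, p.2.1 ^ 2 * h₁ (Q τ p) ∂P = ∫ x, h₁ x ∂(chiThree b ∗ (chi a ∗ ρ)) :=
    integral_prod_chiThree_mid a b ρ H.bdd₁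
  have e5 : ∫ p, h₁ (Q τ p) ∂P = ∫ x, h₁ x ∂(chi a ∗ (chi b ∗ ρ)) :=
    integral_prod_chi a b ρ H.bdd₁
  have comm (α β : Measure ℝ) [IsProbabilityMeasure α] [IsProbabilityMeasure β] :
      α ∗ (β ∗ ρ) = β ∗ (α ∗ ρ) := by
    rw [← Measure.conv_assoc, Measure.conv_comm α, Measure.conv_assoc]
  -- Index expectations by the degrees of freedom of a and b. The first two identities reduce the
  -- derivative to 2ab(E₃₁ - E₁₃)h₂. The other two raise both terms to E₃₃, where the h₂ parts
  -- cancel and 2(a - b)E₃₃h₃ remains.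
  have f1 := integral_chiThree_conv a (chi b ∗ ρ) H.bdd₁ H.bdd₂ H.deriv₂
  have f2 := integral_chiThree_conv b (chi a ∗ ρ) H.bdd₁ H.bdd₂ H.deriv₂
  have f3 := integral_chiThree_conv a (chiThree b ∗ ρ) H.bdd₂ H.bdd₃ H.deriv₃
  have f4 := integral_chiThree_conv b (chiThree a ∗ ρ) H.bdd₂ H.bdd₃ H.deriv₃
  rw [comm (chi b) (chi a)] at f2
  rw [comm (chi a) (chiThree b)] at f3
  rw [comm (chiThree b) (chiThree a), comm (chi b) (chiThree a)] at f4
  rw [e2, e3, e4, e5]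
  linear_combination (-b) * f1 + a * f2 - 2 * a * b * f3 + 2 * a * b * f4

end TraceEst

/-! ### Monotonicity of tails and majorization of coefficients. -/

namespace TraceEst

open Real Filter Topology
open scoped MeasureTheory NNReal ENNReal

theorem abs_le_of_sum_sq_le {w : Multiset ℝ} {s : ℝ} (hs : 0 ≤ s)
    (hV : (w.map (· ^ 2)).sum ≤ s ^ 2) : ∀ x ∈ w, |x| ≤ s := fun x hx => by
  refine abs_le_of_sq_le_sq (le_trans ?_ hV) hs
  refine Multiset.single_le_sum (fun y hy => ?_) _ (Multiset.mem_map_of_mem (· ^ 2) hx)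
  obtain ⟨z, _, rfl⟩ := Multiset.mem_map.1 hy
  positivity

theorem sum_sq_nonneg (w : Multiset ℝ) : 0 ≤ (w.map (· ^ 2)).sum :=
  Multiset.sum_nonneg fun y hy => by
    obtain ⟨z, _, rfl⟩ := Multiset.mem_map.1 hy
    positivity

/-- Threshold beyond which tails are monotone along rotations of coefficients whose squares sum
to at most `s ^ 2`. -/
noncomputable def tailThreshold (s : ℝ) : ℝ := 5 * (40 * (s + 1) + 1) + 1

/-- The law is that of a form with a and b taken three times, so its squares sum to at most 3s² and
its mean is 2a + 2b, of size at most 4s. Tail convexity is tested against the bump h₁, whose second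
derivative is h₃; the final 1 in the threshold accounts for its support [ε - 1, ε]. -/
theorem integral_chiThree_deriv_nonneg {a b : ℝ} {w : Multiset ℝ} {s : ℝ} (hs : 0 ≤ s)
    (hV : a ^ 2 + b ^ 2 + (w.map (· ^ 2)).sum ≤ s ^ 2) {h h₁ h₂ h₃ : ℝ → ℝ} {ε : ℝ}
    (H : SmoothTest h h₁ h₂ h₃) (h0 : ∀ x, 0 ≤ h₁ x)
    (hsupp : ∀ x, x ∉ Set.Icc (ε - 1) ε → h₁ x = 0) (hε : tailThreshold s ≤ ε) :
    0 ≤ ∫ x, h₃ x ∂(chiThree a ∗ (chiThree b ∗ quadLaw w)) := by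
  have hT := (quadMGF_chiThree a).conv ((quadMGF_chiThree b).conv (quadMGF_quadLaw w))
  have hw0 := sum_sq_nonneg w
  have ha : |a| ≤ s := abs_le_of_sq_le_sq (by nlinarith [sq_nonneg b]) hs
  have hb : |b| ≤ s := abs_le_of_sq_le_sq (by nlinarith [sq_nonneg a]) hs
  have hw := abs_le_of_sum_sq_le hs (w := w) (by nlinarith [sq_nonneg b, sq_nonneg a])
  refine hT.integral_secondDeriv_nonneg (r := 40 * (s + 1)) (by positivity)
    (hT.tail_lt hs ?_ ?_ ?_) H.deriv₂ H.deriv₃ H.bdd₃ h0 hsupp ?_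
  · intro x hx
    simp only [Multiset.mem_add, Multiset.insert_eq_cons, Multiset.mem_cons,
      Multiset.mem_singleton] at hx
    rcases hx with hx | hx | hx
    · rcases hx with rfl | rfl | rfl <;> exact ha
    · rcases hx with rfl | rfl | rfl <;> exact hb
    · exact hw x hx
  · simp only [Multiset.insert_eq_cons, Multiset.sum_add, Multiset.sum_cons,
      Multiset.sum_singleton]
    have : -a + (-b + -w.sum) + (a + (a + a) + (b + (b + b) + w.sum)) = 2 * a + 2 * b := by ring
    rw [this]
    rw [abs_le] at *
    constructor <;> linarith [ha.1, ha.2, hb.1, hb.2]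
  · simp only [Multiset.insert_eq_cons, Multiset.map_add, Multiset.map_cons, Multiset.sum_add,
      Multiset.sum_cons, Multiset.map_singleton, Multiset.sum_singleton]
    linarith
  · rw [tailThreshold] at hε; linarith

theorem deriv_eq_zero_of_notMem_Icc {f : ℝ → ℝ} {p q c d : ℝ} (hl : ∀ x < p, f x = c)
    (hr : ∀ x, q < x → f x = d) : ∀ x, x ∉ Set.Icc p q → deriv f x = 0 := fun x hx => by
  rw [Set.mem_Icc, not_and_or, not_le, not_le] at hx
  rcases hx with hx | hx
  · rw [Filter.EventuallyEq.deriv_eq (f := fun _ => c)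
      ((gt_mem_nhds hx).mono hl), deriv_const]
  · rw [Filter.EventuallyEq.deriv_eq (f := fun _ => d)
      ((lt_mem_nhds hx).mono hr), deriv_const]

theorem bddCont_of_support {f : ℝ → ℝ} {p q : ℝ} (hf : Continuous f)
    (h : ∀ x, x ∉ Set.Icc p q → f x = 0) : BddCont f :=
  ⟨hf, hf.bounded_above_of_compact_support (HasCompactSupport.intro isCompact_Icc h)⟩

/-- Smooth approximation of the indicator of `[ε, ∞)`. -/
noncomputable def smoothStep (ε N x : ℝ) : ℝ := smoothTransition (N * (x - ε) + 1)

/-- The step rises within [ε - 1/N, ε], inside an interval independent of N. One threshold therefore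
serves the whole approximating sequence. -/
theorem exists_smoothTest (ε : ℝ) {N : ℝ} (hN : 1 ≤ N) :
    ∃ h₁ h₂ h₃, SmoothTest (smoothStep ε N) h₁ h₂ h₃ ∧ (∀ x, 0 ≤ h₁ x) ∧
      ∀ x, x ∉ Set.Icc (ε - 1) ε → h₁ x = 0 := by
  set h := smoothStep ε N with hh
  have c0 : ContDiff ℝ 3 h := smoothTransition.contDiff.comp (by fun_prop)
  have c1 : ContDiff ℝ 2 (deriv h) := by
    have : ContDiff ℝ (2 + 1) h := c0
    exact (contDiff_succ_iff_deriv.1 this).2.2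
  have c2 : ContDiff ℝ 1 (deriv (deriv h)) := by
    have : ContDiff ℝ (1 + 1) (deriv h) := c1
    exact (contDiff_succ_iff_deriv.1 this).2.2
  have c3 : Continuous (deriv (deriv (deriv h))) := c2.continuous_deriv le_rfl
  have s1 : ∀ x, x ∉ Set.Icc (ε - 1) ε → deriv h x = 0 := by
    refine deriv_eq_zero_of_notMem_Icc (c := 0) (d := 1) (fun x hx => ?_) fun x hx => ?_
    · exact smoothTransition.zero_of_nonpos (by nlinarith)
    · exact smoothTransition.one_of_one_le (by nlinarith)
  have s2 {f : ℝ → ℝ} (hf : ∀ x, x ∉ Set.Icc (ε - 1) ε → f x = 0) :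
      ∀ x, x ∉ Set.Icc (ε - 1) ε → deriv f x = 0 :=
    deriv_eq_zero_of_notMem_Icc (c := 0) (d := 0) (fun x hx => hf x fun h' => hx.not_ge h'.1)
      fun x hx => hf x fun h' => hx.not_ge h'.2
  have mono : Monotone h := fun x y hxy =>
    smoothTransition.monotone (by
      have := mul_le_mul_of_nonneg_left (sub_le_sub_right hxy ε) (zero_le_one.trans hN)
      linarith)
  refine ⟨deriv h, deriv (deriv h), deriv (deriv (deriv h)), ⟨⟨c0.continuous, 1, fun x => ?_⟩,
    bddCont_of_support c1.continuous s1, bddCont_of_support c2.continuous (s2 s1),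
    bddCont_of_support c3 (s2 (s2 s1)),
    fun x => ((c0.differentiable (by norm_num)) x).hasDerivAt,
    fun x => ((c1.differentiable (by norm_num)) x).hasDerivAt,
    fun x => ((c2.differentiable (by norm_num)) x).hasDerivAt⟩, fun x => mono.deriv_nonneg, s1⟩
  rw [hh, smoothStep, abs_of_nonneg (smoothTransition.nonneg _)]
  exact smoothTransition.le_one _

theorem tendsto_integral_smoothStep (μ : Measure ℝ) [IsProbabilityMeasure μ] (ε : ℝ) :
    Tendsto (fun N : ℕ => ∫ x, smoothStep ε (N + 1) x ∂μ) atTop (𝓝 (μ.real {x | ε ≤ x})) := by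
  have hm : MeasurableSet {x : ℝ | ε ≤ x} := measurableSet_Ici
  rw [← integral_indicator_one hm]
  refine tendsto_integral_of_dominated_convergence (fun _ => 1) (fun N => ?_)
    (integrable_const 1) (fun N => ae_of_all _ fun x => ?_) (ae_of_all _ fun x => ?_)
  · have : Continuous (smoothStep ε (N + 1)) :=
      smoothTransition.continuous.comp (by fun_prop)
    exact this.aestronglyMeasurable
  · rw [norm_eq_abs, smoothStep, abs_of_nonneg (smoothTransition.nonneg _)]
    exact smoothTransition.le_one _
  · refine tendsto_const_nhds.congr' ?_
    by_cases hx : ε ≤ x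
    · refine Eventually.of_forall fun N => ?_
      have e : smoothStep ε (N + 1) x = 1 := smoothTransition.one_of_one_le (by
        have : (0 : ℝ) ≤ (N + 1) * (x - ε) := mul_nonneg (by positivity) (sub_nonneg.2 hx)
        linarith)
      rw [Set.indicator_of_mem (show x ∈ {x : ℝ | ε ≤ x} from hx)]
      exact e.symm
    · obtain ⟨N₀, hN₀⟩ := exists_nat_gt (1 / (ε - x))
      rw [not_le] at hx
      filter_upwards [eventually_ge_atTop N₀] with N hN
      rw [Set.indicator_of_notMem (fun h : x ∈ {x : ℝ | ε ≤ x} => hx.not_ge h), smoothStep,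
        smoothTransition.zero_of_nonpos]
      rw [div_lt_iff₀ (sub_pos.2 hx)] at hN₀
      have : (N₀ : ℝ) ≤ N := by exact_mod_cast hN
      nlinarith

/-- Tail probability. -/
noncomputable def tail (w : Multiset ℝ) (ε : ℝ) : ℝ := (quadLaw w).real {x | ε ≤ x}

theorem measureReal_Ici_le {μ ν : Measure ℝ} [IsProbabilityMeasure μ] [IsProbabilityMeasure ν]
    {ε : ℝ} (h : ∀ h h₁ h₂ h₃, SmoothTest h h₁ h₂ h₃ → (∀ x, 0 ≤ h₁ x) →
      (∀ x, x ∉ Set.Icc (ε - 1) ε → h₁ x = 0) → ∫ x, h x ∂μ ≤ ∫ x, h x ∂ν) :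
    μ.real {x | ε ≤ x} ≤ ν.real {x | ε ≤ x} := by
  refine le_of_tendsto_of_tendsto' (tendsto_integral_smoothStep μ ε)
    (tendsto_integral_smoothStep ν ε) fun N => ?_
  obtain ⟨h₁, h₂, h₃, H, h0, hs⟩ := exists_smoothTest ε (N := (N : ℝ) + 1) (by simp)
  exact h _ _ _ _ H h0 hs

theorem quadLaw_zero_cons (w : Multiset ℝ) : quadLaw (0 ::ₘ w) = quadLaw w := by
  have : chi 0 = Measure.dirac 0 := by simp [chi, Measure.map_const]
  rw [quadLaw_cons, this, Measure.dirac_zero_conv]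

theorem tail_zero_cons (w : Multiset ℝ) (ε : ℝ) : tail (0 ::ₘ w) ε = tail w ε := by
  rw [tail, quadLaw_zero_cons, tail]

/-- On this range of angles a ≥ b ≥ 0, so 4ab(a - b) ≥ 0 and the derivative of every smoothed tail
is nonnegative. -/
theorem tail_rotate_le {r s ε τ₁ τ₂ : ℝ} {w : Multiset ℝ} (hs : 0 ≤ s) (hr : 0 ≤ r)
    (hV : r ^ 2 + (w.map (· ^ 2)).sum ≤ s ^ 2) (hε : tailThreshold s ≤ ε) (h1 : π / 4 ≤ τ₁)
    (h12 : τ₁ ≤ τ₂) (h2 : τ₂ ≤ π / 2) :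
    tail (r * sin τ₁ ::ₘ r * cos τ₁ ::ₘ w) ε ≤ tail (r * sin τ₂ ::ₘ r * cos τ₂ ::ₘ w) ε := by
  refine measureReal_Ici_le fun h h₁ h₂ h₃ H h0 hsupp => ?_
  simp only [quadLaw_cons]
  have hd := hasDerivAt_integral_chi H (quadLaw w) r
  have hmono := monotoneOn_of_deriv_nonneg (convex_Icc (π / 4) (π / 2))
    (fun τ _ => (hd τ).continuousAt.continuousWithinAt)
    (fun τ _ => (hd τ).differentiableAt.differentiableWithinAt) (fun τ hτ => by
      rw [(hd τ).deriv]
      rw [interior_Icc] at hτ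
      have hπ := pi_pos
      have c1 : 0 ≤ cos τ := cos_nonneg_of_mem_Icc ⟨by linarith [hτ.1], hτ.2.le⟩
      have c2 : cos τ ≤ cos (π / 4) :=
        cos_le_cos_of_nonneg_of_le_pi (by linarith) (by linarith [hτ.2]) hτ.1.le
      have c3 : sin (π / 4) ≤ sin τ :=
        sin_le_sin_of_le_of_le_pi_div_two (by linarith) hτ.2.le hτ.1.le
      rw [cos_pi_div_four] at c2
      rw [sin_pi_div_four] at c3
      have c4 : 0 ≤ sin τ := by linarith
      refine mul_nonneg (mul_nonneg (by positivity) ?_) ?_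
      · rw [← mul_sub]; exact mul_nonneg hr (by linarith)
      · refine integral_chiThree_deriv_nonneg hs ?_ H h0 hsupp hε
        have := sin_sq_add_cos_sq τ
        calc _ = r ^ 2 * (sin τ ^ 2 + cos τ ^ 2) + (w.map (· ^ 2)).sum := by ring
          _ ≤ s ^ 2 := by rw [this]; linarith)
  exact hmono ⟨h1, h12.trans h2⟩ ⟨h1.trans h12, h2⟩ h12

/-- Here b ≤ 0 ≤ a, so 4ab(a - b) ≤ 0. This is the range that compares a negative coefficient with
its absolute value. -/
theorem tail_rotate_le' {r s ε τ₁ τ₂ : ℝ} {w : Multiset ℝ} (hs : 0 ≤ s) (hr : 0 ≤ r)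
    (hV : r ^ 2 + (w.map (· ^ 2)).sum ≤ s ^ 2) (hε : tailThreshold s ≤ ε) (h1 : π / 2 ≤ τ₁)
    (h12 : τ₁ ≤ τ₂) (h2 : τ₂ ≤ π) :
    tail (r * sin τ₂ ::ₘ r * cos τ₂ ::ₘ w) ε ≤ tail (r * sin τ₁ ::ₘ r * cos τ₁ ::ₘ w) ε := by
  refine measureReal_Ici_le fun h h₁ h₂ h₃ H h0 hsupp => ?_
  simp only [quadLaw_cons]
  have hd := hasDerivAt_integral_chi H (quadLaw w) r
  have hmono := antitoneOn_of_deriv_nonpos (convex_Icc (π / 2) π)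
    (fun τ _ => (hd τ).continuousAt.continuousWithinAt)
    (fun τ _ => (hd τ).differentiableAt.differentiableWithinAt) (fun τ hτ => by
      rw [(hd τ).deriv]
      rw [interior_Icc] at hτ
      have hπ := pi_pos
      have c1 : cos τ ≤ 0 := cos_nonpos_of_pi_div_two_le_of_le hτ.1.le (by linarith [hτ.2])
      have c4 : 0 ≤ sin τ := sin_nonneg_of_nonneg_of_le_pi (by linarith [hτ.1]) hτ.2.le
      refine mul_nonpos_of_nonpos_of_nonneg (mul_nonpos_of_nonpos_of_nonneg
        (mul_nonpos_of_nonneg_of_nonpos (by positivity) ?_) ?_) ?_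
      · exact mul_nonpos_of_nonneg_of_nonpos hr c1
      · rw [← mul_sub]; exact mul_nonneg hr (by linarith)
      · refine integral_chiThree_deriv_nonneg hs ?_ H h0 hsupp hε
        have := sin_sq_add_cos_sq τ
        calc _ = r ^ 2 * (sin τ ^ 2 + cos τ ^ 2) + (w.map (· ^ 2)).sum := by ring
          _ ≤ s ^ 2 := by rw [this]; linarith)
  exact hmono ⟨h1, h12.trans h2⟩ ⟨h1.trans h12, h2⟩ h12

/-- Concentrating two nonnegative coefficients increases the tail. -/
theorem tail_concentrate_le {a b a' b' s ε : ℝ} {w : Multiset ℝ} (hs : 0 ≤ s)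
    (hV : a ^ 2 + b ^ 2 + (w.map (· ^ 2)).sum ≤ s ^ 2) (hε : tailThreshold s ≤ ε) (hb' : 0 ≤ b')
    (hb : b' ≤ b) (hba : b ≤ a) (ha' : 0 ≤ a') (h : a ^ 2 + b ^ 2 = a' ^ 2 + b' ^ 2) :
    tail (a ::ₘ b ::ₘ w) ε ≤ tail (a' ::ₘ b' ::ₘ w) ε := by
  obtain ⟨r, hr0, hr⟩ : ∃ r, 0 ≤ r ∧ r ^ 2 = a ^ 2 + b ^ 2 :=
    ⟨√(a ^ 2 + b ^ 2), sqrt_nonneg _, sq_sqrt (by positivity)⟩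
  rcases hr0.eq_or_lt with rfl | hr0
  · have h1 : a = 0 := by nlinarith [sq_nonneg a, sq_nonneg b]
    have h2 : b = 0 := by nlinarith [sq_nonneg a, sq_nonneg b]
    have h3 : a' = 0 := by nlinarith [sq_nonneg a', sq_nonneg b']
    have h4 : b' = 0 := by nlinarith [sq_nonneg a', sq_nonneg b']
    rw [h1, h2, h3, h4]
  have key {x y : ℝ} (hx : 0 ≤ x) (hy : 0 ≤ y) (hxy : x ^ 2 + y ^ 2 = r ^ 2) :
      r * cos (arccos (y / r)) = y ∧ r * sin (arccos (y / r)) = x := by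
    have hyr : y ≤ r := abs_le_of_sq_le_sq' (by nlinarith) hr0.le |>.2
    constructor
    · rw [cos_arccos (by linarith [div_nonneg hy hr0.le]) (div_le_one_of_le₀ hyr hr0.le)]
      field_simp
    · rw [sin_arccos]
      have : 1 - (y / r) ^ 2 = (x / r) ^ 2 := by field_simp; linarith
      rw [this, sqrt_sq (div_nonneg hx hr0.le)]
      field_simp
  have hb0 := hb'.trans hb
  obtain ⟨e1, e2⟩ := key (hb0.trans hba) hb0 hr.symm
  obtain ⟨e3, e4⟩ := key ha' hb' (by rw [← h, hr])
  -- The order b ≤ a means that the starting angle arccos(b/r) is at least π/4.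
  have hyr : b / r ≤ √2 / 2 := by
    rw [div_le_iff₀ hr0]
    refine abs_le_of_sq_le_sq' ?_ (by positivity) |>.2
    rw [mul_pow, div_pow, sq_sqrt (by norm_num)]
    nlinarith
  have := tail_rotate_le (w := w) hs hr0.le (by rwa [hr]) hε (τ₁ := arccos (b / r))
    (τ₂ := arccos (b' / r)) ?_ (arccos_le_arccos (by gcongr)) ?_
  · rwa [e1, e2, e3, e4] at this
  · rw [← arccos_cos (x := π / 4) (by linarith [pi_pos]) (by linarith [pi_pos]), cos_pi_div_four]
    exact arccos_le_arccos hyr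
  · rw [arccos_le_pi_div_two]; positivity

/-- For negative a, adjoin a coefficient 0, which leaves the law unchanged, and rotate between (0,
-|a|) at angle π and (|a|, 0) at angle π/2. -/
theorem tail_abs_le {a s ε : ℝ} {w : Multiset ℝ} (hs : 0 ≤ s)
    (hV : a ^ 2 + (w.map (· ^ 2)).sum ≤ s ^ 2) (hε : tailThreshold s ≤ ε) :
    tail (a ::ₘ w) ε ≤ tail (|a| ::ₘ w) ε := by
  rcases le_total 0 a with ha | ha
  · rw [abs_of_nonneg ha]
  · have := tail_rotate_le' (r := |a|) hs (abs_nonneg a) (by rwa [sq_abs]) hε le_rfl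
      (by linarith [pi_pos]) (le_refl π)
    rw [sin_pi, cos_pi, sin_pi_div_two, cos_pi_div_two, mul_zero, mul_one, mul_neg_one,
      Multiset.cons_swap |a|, tail_zero_cons, tail_zero_cons, abs_of_nonpos ha, neg_neg] at this
    rwa [abs_of_nonpos ha]

/-- The coefficients in `[-Λ, Λ]` can be replaced by copies of `Λ` and one remainder. -/
theorem exists_tail_le {Λ : ℝ} (hΛ : 0 < Λ) (l : Multiset ℝ) (hl : ∀ a ∈ l, |a| ≤ Λ) :
    ∃ (k : ℕ) (t : ℝ), 0 ≤ t ∧ t < Λ ∧ k * Λ ^ 2 + t ^ 2 = (l.map (· ^ 2)).sum ∧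
      ∀ (w : Multiset ℝ) (s ε : ℝ), 0 ≤ s → ((l + w).map (· ^ 2)).sum ≤ s ^ 2 →
        tailThreshold s ≤ ε → tail (l + w) ε ≤ tail (t ::ₘ (Multiset.replicate k Λ + w)) ε := by
  induction l using Multiset.induction_on with
  | empty =>
    refine ⟨0, 0, le_rfl, hΛ, by simp, fun w s ε _ _ _ => ?_⟩
    rw [tail_zero_cons, Multiset.replicate_zero]
  | cons a l ih =>
    obtain ⟨k, t, ht0, htΛ, hsum, H⟩ := ih fun x hx => hl x (Multiset.mem_cons_of_mem hx)
    have ha : |a| ≤ Λ := hl a (Multiset.mem_cons_self a l)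
    have ha2 : |a| ^ 2 ≤ Λ ^ 2 := by gcongr
    -- The induction hypothesis is used with |a| among the spectators w. Afterwards |a| and the old
    -- remainder t are concentrated into u and v.
    have step (w : Multiset ℝ) (s ε : ℝ) (hs : 0 ≤ s)
        (hV : ((a ::ₘ l + w).map (· ^ 2)).sum ≤ s ^ 2) (hε : tailThreshold s ≤ ε)
        (u v : ℝ) (hu : 0 ≤ u) (hv : 0 ≤ v) (hvm : v ≤ min |a| t)
        (huv : u ^ 2 + v ^ 2 = |a| ^ 2 + t ^ 2) :
        tail (a ::ₘ l + w) ε ≤ tail (u ::ₘ v ::ₘ (Multiset.replicate k Λ + w)) ε := by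
      rw [Multiset.cons_add] at hV ⊢
      simp only [Multiset.map_cons, Multiset.sum_cons, Multiset.map_add, Multiset.sum_add] at hV
      refine (tail_abs_le hs (by simpa using hV) hε).trans ?_
      have h1 := H (|a| ::ₘ w) s ε hs
        (by simp only [Multiset.map_cons, Multiset.sum_cons, Multiset.map_add, Multiset.sum_add,
          sq_abs]; linarith) hε
      rw [Multiset.add_cons, Multiset.add_cons] at h1
      refine h1.trans ?_
      have hV' : |a| ^ 2 + t ^ 2 + ((Multiset.replicate k Λ + w).map (· ^ 2)).sum ≤ s ^ 2 := by
        simp only [Multiset.map_add, Multiset.sum_add, Multiset.map_replicate,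
          Multiset.sum_replicate, nsmul_eq_mul, sq_abs]
        linarith
      rcases le_total t |a| with h | h
      · rw [Multiset.cons_swap]
        exact tail_concentrate_le hs hV' hε hv (hvm.trans (min_le_right _ _)) h hu huv.symm
      · exact tail_concentrate_le hs (by linarith) hε hv (hvm.trans (min_le_left _ _)) h hu
          (by linarith)
    -- Either all of the square mass fits into a new remainder below Λ, or one more full copy of Λ
    -- is split off.
    by_cases hc : |a| ^ 2 + t ^ 2 < Λ ^ 2
    · refine ⟨k, √(|a| ^ 2 + t ^ 2), sqrt_nonneg _, ?_, ?_, fun w s ε hs hV hε => ?_⟩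
      · exact (sqrt_lt_sqrt (by positivity) hc).trans_eq (sqrt_sq hΛ.le)
      · rw [sq_sqrt (by positivity), Multiset.map_cons, Multiset.sum_cons, ← hsum, sq_abs]; ring
      · have := step w s ε hs hV hε (√(|a| ^ 2 + t ^ 2)) 0 (sqrt_nonneg _) le_rfl
          (le_min (abs_nonneg a) ht0) (by rw [sq_sqrt (by positivity)]; ring)
        rwa [Multiset.cons_swap, tail_zero_cons] at this
    · rw [not_lt] at hc
      have hnn : 0 ≤ |a| ^ 2 + t ^ 2 - Λ ^ 2 := by linarith
      have ht2 : t ^ 2 < Λ ^ 2 := by gcongr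
      refine ⟨k + 1, √(|a| ^ 2 + t ^ 2 - Λ ^ 2), sqrt_nonneg _, ?_, ?_, fun w s ε hs hV hε => ?_⟩
      · exact (sqrt_lt_sqrt hnn (by linarith)).trans_eq (sqrt_sq hΛ.le)
      · rw [sq_sqrt hnn, Multiset.map_cons, Multiset.sum_cons, ← hsum, sq_abs]
        push_cast; ring
      · have := step w s ε hs hV hε Λ (√(|a| ^ 2 + t ^ 2 - Λ ^ 2)) hΛ.le (sqrt_nonneg _)
          (le_min (sqrt_le_iff.2 ⟨abs_nonneg a, by linarith⟩)
            (sqrt_le_iff.2 ⟨ht0, by linarith⟩)) (by rw [sq_sqrt hnn]; ring)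
        rwa [Multiset.cons_swap, ← Multiset.cons_add, ← Multiset.replicate_succ] at this

/-- Majorization of `m` copies of a family of coefficients bounded by `Λ`. -/
theorem tail_nsmul_le {Λ : ℝ} (hΛ : 0 < Λ) (l : Multiset ℝ) (hl : ∀ a ∈ l, |a| ≤ Λ) {k : ℕ}
    {θ : ℝ} (hk : k = ⌊(l.map (· ^ 2)).sum / Λ ^ 2⌋₊) (hθ : θ = √((l.map (· ^ 2)).sum / Λ ^ 2 - k))
    (m : ℕ) {s ε : ℝ} (hs : 0 ≤ s) (hV : m * (l.map (· ^ 2)).sum ≤ s ^ 2)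
    (hε : tailThreshold s ≤ ε) :
    tail (m • l) ε ≤ tail (m • ((θ * Λ) ::ₘ Multiset.replicate k Λ)) ε := by
  obtain ⟨k', t, ht0, htΛ, hsum, H⟩ := exists_tail_le hΛ l hl
  have e1 : (l.map (· ^ 2)).sum / Λ ^ 2 = k' + (t / Λ) ^ 2 := by
    rw [← hsum]; field_simp
  have htl : t / Λ < 1 := (div_lt_one hΛ).2 htΛ
  have htn : 0 ≤ t / Λ := by positivity
  -- Because t < Λ, the number of full copies is forced to be the floor of the normalized sum of
  -- squares.
  have e2 : k = k' := by
    rw [hk, e1, Nat.floor_eq_iff (by positivity)]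
    constructor <;> nlinarith [sq_nonneg (t / Λ)]
  subst e2
  have e3 : θ * Λ = t := by
    rw [hθ, e1, add_sub_cancel_left, sqrt_sq htn]; field_simp
  rw [e3]
  set l' := t ::ₘ Multiset.replicate k Λ with hl'
  have hl'V : (l'.map (· ^ 2)).sum = (l.map (· ^ 2)).sum := by
    rw [← hsum, hl']
    simp only [Multiset.map_cons, Multiset.sum_cons, Multiset.map_replicate,
      Multiset.sum_replicate, nsmul_eq_mul]
    ring
  -- The copies of l are replaced one at a time, the rest being spectators. The sum of squares stays
  -- constant, so the same threshold works at each stage.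
  have main (i j : ℕ) (hij : i + j = m) : tail (i • l + j • l) ε ≤ tail (i • l' + j • l) ε := by
    induction i generalizing j with
    | zero => simp
    | succ i ih =>
      have h1 := ih (j + 1) (by omega)
      have e4 : i • l + (j + 1) • l = (i + 1) • l + j • l := by rw [← add_nsmul, ← add_nsmul]; congr 1; omega
      rw [e4] at h1
      refine h1.trans ?_
      have h2 := H (i • l' + j • l) s ε hs ?_ hε
      · rw [← Multiset.cons_add] at h2
        convert! h2 using 2
        · rw [succ_nsmul]; abel
        · rw [← hl', succ_nsmul]; abel
      · simp only [Multiset.map_add, Multiset.sum_add, Multiset.map_nsmul, Multiset.sum_nsmul,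
          nsmul_eq_mul, hl'V]
        rw [← hij] at hV
        push_cast at hV
        linarith
  simpa using main m 0 rfl

end TraceEst

/-! ### From matrices to quadratic forms. -/

namespace TraceEst

open Real Filter Topology
open scoped MeasureTheory NNReal ENNReal

theorem QuadMGF.pi {ι X : Type*} [Fintype ι] [MeasurableSpace X] {μ : ι → Measure X}
    [∀ i, IsProbabilityMeasure (μ i)] {f : ι → X → ℝ} (hf : ∀ i, Measurable (f i))
    {w : ι → Multiset ℝ} {c : ι → ℝ} (h : ∀ i, QuadMGF ((μ i).map (f i)) (w i) (c i)) :
    QuadMGF ((Measure.pi μ).map fun x => ∑ i, f i (x i)) (∑ i, w i) (∑ i, c i) := by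
  have hm : Measurable fun x : ι → X => ∑ i, f i (x i) :=
    Finset.measurable_sum _ fun i _ => (hf i).comp (measurable_pi_apply i)
  have e (u : ℝ) (x : ι → X) : exp (u * ∑ i, f i (x i)) = ∏ i, exp (u * f i (x i)) := by
    rw [Finset.mul_sum, exp_sum]
  have hu' {u : ℝ} (hu : ∀ a ∈ ∑ i, w i, |2 * u * a| < 1) (i : ι) :
      ∀ a ∈ w i, |2 * u * a| < 1 := fun a ha =>
    hu a (Multiset.mem_of_le (Finset.single_le_sum (fun _ _ => Multiset.zero_le _)
      (Finset.mem_univ i)) ha)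
  refine ⟨Measure.isProbabilityMeasure_map hm.aemeasurable, fun u hu => ?_, fun u hu => ?_⟩
  · rw [integrable_map_measure (by fun_prop) hm.aemeasurable]
    simp only [Function.comp_def, e]
    refine Integrable.fintype_prod_dep (μ := μ) (f := fun i x => exp (u * f i x)) fun i => ?_
    have := (h i).integrable u (hu' hu i)
    rwa [integrable_map_measure (by fun_prop) (hf i).aemeasurable] at this
  · rw [integral_map hm.aemeasurable (by fun_prop)]
    simp only [e]
    rw [integral_fintype_prod_eq_prod (f := fun i x => exp (u * f i x)),
      Finset.mul_sum, exp_sum]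
    have : ((∑ i, w i).map fun a => (√(1 - 2 * u * a))⁻¹).prod =
        ∏ i, ((w i).map fun a => (√(1 - 2 * u * a))⁻¹).prod := by
      rw [← Multiset.prod_sum]
      congr 1
      exact map_sum (Multiset.mapAddMonoidHom fun a : ℝ => (√(1 - 2 * u * a))⁻¹) _ _
    rw [this, ← Finset.prod_mul_distrib]
    refine Finset.prod_congr rfl fun i _ => ?_
    rw [← (h i).integral_eq u (hu' hu i), integral_map (hf i).aemeasurable (by fun_prop)]

section Matrix

variable {n : ℕ} {A : Matrix (Fin n) (Fin n) ℝ}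
  {b : OrthonormalBasis (Fin n) ℝ (EuclideanSpace ℝ (Fin n))} {d : Fin n → ℝ}

theorem trace_eq_sum_of_mulVec (hb : ∀ i, A *ᵥ (b i).ofLp = d i • (b i).ofLp) :
    A.trace = ∑ i, d i := by
  have h1 := LinearMap.trace_eq_sum_inner (toEuclideanLin A) (EuclideanSpace.basisFun (Fin n) ℝ)
  have h2 := LinearMap.trace_eq_sum_inner (toEuclideanLin A) b
  have h3 (i : Fin n) : toEuclideanLin A (b i) = d i • b i := by
    rw [toLpLin_apply, hb]; rfl
  rw [h1] at h2
  simp only [h3, real_inner_smul_right, real_inner_self_eq_norm_sq, b.orthonormal.1] at h2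
  simp [toLpLin_apply, EuclideanSpace.inner_eq_star_dotProduct] at h2
  rw [← h2]; rfl

theorem frobNorm_sq_eq (hA : A.IsSymm) (hb : ∀ i, A *ᵥ (b i).ofLp = d i • (b i).ofLp) :
    frobNorm A ^ 2 = ∑ i, d i ^ 2 := by
  have h : (A * A).trace = ∑ i, d i ^ 2 := trace_eq_sum_of_mulVec (b := b) fun i => by
    rw [← mulVec_mulVec, hb, mulVec_smul, hb, smul_smul, sq]
  rw [← h, frobNorm_eq, sq_sqrt (by positivity)]
  simp only [trace, diag_apply, mul_apply, sq]
  refine Finset.sum_congr rfl fun i _ => Finset.sum_congr rfl fun j _ => ?_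
  rw [hA.apply]

theorem abs_le_specNorm (hb : ∀ i, A *ᵥ (b i).ofLp = d i • (b i).ofLp) (i : Fin n) :
    |d i| ≤ specNorm A := by
  have h1 := (toEuclideanCLM (n := Fin n) (𝕜 := ℝ) A).le_opNorm (b i)
  have h3 : toEuclideanCLM (n := Fin n) (𝕜 := ℝ) A (b i) = d i • b i := by
    apply (WithLp.ofLp_injective 2)
    rw [ofLp_toEuclideanCLM, hb]; rfl
  rw [h3, norm_smul, b.orthonormal.1, mul_one, mul_one] at h1
  exact h1

theorem specNorm_le_frobNorm (A : Matrix (Fin n) (Fin n) ℝ) : specNorm A ≤ frobNorm A := by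
  rw [specNorm_eq]
  refine ContinuousLinearMap.opNorm_le_bound _ (by rw [frobNorm_eq]; positivity) fun x => ?_
  rw [EuclideanSpace.norm_eq, EuclideanSpace.norm_eq, frobNorm_eq, ← sqrt_mul (by positivity)]
  refine sqrt_le_sqrt ?_
  rw [Finset.sum_mul]
  refine Finset.sum_le_sum fun i _ => ?_
  simp only [norm_eq_abs, sq_abs, ofLp_toEuclideanCLM]
  exact Finset.sum_mul_sq_le_sq_mul_sq Finset.univ (A i) x.ofLp

theorem dotProduct_mulVec_sum (hb : ∀ i, A *ᵥ (b i).ofLp = d i • (b i).ofLp) (x : Fin n → ℝ) :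
    (∑ i, x i • b i).ofLp ⬝ᵥ (A *ᵥ (∑ i, x i • b i).ofLp) = ∑ i, d i * x i ^ 2 := by
  have h1 : A *ᵥ (∑ i, x i • b i).ofLp = (∑ i, (x i * d i) • b i).ofLp := by
    simp only [WithLp.ofLp_sum, WithLp.ofLp_smul, mulVec_sum, mulVec_smul, hb, smul_smul]
  have h2 : (∑ i, x i • b i).ofLp ⬝ᵥ (∑ i, (x i * d i) • b i).ofLp =
      inner ℝ (∑ i, (x i * d i) • b i) (∑ i, x i • b i) := by
    rw [EuclideanSpace.inner_eq_star_dotProduct, star_trivial]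
  rw [h1, h2, b.orthonormal.inner_sum]
  refine Finset.sum_congr rfl fun i _ => ?_
  simp only [conj_trivial]
  ring

/-- The centered trace estimator of a matrix with eigenvalues `d` is a quadratic form in Gaussian
variables. -/
theorem map_gaussTr_sub_trace {m : ℕ} (hm : 1 ≤ m)
    (hb : ∀ i, A *ᵥ (b i).ofLp = d i • (b i).ofLp) :
    (sampleLaw m n).map (fun z => gaussTr m A z - A.trace) =
      quadLaw (m • Finset.univ.val.map fun i => d i / m) := by
  have hm0 : (m : ℝ) ≠ 0 := by positivity
  set g : EuclideanSpace ℝ (Fin n) → ℝ := fun z =>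
    1 / (m : ℝ) * (z.ofLp ⬝ᵥ (A *ᵥ z.ofLp)) - A.trace / m with hg
  have hgm : Measurable g := by
    have : Continuous g := by
      simp only [hg, dotProduct, mulVec]
      fun_prop
    exact this.measurable
  have e1 : (fun z => gaussTr m A z - A.trace) =
      fun z : Fin m → EuclideanSpace ℝ (Fin n) => ∑ j, g (z j) := by
    ext z
    simp only [hg, gaussTr, Finset.sum_sub_distrib, ← Finset.mul_sum, Finset.sum_const,
      Finset.card_univ, Fintype.card_fin, nsmul_eq_mul]
    field_simp
  have hsum : Measurable fun x : Fin n → ℝ => ∑ i, x i • b i := by fun_prop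
  -- By rotation invariance the coordinates in the eigenbasis are independent standard Gaussians.
  have e2 : (stdGaussian (EuclideanSpace ℝ (Fin n))).map g =
      (Measure.pi fun _ : Fin n => stdG).map fun x => ∑ i, d i / m * (x i ^ 2 - 1) := by
    rw [stdGaussian_eq_map_pi_orthonormalBasis b, Measure.map_map hgm hsum]
    congr 1; ext x
    simp only [Function.comp, hg]
    rw [dotProduct_mulVec_sum hb, trace_eq_sum_of_mulVec hb, Finset.mul_sum, Finset.sum_div,
      ← Finset.sum_sub_distrib]
    refine Finset.sum_congr rfl fun i _ => ?_
    ring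
  have e3 : QuadMGF ((stdGaussian (EuclideanSpace ℝ (Fin n))).map g)
      (Finset.univ.val.map fun i => d i / m) (-(Finset.univ.val.map fun i => d i / m).sum) := by
    have := QuadMGF.pi (μ := fun _ : Fin n => stdG) (f := fun i z => d i / m * (z ^ 2 - 1))
      (fun i => by fun_prop) (fun i => quadMGF_chi (d i / m))
    rw [e2]
    convert! this using 1
    · rw [← Multiset.sum_map_singleton (Finset.univ.val.map fun i => d i / m), Multiset.map_map]
      rfl
    · rw [Finset.sum_neg_distrib]; rfl
  have e4 := QuadMGF.pi (μ := fun _ : Fin m => stdGaussian (EuclideanSpace ℝ (Fin n)))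
    (f := fun _ => g) (fun _ => hgm) (fun _ => e3)
  rw [e1]
  refine QuadMGF.unique (w := m • Finset.univ.val.map fun i => d i / m) ?_ (quadMGF_quadLaw _)
  convert! e4 using 1
  · simp
  · simp [Multiset.sum_nsmul]

theorem measurable_gaussTr (m : ℕ) (A : Matrix (Fin n) (Fin n) ℝ) : Measurable (gaussTr m A) := by
  have : Continuous (gaussTr m A) := by
    unfold gaussTr
    simp only [dotProduct, mulVec]
    fun_prop
  exact this.measurable

theorem sampleLaw_real_eq_tail {m : ℕ} (hm : 1 ≤ m)
    (hb : ∀ i, A *ᵥ (b i).ofLp = d i • (b i).ofLp) (ε : ℝ) :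
    (sampleLaw m n).real {z | ε ≤ gaussTr m A z - A.trace} =
      tail (m • Finset.univ.val.map fun i => d i / m) ε := by
  rw [tail, ← map_gaussTr_sub_trace hm hb]
  exact (map_measureReal_apply ((measurable_gaussTr m A).sub_const _) measurableSet_Ici).symm

theorem sampleLaw_real_le {m : ℕ} (hm : 1 ≤ m)
    (hb : ∀ i, A *ᵥ (b i).ofLp = d i • (b i).ofLp) (ε : ℝ) :
    (sampleLaw m n).real {z | ε ≤ |gaussTr m A z - A.trace|} ≤
      tail (m • Finset.univ.val.map fun i => d i / m) ε +
      tail (m • Finset.univ.val.map fun i => -d i / m) ε := by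
  have hb' (i : Fin n) : (-A) *ᵥ (b i).ofLp = (-d i) • (b i).ofLp := by
    rw [neg_mulVec, hb, neg_smul]
  have : IsProbabilityMeasure (sampleLaw m n) := by unfold sampleLaw; infer_instance
  rw [← sampleLaw_real_eq_tail hm hb, ← sampleLaw_real_eq_tail hm hb']
  refine (measureReal_mono ?_).trans (measureReal_union_le _ _)
  intro z hz
  have e : gaussTr m (-A) z - (-A).trace = -(gaussTr m A z - A.trace) := by
    simp only [gaussTr, neg_mulVec, dotProduct_neg, Finset.sum_neg_distrib, trace_neg]
    ring
  rcases le_abs'.1 (show ε ≤ |_| from hz) with h | h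
  · right
    show ε ≤ gaussTr m (-A) z - (-A).trace
    rw [e]; linarith
  · exact Or.inl h

end Matrix

theorem tail_add_replicate_zero (w : Multiset ℝ) (j : ℕ) (ε : ℝ) :
    tail (w + Multiset.replicate j 0) ε = tail w ε := by
  induction j with
  | zero => simp
  | succ j ih => rw [Multiset.replicate_succ, Multiset.add_cons, tail_zero_cons, ih]

/-- Zero entries do not affect the law. When k = n the matrix has no place for the entry y, whence
the condition y = 0 in that case. -/
theorem tail_nsmul_map_ite {n k : ℕ} {x y : ℝ} (hk : k ≤ n) (hy : k = n → y = 0) (ε : ℝ)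
    (m : ℕ) :
    tail (m • Finset.univ.val.map fun i : Fin n =>
      if (i : ℕ) < k then x else if (i : ℕ) = k then y else 0) ε =
    tail (m • (y ::ₘ Multiset.replicate k x)) ε := by
  set f : ℕ → ℝ := fun i => if i < k then x else if i = k then y else 0 with hf
  have e1 : (Finset.univ.val.map fun i : Fin n => f i) = (Multiset.range n).map f := by
    rw [Fin.univ_val_map, List.ofFn_eq_map, Multiset.range, Multiset.map_coe,
      ← List.map_coe_finRange_eq_range, List.map_map]
    rfl
  have e2 : (Multiset.range k).map f = Multiset.replicate k x := by
    rw [Multiset.eq_replicate]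
    refine ⟨by simp, fun a ha => ?_⟩
    obtain ⟨i, hi, rfl⟩ := Multiset.mem_map.1 ha
    exact if_pos (Multiset.mem_range.1 hi)
  rw [e1]
  rcases hk.eq_or_lt with rfl | hk
  · rw [e2, hy rfl, ← Multiset.singleton_add, nsmul_add, add_comm, ← Multiset.replicate_one,
      Multiset.nsmul_replicate m 1, tail_add_replicate_zero]
  · obtain ⟨j, rfl⟩ := Nat.exists_eq_add_of_lt hk
    have e3 : (Multiset.range (k + j + 1)).map f =
        (y ::ₘ Multiset.replicate k x) + Multiset.replicate j 0 := by
      rw [add_assoc, add_comm j 1, ← add_assoc, Multiset.range_add, Multiset.range_succ,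
        Multiset.map_add, Multiset.map_cons, e2]
      have h1 : f k = y := by simp [hf]
      rw [h1]
      congr 1
      rw [Multiset.map_map, Multiset.eq_replicate]
      refine ⟨by simp, fun a ha => ?_⟩
      obtain ⟨i, hi, rfl⟩ := Multiset.mem_map.1 ha
      have h2 : ¬ k + 1 + i < k := by omega
      have h3 : k + 1 + i ≠ k := by omega
      simp [hf, h2, h3]
    rw [e3, nsmul_add, Multiset.nsmul_replicate, tail_add_replicate_zero]

theorem Aabs_mulVec (n : ℕ) (lam phi : ℝ) (i : Fin n) :
    Aabs n lam phi *ᵥ (EuclideanSpace.basisFun (Fin n) ℝ i).ofLp =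
      (if (i : ℕ) < ⌊rho lam phi⌋₊ then lam
        else if (i : ℕ) = ⌊rho lam phi⌋₊ then √(rho lam phi - ⌊rho lam phi⌋₊) * lam else 0) •
        (EuclideanSpace.basisFun (Fin n) ℝ i).ofLp := by
  rw [Aabs, smul_mulVec]
  ext j
  simp only [EuclideanSpace.basisFun_apply, Pi.smul_apply, smul_eq_mul, mulVec_diagonal,
    PiLp.single_apply]
  by_cases hij : j = i
  · subst hij
    split_ifs <;> ring
  · simp [hij]

end TraceEst

/-! ### Comparison with gamma tails. -/

namespace TraceEst

open Real Filter Topology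
open scoped MeasureTheory NNReal ENNReal

theorem measurable_gammaPDF (a r : ℝ) : Measurable (gammaPDF a r) :=
  (measurable_gammaPDFReal a r).ennreal_ofReal

theorem integral_gammaMeasure {a r : ℝ} (ha : 0 < a) (hr : 0 < r) (f : ℝ → ℝ) :
    ∫ x, f x ∂(gammaMeasure a r) = ∫ x, gammaPDFReal a r x * f x := by
  rw [gammaMeasure, integral_withDensity_eq_integral_toReal_smul
    (measurable_gammaPDF a r) (ae_of_all _ fun x => ENNReal.ofReal_lt_top)]
  simp only [gammaPDF, ENNReal.toReal_ofReal (gammaPDFReal_nonneg ha hr _), smul_eq_mul]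

theorem integrable_gammaMeasure_iff {a r : ℝ} (ha : 0 < a) (hr : 0 < r) (f : ℝ → ℝ) :
    Integrable f (gammaMeasure a r) ↔ Integrable fun x => gammaPDFReal a r x * f x := by
  rw [gammaMeasure, integrable_withDensity_iff
    (measurable_gammaPDF a r) (ae_of_all _ fun x => ENNReal.ofReal_lt_top)]
  simp only [gammaPDF, ENNReal.toReal_ofReal (gammaPDFReal_nonneg ha hr _), mul_comm]

theorem integrable_gammaPDFReal {a r : ℝ} (ha : 0 < a) (hr : 0 < r) :
    Integrable (gammaPDFReal a r) := by
  have := isProbabilityMeasure_gammaMeasure ha hr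
  simpa using (integrable_gammaMeasure_iff ha hr fun _ => 1).1 (integrable_const 1)

theorem integral_gammaPDFReal {a r : ℝ} (ha : 0 < a) (hr : 0 < r) :
    ∫ x, gammaPDFReal a r x = 1 := by
  have := isProbabilityMeasure_gammaMeasure ha hr
  simpa using (integral_gammaMeasure ha hr fun _ => 1).symm

theorem integral_id_gammaMeasure {a r : ℝ} (ha : 0 < a) (hr : 0 < r) :
    ∫ x, x ∂(gammaMeasure a r) = a / r := by
  have e (x : ℝ) : gammaPDFReal a r x * x = a / r * gammaPDFReal (a + 1) r x := by
    unfold gammaPDFReal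
    split_ifs with hx
    · rw [Gamma_add_one ha.ne', rpow_add_one hr.ne', add_sub_cancel_right]
      have h1 : x ^ (a - 1) * x = x ^ a := by
        rcases hx.eq_or_lt with rfl | hx
        · rw [mul_zero, zero_rpow ha.ne']
        · rw [← rpow_add_one hx.ne', sub_add_cancel]
      have := (Gamma_pos_of_pos ha).ne'
      rw [← h1]
      field_simp
    · simp
  rw [integral_gammaMeasure ha hr]
  simp only [e]
  rw [integral_const_mul, integral_gammaPDFReal (by linarith) hr, mul_one]

theorem gammaPDFReal_mul_exp {a r u : ℝ} (hr : 0 < r) (hu : u < r) (x : ℝ) :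
    gammaPDFReal a r x * exp (u * x) = (r / (r - u)) ^ a * gammaPDFReal a (r - u) x := by
  have hru : 0 < r - u := sub_pos.2 hu
  unfold gammaPDFReal
  split_ifs
  · have h1 : exp (-((r - u) * x)) = exp (-(r * x)) * exp (u * x) := by
      rw [← exp_add]; ring_nf
    rw [h1, div_rpow hr.le hru.le]
    have := (rpow_pos_of_pos hru a).ne'
    field_simp
  · simp

theorem integrable_exp_gammaMeasure {a r u : ℝ} (ha : 0 < a) (hr : 0 < r) (hu : u < r) :
    Integrable (fun x => exp (u * x)) (gammaMeasure a r) := by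
  rw [integrable_gammaMeasure_iff ha hr]
  simp only [gammaPDFReal_mul_exp hr hu]
  exact (integrable_gammaPDFReal ha (sub_pos.2 hu)).const_mul _

theorem integral_exp_gammaMeasure {a r u : ℝ} (ha : 0 < a) (hr : 0 < r) (hu : u < r) :
    ∫ x, exp (u * x) ∂(gammaMeasure a r) = (r / (r - u)) ^ a := by
  rw [integral_gammaMeasure ha hr]
  simp only [gammaPDFReal_mul_exp hr hu]
  rw [integral_const_mul, integral_gammaPDFReal ha (sub_pos.2 hu), mul_one]

theorem gammaMeasure_conv {a b r : ℝ} (ha : 0 < a) (hb : 0 < b) (hr : 0 < r) :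
    gammaMeasure a r ∗ gammaMeasure b r = gammaMeasure (a + b) r := by
  have := isProbabilityMeasure_gammaMeasure ha hr
  have := isProbabilityMeasure_gammaMeasure hb hr
  have hab : 0 < a + b := by positivity
  have := isProbabilityMeasure_gammaMeasure hab hr
  refine measure_ext_of_mgf_near_zero hr (fun u hu => ?_) (fun u hu => ?_) fun u hu => ?_ <;>
    have hu := (abs_lt.1 hu).2
  · exact integrable_exp_conv (integrable_exp_gammaMeasure ha hr hu)
      (integrable_exp_gammaMeasure hb hr hu)
  · exact integrable_exp_gammaMeasure hab hr hu
  · rw [integral_exp_conv, integral_exp_gammaMeasure ha hr hu,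
      integral_exp_gammaMeasure hb hr hu, integral_exp_gammaMeasure hab hr hu,
      rpow_add (div_pos hr (sub_pos.2 hu))]

/-- A multiple of a chi-squared variable is a gamma variable. The shift is 0 since this law is not
centered. -/
theorem quadMGF_gammaMeasure {j : ℕ} (hj : 0 < j) {a : ℝ} (ha : 0 < a) :
    QuadMGF (gammaMeasure (j / 2) (1 / (2 * a))) (Multiset.replicate j a) 0 := by
  have hj' : (0 : ℝ) < j / 2 := by positivity
  have hr : 0 < 1 / (2 * a) := by positivity
  have hlt {u : ℝ} (hu : ∀ b ∈ Multiset.replicate j a, |2 * u * b| < 1) : 0 < 1 - 2 * u * a := by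
    have := (abs_lt.1 (hu a (Multiset.mem_replicate.2 ⟨hj.ne', rfl⟩))).2
    linarith
  have hlt' {u : ℝ} (hu : ∀ b ∈ Multiset.replicate j a, |2 * u * b| < 1) : u < 1 / (2 * a) := by
    rw [lt_div_iff₀ (by positivity)]
    linarith [hlt hu]
  refine ⟨isProbabilityMeasure_gammaMeasure hj' hr, fun u hu => ?_, fun u hu => ?_⟩
  · exact integrable_exp_gammaMeasure hj' hr (hlt' hu)
  · have h0 := hlt hu
    rw [integral_exp_gammaMeasure hj' hr (hlt' hu), mul_zero, exp_zero, one_mul,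
      Multiset.map_replicate, Multiset.prod_replicate]
    have e1 : 1 / (2 * a) / (1 / (2 * a) - u) = (1 - 2 * u * a)⁻¹ := by
      have : 1 / (2 * a) - u = (1 - 2 * u * a) / (2 * a) := by field_simp
      rw [this]; field_simp
    rw [e1, ← sqrt_inv, sqrt_eq_rpow, ← rpow_mul_natCast (by positivity)]
    congr 1; ring

/-- Raise y ≤ e^y to the power p at y = cx/p. -/
theorem exists_rpow_mul_exp_le {p c : ℝ} (hp : 0 < p) (hc : 0 < c) :
    ∃ D > 0, ∀ x > 0, x ^ p * exp (-(c * x)) ≤ D := by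
  refine ⟨(p / c) ^ p, by positivity, fun x hx => ?_⟩
  have h1 : c * x / p ≤ exp (c * x / p) := by linarith [add_one_le_exp (c * x / p)]
  have h2 : (c * x / p) ^ p ≤ exp (c * x) := by
    have := rpow_le_rpow (by positivity) h1 hp.le
    rwa [← exp_mul, div_mul_cancel₀ _ hp.ne'] at this
  rw [exp_neg, ← div_eq_mul_inv, div_le_iff₀ (exp_pos _)]
  calc x ^ p = (p / c) ^ p * (c * x / p) ^ p := by
        rw [← mul_rpow (by positivity) (by positivity)]
        congr 1; field_simp
    _ ≤ _ := by gcongr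

/-- A gamma law with larger rate and larger shape is dominated by a multiple of another. -/
theorem exists_gammaMeasure_le {a b r R : ℝ} (hb : 0 < b) (hba : b < a) (hr : 0 < r)
    (hrR : r < R) : ∃ C : ℝ≥0, gammaMeasure a R ≤ (C : ℝ≥0∞) • gammaMeasure b r := by
  have ha := hb.trans hba
  have hR := hr.trans hrR
  -- The quotient of the two densities is a constant times x^(a-b) e^(-(R-r)x), which is bounded.
  obtain ⟨D, hD, H⟩ := exists_rpow_mul_exp_le (sub_pos.2 hba) (sub_pos.2 hrR)
  set K := R ^ a / Gamma a with hK
  set L := r ^ b / Gamma b with hL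
  have hK0 : 0 < K := div_pos (rpow_pos_of_pos hR _) (Gamma_pos_of_pos ha)
  have hL0 : 0 < L := div_pos (rpow_pos_of_pos hr _) (Gamma_pos_of_pos hb)
  refine ⟨(K * D / L).toNNReal, ?_⟩
  rw [gammaMeasure, gammaMeasure, ← withDensity_smul _ (measurable_gammaPDF b r)]
  refine withDensity_mono ?_
  filter_upwards [(show ∀ᵐ x : ℝ, x ≠ 0 from by simp [ae_iff])] with x hx
  rw [Pi.smul_apply, smul_eq_mul, gammaPDF, gammaPDF, ← ENNReal.ofReal.eq_1,
    ← ENNReal.ofReal_mul (by positivity)]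
  refine ENNReal.ofReal_le_ofReal ?_
  unfold gammaPDFReal
  split_ifs with h0
  · have hx0 : 0 < x := lt_of_le_of_ne h0 hx.symm
    rw [← hK, ← hL]
    have e1 : x ^ (a - 1) = x ^ (a - b) * x ^ (b - 1) := by
      rw [← rpow_add hx0]; congr 1; ring
    have e2 : exp (-(R * x)) = exp (-((R - r) * x)) * exp (-(r * x)) := by
      rw [← exp_add]; congr 1; ring
    rw [e1, e2]
    calc _ = (x ^ (a - b) * exp (-((R - r) * x))) * (K * x ^ (b - 1) * exp (-(r * x))) := by ring
      _ ≤ D * (K * x ^ (b - 1) * exp (-(r * x))) := by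
        refine mul_le_mul_of_nonneg_right (H x hx0) (by positivity)
      _ = _ := by field_simp
  · simp

theorem conv_apply_le {μ ν ν' : Measure ℝ} [SFinite μ] [SFinite ν] [SFinite ν'] {C : ℝ≥0∞}
    (h : ν ≤ C • ν') (hC : C ≠ ∞) {s : Set ℝ} (hs : MeasurableSet s) :
    (μ ∗ ν) s ≤ C * (μ ∗ ν') s := by
  have hm : Measurable (s.indicator (1 : ℝ → ℝ≥0∞)) := measurable_one.indicator hs
  rw [← lintegral_indicator_one hs, ← lintegral_indicator_one hs, Measure.lintegral_conv hm,
    Measure.lintegral_conv hm, ← lintegral_const_mul' _ _ hC]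
  refine lintegral_mono fun x => ?_
  rw [← smul_eq_mul, ← lintegral_smul_measure]
  exact lintegral_mono' h le_rfl

/-- At equal rates the quotient of densities is a multiple of x^(b-a), which eventually exceeds any
constant. -/
theorem exists_gammaMeasure_Ici_le {a b r : ℝ} (ha : 0 < a) (hab : a < b) (hr : 0 < r)
    (C : ℝ≥0) : ∃ x₀, ∀ x ≥ x₀,
      (C : ℝ≥0∞) * gammaMeasure a r (Set.Ici x) ≤ gammaMeasure b r (Set.Ici x) := by
  have hb := ha.trans hab
  set K := r ^ a / Gamma a with hK
  set L := r ^ b / Gamma b with hL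
  have hL0 : 0 < L := div_pos (rpow_pos_of_pos hr _) (Gamma_pos_of_pos hb)
  obtain ⟨x₀, hx₀⟩ := eventually_atTop.1
    ((tendsto_rpow_atTop (sub_pos.2 hab)).eventually_ge_atTop (C * K / L))
  refine ⟨max x₀ 1, fun x hx => ?_⟩
  rw [gammaMeasure, gammaMeasure, withDensity_apply _ measurableSet_Ici,
    withDensity_apply _ measurableSet_Ici, ← lintegral_const_mul' _ _ ENNReal.coe_ne_top]
  refine setLIntegral_mono (measurable_gammaPDF b r) fun y hy => ?_
  have hy1 : 1 ≤ y := (le_max_right _ _).trans (hx.trans hy)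
  have hy0 : 0 < y := by linarith
  have h1 := hx₀ y ((le_max_left _ _).trans (hx.trans hy))
  rw [gammaPDF_of_nonneg hy0.le, gammaPDF_of_nonneg hy0.le, ← ENNReal.ofReal_coe_nnreal,
    ← ENNReal.ofReal_mul (by positivity), ← hK, ← hL]
  refine ENNReal.ofReal_le_ofReal ?_
  rw [div_le_iff₀ hL0] at h1
  have e1 : y ^ (b - 1) = y ^ (b - a) * y ^ (a - 1) := by
    rw [← rpow_add hy0]; congr 1; ring
  rw [e1]
  calc _ = (C * K) * (y ^ (a - 1) * exp (-(r * y))) := by ring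
    _ ≤ (y ^ (b - a) * L) * (y ^ (a - 1) * exp (-(r * y))) := by gcongr
    _ = _ := by ring

/-- Eventual domination of the tail of a sum of two gamma variables of different rates. -/
theorem exists_conv_Ici_le {q β β' r R : ℝ} (hq : 0 < q) (hβ' : 0 < β') (hβ : β' ≤ β)
    (hr : 0 < r) (hrR : r < R) : ∃ x₀, ∀ x ≥ x₀,
      (gammaMeasure q r ∗ gammaMeasure β R) (Set.Ici x) ≤
        gammaMeasure (q + β') r (Set.Ici x) := by
  have hh : 0 < β' / 2 := by positivity
  -- Only half of β' is spent on dominating the faster gamma law. The other half of the shape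
  -- parameter absorbs the constant C far out in the tail.
  obtain ⟨C, hC⟩ := exists_gammaMeasure_le hh (show β' / 2 < β by linarith) hr hrR
  obtain ⟨x₀, hx₀⟩ := exists_gammaMeasure_Ici_le (a := q + β' / 2) (b := q + β') (by positivity)
    (by linarith) hr C
  have := isProbabilityMeasure_gammaMeasure hq hr
  have := isProbabilityMeasure_gammaMeasure hh hr
  have := isProbabilityMeasure_gammaMeasure (hβ'.trans_le hβ) (hr.trans hrR)
  refine ⟨x₀, fun x hx => ?_⟩
  refine (conv_apply_le hC ENNReal.coe_ne_top measurableSet_Ici).trans ?_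
  rw [gammaMeasure_conv hq hh hr]
  exact hx₀ x hx

theorem tail_eq_of_quadMGF {μ : Measure ℝ} {w : Multiset ℝ} (h : QuadMGF μ w 0) (ε : ℝ) :
    tail w ε = μ.real (Set.Ici (ε + w.sum)) := by
  have := h.prob
  have h1 : quadLaw w = μ ∗ Measure.dirac (-w.sum) := by
    refine (quadMGF_quadLaw w).unique ?_
    simpa using h.conv (quadMGF_dirac (-w.sum))
  rw [tail, h1, Measure.conv_dirac]
  refine (map_measureReal_apply (by fun_prop) measurableSet_Ici).trans ?_
  congr 1; ext x
  simp [← sub_eq_add_neg]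

/-- The tail of the extremal quadratic form is eventually dominated by a gamma tail. -/
theorem exists_tail_le_gammaMeasure {m k : ℕ} (hm : 1 ≤ m) (hk : 1 ≤ k) {lam θ : ℝ}
    (hlam : 0 < lam) (hθ0 : 0 ≤ θ) (hθ1 : θ < 1) : ∃ ε₀, ∀ ε ≥ ε₀,
      tail (m • ((θ * (lam / m)) ::ₘ Multiset.replicate k (lam / m))) ε ≤
        (gammaMeasure (m * (k + θ ^ 2) / 2) (m / (2 * lam))).real
          {x | ε ≤ x - ∫ y, y ∂(gammaMeasure (m * (k + θ ^ 2) / 2) (m / (2 * lam)))} := by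
  have hm0 : (0 : ℝ) < m := by positivity
  have hk0 : (0 : ℝ) < k := by positivity
  have hΛ : 0 < lam / m := by positivity
  have hr : 0 < m / (2 * lam) := by positivity
  have hmk : 0 < m * k := by positivity
  have hq : (0 : ℝ) < m * k / 2 := by positivity
  have hr' : 1 / (2 * (lam / m)) = m / (2 * lam) := by field_simp
  have hmean : ∫ y, y ∂(gammaMeasure (m * (k + θ ^ 2) / 2) (m / (2 * lam))) =
      lam * (k + θ ^ 2) := by
    rw [integral_id_gammaMeasure (by positivity) hr]; field_simp
  have hset (ε : ℝ) : {x : ℝ | ε ≤ x - lam * (k + θ ^ 2)} = Set.Ici (ε + lam * (k + θ ^ 2)) := by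
    ext x; simp [le_sub_iff_add_le]
  simp only [hmean, hset]
  have hG1 := quadMGF_gammaMeasure hmk hΛ
  rw [hr', Nat.cast_mul] at hG1
  rcases hθ0.eq_or_lt with rfl | hθ0
  -- Without a remainder the form is exactly a centered gamma variable.
  · refine ⟨0, fun ε _ => ?_⟩
    have e : m • ((0 * (lam / m)) ::ₘ Multiset.replicate k (lam / m)) =
        Multiset.replicate (m * k) (lam / m) + Multiset.replicate (m * 1) 0 := by
      rw [zero_mul, ← Multiset.singleton_add, nsmul_add, add_comm, ← Multiset.replicate_one,
        Multiset.nsmul_replicate m 1, Multiset.nsmul_replicate]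
    rw [e, tail_add_replicate_zero, tail_eq_of_quadMGF hG1]
    refine le_of_eq ?_
    congr 2
    · simp
    · rw [Multiset.sum_replicate, nsmul_eq_mul]
      push_cast; field_simp; ring
  · have hG2 := quadMGF_gammaMeasure (j := m) (by omega) (mul_pos hθ0 hΛ)
    have hR' : 1 / (2 * (θ * (lam / m))) = m / (2 * lam) / θ := by field_simp
    rw [hR'] at hG2
    have hG := hG1.conv hG2
    have hrR : m / (2 * lam) < m / (2 * lam) / θ := by
      rw [lt_div_iff₀ hθ0]; exact mul_lt_of_lt_one_right hr hθ1
    obtain ⟨x₀, hx₀⟩ := exists_conv_Ici_le (q := m * k / 2) (β := m / 2) (β' := m * θ ^ 2 / 2) hq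
      (by positivity) (by nlinarith [mul_pos hm0 (show 0 < 1 - θ ^ 2 by nlinarith)]) hr hrR
    refine ⟨x₀, fun ε hε => ?_⟩
    have e : m • ((θ * (lam / m)) ::ₘ Multiset.replicate k (lam / m)) =
        Multiset.replicate (m * k) (lam / m) + Multiset.replicate m (θ * (lam / m)) := by
      rw [← Multiset.singleton_add, nsmul_add, add_comm, ← Multiset.replicate_one,
        Multiset.nsmul_replicate, Multiset.nsmul_replicate, mul_one]
    have hsum : (Multiset.replicate (m * k) (lam / m) +
        Multiset.replicate m (θ * (lam / m))).sum = lam * (k + θ) := by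
      simp only [Multiset.sum_add, Multiset.sum_replicate, nsmul_eq_mul]
      push_cast; field_simp
    rw [zero_add] at hG
    rw [e, tail_eq_of_quadMGF hG, hsum]
    have hq' : m * (k + θ ^ 2) / 2 = m * k / 2 + m * θ ^ 2 / 2 := by ring
    have := isProbabilityMeasure_gammaMeasure (a := m * (k + θ ^ 2) / 2) (by positivity) hr
    have hpos : 0 ≤ lam * (k + θ) := by positivity
    have h1 := hx₀ (ε + lam * (k + θ)) (by linarith)
    rw [← hq'] at h1
    refine (ENNReal.toReal_mono (measure_ne_top _ _) h1).trans ?_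
    -- The uncentered form has mean λ(k + θ), the gamma law λ(k + θ²). Since θ² ≤ θ, centering puts
    -- the gamma cutoff no higher, which only enlarges its event.
    refine measureReal_mono (Set.Ici_subset_Ici.2 ?_)
    have : θ ^ 2 ≤ θ := by nlinarith
    gcongr

end TraceEst

/-! ### Extremality of `Aabs` and the final assembly. -/

namespace TraceEst

open Real Filter Topology
open scoped MeasureTheory NNReal ENNReal

/-- The coefficients of a matrix with spectral norm `lam` and Frobenius norm `phi` are dominated
by the extremal ones. -/
theorem tail_le_extremal {m n : ℕ} (hm : 1 ≤ m) {lam phi ε : ℝ} (hlam : 0 < lam) (hphi : 0 ≤ phi)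
    {d : Fin n → ℝ} (hd : ∀ i, |d i| ≤ lam) (hsq : ∑ i, d i ^ 2 = phi ^ 2)
    (hε : tailThreshold phi ≤ ε) :
    tail (m • Finset.univ.val.map fun i => d i / m) ε ≤
      tail (m • ((√(rho lam phi - ⌊rho lam phi⌋₊) * (lam / m)) ::ₘ
        Multiset.replicate ⌊rho lam phi⌋₊ (lam / m))) ε := by
  have hm1 : (1 : ℝ) ≤ m := by exact_mod_cast hm
  have hm0 : (0 : ℝ) < m := by linarith
  have hV : ((Finset.univ.val.map fun i => d i / (m : ℝ)).map (· ^ 2)).sum = phi ^ 2 / m ^ 2 := by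
    rw [Multiset.map_map, ← hsq, Finset.sum_div]
    simp only [Function.comp_def, div_pow]
    rfl
  have hρ : phi ^ 2 / m ^ 2 / (lam / m) ^ 2 = rho lam phi := by
    rw [rho]; field_simp
  refine tail_nsmul_le (Λ := lam / m) (by positivity) _ (fun a ha => ?_) (by rw [hV, hρ])
    (by rw [hV, hρ]) m hphi ?_ hε
  · obtain ⟨i, -, rfl⟩ := Multiset.mem_map.1 ha
    rw [abs_div, abs_of_pos hm0]
    exact div_le_div_of_nonneg_right (hd i) hm0.le
  · rw [hV]
    -- All m copies together have square sum φ²/m ≤ φ², so the threshold for s = φ suffices.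
    calc m * (phi ^ 2 / m ^ 2) = phi ^ 2 / m := by field_simp
      _ ≤ phi ^ 2 := div_le_self (by positivity) hm1

theorem sampleLaw_Aabs_real_eq_tail {m n : ℕ} (hm : 1 ≤ m) {lam phi : ℝ}
    (hn : rho lam phi ≤ n) (ε : ℝ) :
    (sampleLaw m n).real {z | ε ≤ gaussTr m (Aabs n lam phi) z - (Aabs n lam phi).trace} =
      tail (m • ((√(rho lam phi - ⌊rho lam phi⌋₊) * (lam / m)) ::ₘ
        Multiset.replicate ⌊rho lam phi⌋₊ (lam / m))) ε := by
  have h0 : 0 ≤ rho lam phi := by unfold rho; positivity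
  rw [sampleLaw_real_eq_tail hm (Aabs_mulVec n lam phi)]
  have hk : ⌊rho lam phi⌋₊ ≤ n := by
    have := (Nat.floor_le h0).trans hn
    exact_mod_cast this
  rw [← tail_nsmul_map_ite hk (fun h => ?_)]
  · congr 3
    ext i
    split_ifs <;> ring
  · rw [h, sqrt_eq_zero_of_nonpos (by linarith), zero_mul]

end TraceEst

theorem mainTheorem3 (m : ℕ) (hm : 1 ≤ m) (lam phi : ℝ) (hlam : 0 < lam) :
    ∃ epsAbs : ℝ, ∀ (n : ℕ) (A : Matrix (Fin n) (Fin n) ℝ), A.IsSymm →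
      TraceEst.specNorm A = lam → TraceEst.frobNorm A = phi →
      ∀ ε : ℝ, epsAbs ≤ ε →
        (TraceEst.sampleLaw m n).real {z | ε ≤ |TraceEst.gaussTr m A z - A.trace|} ≤
          2 * (TraceEst.sampleLaw m n).real
            {z | ε ≤ TraceEst.gaussTr m (TraceEst.Aabs n lam phi) z
              - (TraceEst.Aabs n lam phi).trace} ∧
        2 * (TraceEst.sampleLaw m n).real
            {z | ε ≤ TraceEst.gaussTr m (TraceEst.Aabs n lam phi) z
              - (TraceEst.Aabs n lam phi).trace} ≤
          2 * (gammaMeasure (m * TraceEst.rho lam phi / 2) (m / (2 * lam))).real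
            {x | ε ≤ x - ∫ y, y ∂(gammaMeasure (m * TraceEst.rho lam phi / 2) (m / (2 * lam)))} := by
  open TraceEst in
  -- For φ < λ no matrix has these norms, so any number serves.
  rcases lt_or_ge phi lam with hlt | hle
  · refine ⟨0, fun n A _ h1 h2 => absurd (specNorm_le_frobNorm A) ?_⟩
    rw [h1, h2]
    exact hlt.not_ge
  have hphi : 0 < phi := hlam.trans_le hle
  have hρ1 : 1 ≤ rho lam phi := by
    rw [rho, one_le_div (by positivity)]
    gcongr
  have hρ0 : 0 ≤ rho lam phi := by linarith
  have hf := Nat.lt_floor_add_one (rho lam phi)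
  have hf' := Nat.floor_le hρ0
  set θ := √(rho lam phi - ⌊rho lam phi⌋₊) with hθ
  have hθ1 : θ < 1 := by
    rw [hθ, Real.sqrt_lt' one_pos]; linarith
  have hθ2 : (⌊rho lam phi⌋₊ : ℝ) + θ ^ 2 = rho lam phi := by
    rw [hθ, Real.sq_sqrt (by linarith)]; ring
  obtain ⟨ε₀, hε₀⟩ := exists_tail_le_gammaMeasure hm ((Nat.one_le_floor_iff _).2 hρ1) hlam
    (Real.sqrt_nonneg _) hθ1
  rw [hθ2] at hε₀
  refine ⟨max (tailThreshold phi) ε₀, fun n A hA h1 h2 ε hε => ?_⟩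
  have hA' : A.IsHermitian := by rwa [Matrix.IsHermitian, conjTranspose_eq_transpose_of_trivial]
  have hb := hA'.mulVec_eigenvectorBasis
  have hd (i : Fin n) : |hA'.eigenvalues i| ≤ lam := h1 ▸ abs_le_specNorm hb i
  have hsq : ∑ i, hA'.eigenvalues i ^ 2 = phi ^ 2 := by rw [← frobNorm_sq_eq hA hb, h2]
  -- Since φ² is a sum of n squared eigenvalues, each at most λ², the entries of `Aabs` fit into
  -- size n.
  have hn : rho lam phi ≤ n := by
    rw [rho, div_le_iff₀ (by positivity), ← hsq]
    calc ∑ i, hA'.eigenvalues i ^ 2 ≤ ∑ _i : Fin n, lam ^ 2 :=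
          Finset.sum_le_sum fun i _ => by rw [← sq_abs]; gcongr; exact hd i
      _ = n * lam ^ 2 := by simp
  have hε1 := (le_max_left _ _).trans hε
  rw [sampleLaw_Aabs_real_eq_tail hm hn]
  refine ⟨(sampleLaw_real_le hm hb ε).trans ?_, ?_⟩
  · rw [two_mul]
    -- The eigenvalues of -A obey the same bounds, so both one-sided tails have the same extremal
    -- majorant; this produces the factor 2.
    exact add_le_add (tail_le_extremal hm hlam hphi.le hd hsq hε1)
      (tail_le_extremal hm hlam hphi.le (fun i => by rw [abs_neg]; exact hd i)
        (by simpa only [neg_sq] using hsq) hε1)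
  · exact mul_le_mul_of_nonneg_left (hε₀ ε ((le_max_right _ _).trans hε)) two_pos.le
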